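/- Let $M$ be a connected smooth manifold (Hausdorff, second countable, without boundary) of dimension $2n+1$, with $n$ arbitrary, and let $(\varphi,\xi,\eta,g)$ be a contact pseudo-metric structure on $M$. That is, $\varphi$ is a smooth $(1,1)$-tensor field, $\xi$ a smooth vector field, $\eta$ a smooth $1$-form and $g$ a smooth pseudo-Riemannian metric such that, for some $\varepsilon\in\{1,-1\}$ and all vector fields $X,Y$, $$\eta(\xi)=1,\qquad \varphi^2X=-X+\eta(X)\xi,\qquad g(\varphi X,\varphi Y)=g(X,Y)-\varepsilon\,\eta(X)\eta(Y),\qquad d\eta(X,Y)=g(X,\varphi Y),$$ where $2\,d\eta(X,Y)=X\eta(Y)-Y\eta(X)-\eta([X,Y])$. Let $\nabla$ be the Levi-Civita connection of $g$, let $R(X,Y)=[\nabla_X,\nabla_Y]-\nabla_{[X,Y]}$ be its curvature, and put $h=\frac12\mathcal L_\xi\varphi$. Let $\kappa,\mu:M\to\mathbb R$ be smooth functions such that $M$ is a generalized $(\kappa,\mu)$-contact pseudo-metric manifold, i.e. $$R(X,Y)\xi=\varepsilon\kappa\,\bigl(\eta(Y)X-\eta(X)Y\bigr)+\varepsilon\mu\,\bigl(\eta(Y)hX-\eta(X)hY\bigr)$$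 for all vector fields $X,Y$. Assume that $M$ is not Sasakian, i.e. that $[\varphi,\varphi]+2\,d\eta\otimes\xi$ does not vanish identically on $M$, where $[\varphi,\varphi](X,Y)=\varphi^2[X,Y]+[\varphi X,\varphi Y]-\varphi[\varphi X,Y]-\varphi[X,\varphi Y]$. If there are real constants $a,b,c$ with $(a,b)\neq(0,0)$ and $a\kappa+b\mu=c$ on $M$, then $\kappa$ and $\mu$ are constant. -/

import Mathlib

open Bundle VectorField
open scoped Manifold ContDiff

noncomputable section

namespace ContactPseudo

section VectorFields

variable {m : ℕ} {M : Type*} [TopologicalSpace M] [ChartedSpace (EuclideanSpace ℝ (Fin m)) M]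

/-- The derivative `X f` of a function `f` along a vector field `X`. -/
def dirDeriv (X : ∀ x : M, TangentSpace (𝓡 m) x) (f : M → ℝ) (x : M) : ℝ :=
  mvfderiv (𝓡 m) f x (X x)

/-- The Lie bracket `[X, Y]` of vector fields. -/
def bracket (X Y : ∀ x : M, TangentSpace (𝓡 m) x) : ∀ x : M, TangentSpace (𝓡 m) x :=
  mlieBracket (𝓡 m) X Y

/-- `X` is a smooth vector field on the `m`-dimensional manifold `M`. -/
def IsSmoothField [IsManifold (𝓡 m) ∞ M] (X : ∀ x : M, TangentSpace (𝓡 m) x) : Prop :=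
  ContMDiff (𝓡 m) ((𝓡 m).prod 𝓘(ℝ, EuclideanSpace ℝ (Fin m))) ∞
    (fun x ↦ (⟨x, X x⟩ : TangentBundle (𝓡 m) M))

end VectorFields

variable (m : ℕ) (M : Type*) [TopologicalSpace M] [ChartedSpace (EuclideanSpace ℝ (Fin m)) M]
  [IsManifold (𝓡 m) ∞ M]

/-- A smooth pseudo-Riemannian metric: a smooth field of nondegenerate symmetric bilinear forms on
the tangent spaces. -/
structure PseudoRiemannianMetric where
  /-- The scalar product on each tangent space. -/
  inner (x : M) : TangentSpace (𝓡 m) x →L[ℝ] TangentSpace (𝓡 m) x →L[ℝ] ℝ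
  symm (x : M) (v w : TangentSpace (𝓡 m) x) : inner x v w = inner x w v
  nondegenerate (x : M) (v : TangentSpace (𝓡 m) x) (hv : ∀ w, inner x v w = 0) : v = 0
  contMDiff : ContMDiff (𝓡 m)
    ((𝓡 m).prod 𝓘(ℝ, EuclideanSpace ℝ (Fin m) →L[ℝ] EuclideanSpace ℝ (Fin m) →L[ℝ] ℝ)) ∞
    (fun x ↦ TotalSpace.mk' (EuclideanSpace ℝ (Fin m) →L[ℝ] EuclideanSpace ℝ (Fin m) →L[ℝ] ℝ)
      (E := fun x : M ↦ TangentSpace (𝓡 m) x →L[ℝ] TangentSpace (𝓡 m) x →L[ℝ] ℝ) x (inner x))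

variable {m M}

namespace PseudoRiemannianMetric

variable (g : PseudoRiemannianMetric m M)

/-- The function `g(X, Y)`. -/
def pair (X Y : ∀ x : M, TangentSpace (𝓡 m) x) (x : M) : ℝ := g.inner x (X x) (Y x)

/-- The right-hand side of the Koszul formula for `2 g(∇_X Y, Z)`. -/
def koszul (X Y Z : ∀ x : M, TangentSpace (𝓡 m) x) (x : M) : ℝ :=
  dirDeriv X (g.pair Y Z) x + dirDeriv Y (g.pair Z X) x - dirDeriv Z (g.pair X Y) x
    + g.pair (bracket X Y) Z x - g.pair (bracket Y Z) X x + g.pair (bracket Z X) Y x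

theorem pair_md {X Y : ∀ x : M, TangentSpace (𝓡 m) x} {x : M}
    (hX : MDifferentiableAt (𝓡 m) ((𝓡 m).prod 𝓘(ℝ, EuclideanSpace ℝ (Fin m))) (fun y ↦ (⟨y, X y⟩ : TangentBundle (𝓡 m) M)) x) 
    (hY : MDifferentiableAt (𝓡 m) ((𝓡 m).prod 𝓘(ℝ, EuclideanSpace ℝ (Fin m))) (fun y ↦ (⟨y, Y y⟩ : TangentBundle (𝓡 m) M)) x) : MDifferentiableAt (𝓡 m) 𝓘(ℝ, ℝ) (g.pair X Y) x := by
  have hg := (g.contMDiff x).mdifferentiableAt (by simp)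
  have := MDifferentiableAt.clm_bundle_apply₂ (F₁ := EuclideanSpace ℝ (Fin m)) (F₂ := EuclideanSpace ℝ (Fin m)) (F₃ := ℝ) (E₃ := fun _ : M => ℝ) hg hX hY
  rw [mdifferentiableAt_totalSpace] at this
  exact this.2

theorem koszul_tensorial {X Y : ∀ x : M, TangentSpace (𝓡 m) x} {x : M}
    (hX : MDifferentiableAt (𝓡 m) ((𝓡 m).prod 𝓘(ℝ, EuclideanSpace ℝ (Fin m))) (fun y ↦ (⟨y, X y⟩ : TangentBundle (𝓡 m) M)) x) 
    (hY : MDifferentiableAt (𝓡 m) ((𝓡 m).prod 𝓘(ℝ, EuclideanSpace ℝ (Fin m))) (fun y ↦ (⟨y, Y y⟩ : TangentBundle (𝓡 m) M)) x) :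
    haveI : IsManifold (𝓡 m) 1 M := .of_le (n := ∞) (by simp)
    TensorialAt (𝓡 m) (EuclideanSpace ℝ (Fin m)) (fun Z => g.koszul X Y Z x) x := by
  have : IsManifold (𝓡 m) 1 M := .of_le (n := ∞) (by simp)
  have : IsManifold (𝓡 m) 2 M := .of_le (n := ∞) (by exact WithTop.coe_le_coe.2 le_top)
  constructor
  · intro f Z hf hZ
    have e1 : g.pair Y (f • Z) = f * g.pair Y Z := by ext; simp [pair]
    have e2 : g.pair (f • Z) X = f * g.pair Z X := by ext; simp [pair]
    simp only [koszul, e1, e2, dirDeriv, bracket, pair]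
    rw [mvfderiv_mul hf (g.pair_md hY hZ), mvfderiv_mul hf (g.pair_md hZ hX),
      mlieBracket_smul_right hf hZ, mlieBracket_smul_left hf hZ]
    simp [pair, g.symm x (Z x) (X x), g.symm x (Z x) (Y x)]
    ring
  · intro Z W hZ hW
    have e1 : g.pair Y (Z + W) = g.pair Y Z + g.pair Y W := by ext; simp [pair]
    have e2 : g.pair (Z + W) X = g.pair Z X + g.pair W X := by ext; simp [pair]
    simp only [koszul, e1, e2, dirDeriv, bracket, pair]
    rw [mvfderiv_add (g.pair_md hY hZ) (g.pair_md hY hW), mvfderiv_add (g.pair_md hZ hX) (g.pair_md hW hX),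
      mlieBracket_add_right hZ hW, mlieBracket_add_left hZ hW]
    simp
    ring

/-- For smooth `X` and `Y` the Koszul formula is solvable for `∇_X Y` at every point. -/
theorem exists_koszul {X Y : ∀ x : M, TangentSpace (𝓡 m) x} (x : M)
    (hX : IsSmoothField X) (hY : IsSmoothField Y) :
    ∃ w : TangentSpace (𝓡 m) x, ∀ Z : ∀ y : M, TangentSpace (𝓡 m) y,
      IsSmoothField Z → 2 * g.inner x w (Z x) = g.koszul X Y Z x := by
  have : IsManifold (𝓡 m) 1 M := .of_le (n := ∞) (by simp)
  have hT := g.koszul_tensorial ((hX x).mdifferentiableAt (by simp)) ((hY x).mdifferentiableAt (by simp))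
  let k := TensorialAt.mkHom _ x hT
  let L : TangentSpace (𝓡 m) x →ₗ[ℝ] (TangentSpace (𝓡 m) x →ₗ[ℝ] ℝ) :=
    { toFun := fun v => (g.inner x v).toLinearMap
      map_add' := by intros; ext; simp
      map_smul' := by intros; ext; simp }
  have : FiniteDimensional ℝ (TangentSpace (𝓡 m) x) := inferInstanceAs (FiniteDimensional ℝ (EuclideanSpace ℝ (Fin m)))
  have inj : Function.Injective L := by
    rw [← LinearMap.ker_eq_bot, LinearMap.ker_eq_bot']
    intro v hv
    exact g.nondegenerate x v fun w => by simpa [L] using congrArg (fun q => q w) hv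
  have sur : Function.Surjective L :=
    (LinearMap.injective_iff_surjective_of_finrank_eq_finrank (Subspace.dual_finrank_eq).symm).1 inj
  obtain ⟨w, hw⟩ := sur ((1/2 : ℝ) • k.toLinearMap)
  refine ⟨w, fun Z hZ => ?_⟩
  have h1 : g.inner x w (Z x) = (1/2 : ℝ) * k (Z x) := by simpa [L] using congrArg (fun q => q (Z x)) hw
  have h2 : k (Z x) = g.koszul X Y Z x := TensorialAt.mkHom_apply hT ((hZ x).mdifferentiableAt (by simp))
  rw [h1, ← h2]; ring
open Classical in
/-- The Levi-Civita connection `∇_X Y` of `g`, for smooth vector fields `X` and `Y`: its value at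
`x` is the vector `w` determined by the Koszul formula `2 g(w, Z) = koszul X Y Z`, for all smooth
vector fields `Z`. (There is exactly one such `w`; the value `0` is never used for smooth `X`
and `Y`.) -/
def nabla (X Y : ∀ x : M, TangentSpace (𝓡 m) x) (x : M) : TangentSpace (𝓡 m) x :=
  if hw : ∃ w : TangentSpace (𝓡 m) x, ∀ Z : ∀ y : M, TangentSpace (𝓡 m) y,
      IsSmoothField Z → 2 * g.inner x w (Z x) = g.koszul X Y Z x
  then hw.choose else 0

/-- The curvature `R(X, Y) Z = ∇_X ∇_Y Z - ∇_Y ∇_X Z - ∇_[X, Y] Z`. -/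
def curvature (X Y Z : ∀ x : M, TangentSpace (𝓡 m) x) (x : M) : TangentSpace (𝓡 m) x :=
  g.nabla X (g.nabla Y Z) x - g.nabla Y (g.nabla X Z) x - g.nabla (bracket X Y) Z x

end PseudoRiemannianMetric

/-- The exterior derivative of a 1-form, evaluated on vector fields, with the convention
`2 dη(X, Y) = X η(Y) - Y η(X) - η([X, Y])`. -/
def dForm (η : ∀ x : M, TangentSpace (𝓡 m) x →L[ℝ] ℝ)
    (X Y : ∀ x : M, TangentSpace (𝓡 m) x) (x : M) : ℝ :=
  (1 / 2) * (dirDeriv X (fun y ↦ η y (Y y)) x - dirDeriv Y (fun y ↦ η y (X y)) x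
    - η x (bracket X Y x))

section Structures

variable (n : ℕ) (M : Type*) [TopologicalSpace M]
  [ChartedSpace (EuclideanSpace ℝ (Fin (2 * n + 1))) M] [IsManifold (𝓡 (2 * n + 1)) ∞ M]

/-- An almost contact pseudo-metric structure `(φ, ξ, η, g)` with `g(ξ, ξ) = ε = ±1` on a manifold
of dimension `2n+1`. -/
structure AlmostContactPseudoMetric where
  /-- The sign `ε`. -/
  ε : ℝ
  ε_eq : ε = 1 ∨ ε = -1
  /-- The (1,1)-tensor field. -/
  φ (x : M) : TangentSpace (𝓡 (2 * n + 1)) x →L[ℝ] TangentSpace (𝓡 (2 * n + 1)) x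
  /-- The characteristic vector field. -/
  ξ (x : M) : TangentSpace (𝓡 (2 * n + 1)) x
  /-- The 1-form. -/
  η (x : M) : TangentSpace (𝓡 (2 * n + 1)) x →L[ℝ] ℝ
  /-- The compatible metric. -/
  g : PseudoRiemannianMetric (2 * n + 1) M
  φ_smooth : ContMDiff (𝓡 (2 * n + 1)) ((𝓡 (2 * n + 1)).prod
      𝓘(ℝ, EuclideanSpace ℝ (Fin (2 * n + 1)) →L[ℝ] EuclideanSpace ℝ (Fin (2 * n + 1)))) ∞
    (fun x ↦ TotalSpace.mk'
      (EuclideanSpace ℝ (Fin (2 * n + 1)) →L[ℝ] EuclideanSpace ℝ (Fin (2 * n + 1)))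
      (E := fun x : M ↦ TangentSpace (𝓡 (2 * n + 1)) x →L[ℝ] TangentSpace (𝓡 (2 * n + 1)) x)
      x (φ x))
  ξ_smooth : IsSmoothField ξ
  η_smooth : ContMDiff (𝓡 (2 * n + 1)) ((𝓡 (2 * n + 1)).prod
      𝓘(ℝ, EuclideanSpace ℝ (Fin (2 * n + 1)) →L[ℝ] ℝ)) ∞
    (fun x ↦ TotalSpace.mk' (EuclideanSpace ℝ (Fin (2 * n + 1)) →L[ℝ] ℝ)
      (E := fun x : M ↦ TangentSpace (𝓡 (2 * n + 1)) x →L[ℝ] ℝ) x (η x))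
  η_ξ (x : M) : η x (ξ x) = 1
  φ_φ (x : M) (v : TangentSpace (𝓡 (2 * n + 1)) x) : φ x (φ x v) = -v + η x v • ξ x
  compatible (x : M) (v w : TangentSpace (𝓡 (2 * n + 1)) x) :
    g.inner x (φ x v) (φ x w) = g.inner x v w - ε * η x v * η x w

/-- A contact pseudo-metric structure: an almost contact pseudo-metric structure with `dη = Φ`,
where `Φ(X, Y) = g(X, φ Y)`. -/
structure ContactPseudoMetric extends AlmostContactPseudoMetric n M where
  contact (X Y : ∀ x : M, TangentSpace (𝓡 (2 * n + 1)) x) (hX : IsSmoothField X)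
    (hY : IsSmoothField Y) (x : M) : dForm η X Y x = g.inner x (X x) (φ x (Y x))

variable {n M}

namespace ContactPseudoMetric

variable (S : ContactPseudoMetric n M)

/-- The vector field `φ X`. -/
def φf (X : ∀ x : M, TangentSpace (𝓡 (2 * n + 1)) x) (x : M) : TangentSpace (𝓡 (2 * n + 1)) x :=
  S.φ x (X x)

/-- The tensor `h = (1/2) 𝓛_ξ φ`, that is `h X = (1/2) ([ξ, φ X] - φ [ξ, X])`. -/
def h (X : ∀ x : M, TangentSpace (𝓡 (2 * n + 1)) x) (x : M) : TangentSpace (𝓡 (2 * n + 1)) x :=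
  (1 / 2 : ℝ) • (bracket S.ξ (S.φf X) x - S.φ x (bracket S.ξ X x))

/-- The torsion `[φ, φ]` of `φ`:
`[φ, φ](X, Y) = φ² [X, Y] + [φ X, φ Y] - φ [φ X, Y] - φ [X, φ Y]`. -/
def nijenhuis (X Y : ∀ x : M, TangentSpace (𝓡 (2 * n + 1)) x) (x : M) :
    TangentSpace (𝓡 (2 * n + 1)) x :=
  S.φ x (S.φ x (bracket X Y x)) + bracket (S.φf X) (S.φf Y) x
    - S.φ x (bracket (S.φf X) Y x) - S.φ x (bracket X (S.φf Y) x)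

/-- A contact pseudo-metric structure is Sasakian if it is normal: `[φ, φ] + 2 dη ⊗ ξ = 0`. -/
def IsSasakian : Prop :=
  ∀ X Y : ∀ x : M, TangentSpace (𝓡 (2 * n + 1)) x, IsSmoothField X → IsSmoothField Y →
    ∀ x, S.nijenhuis X Y x + (2 * dForm S.η X Y x) • S.ξ x = 0

/-- The contact pseudo-metric structure is a generalized `(κ, μ)`-structure: `κ` and `μ` are smooth
functions and `R(X, Y) ξ = ε κ (η(Y) X - η(X) Y) + ε μ (η(Y) h X - η(X) h Y)`. -/
def IsGeneralizedKappaMu (κ μ : M → ℝ) : Prop :=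
  ContMDiff (𝓡 (2 * n + 1)) 𝓘(ℝ, ℝ) ∞ κ ∧ ContMDiff (𝓡 (2 * n + 1)) 𝓘(ℝ, ℝ) ∞ μ ∧
  ∀ X Y : ∀ x : M, TangentSpace (𝓡 (2 * n + 1)) x, IsSmoothField X → IsSmoothField Y →
    ∀ x, S.g.curvature X Y S.ξ x =
      (S.ε * κ x) • (S.η x (Y x) • X x - S.η x (X x) • Y x)
        + (S.ε * μ x) • (S.η x (Y x) • S.h X x - S.η x (X x) • S.h Y x)

end ContactPseudoMetric

end Structures

end ContactPseudo

end

open Bundle VectorField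
open scoped Manifold ContDiff Topology

noncomputable section

/-! Write `∇ξ = s - εφ` with `s` self-adjoint. Closedness of the fundamental form makes `s`
anticommute with `φ`, so that `h = φs`; the curvature hypothesis gives `s² = λ` on `ker η`, where `λ
= 1 - εκ`, together with `ξκ = 0` and a Codazzi equation for `s`. The differentials of `κ` and `μ`
along `ker η` are compared through the second Bianchi identity on `X, Y, ξ`, applied to `ξ`
(`bianchi_hor`).

Where `λ ≠ 0`, `s` is invertible on `ker η`, the horizontal part of `∇φ` vanishes (`P_s_left`), and
the Bianchi identity becomes `Xκ = (hX)μ` (`ev_lie_κ`). If `b ≠ 0`, then `μ = uκ + v` and `h² = λ`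
give `Xκ = u²λ Xκ`; near a point with `Xκ ≠ 0` this makes `λ` constant, which is absurd. Hence `κ`
is constant (`κ_const_of_linear`), and so is `μ`. If `b = 0`, then `κ` is constant. When `λ ≠ 0`,
the same relation applied to `hX` gives `λ Xμ = 0`, and `ξμ = 0` follows because `ker η` is not
integrable.

There remains `κ = ε`, where `s² = 0`. In definite signature this forces `s = 0`; here it does not.
At points where `s ≠ 0` the Bianchi identity still gives `dμ = 0` on `ker η` (`ev_lie_μ`), so a
nonconstant `μ` makes `s` vanish on a nonempty open set. Modulo terms of order zero in `s`, the
components of `s` satisfy Cauchy-Riemann equations along `ker η` (`cauchyRiemann_mem`) and are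
constant along `ξ` (`lie_ξ_S_mem`). Such systems have unique continuation
(`CRSystem.eventually_eq_zero`), so `s = 0` everywhere, and then the structure is normal
(`nijenhuis_eq_zero`), which is excluded.

Unique continuation comes from a maximum principle. For an almost holomorphic vector `w`, `log |w|²`
is subharmonic up to controlled errors, so `|w|² exp (N exp (-αρ))` has no positive local maximum
where `ρ` is noncritical; letting `N → ∞` spreads the zeros of `w`.

The tensor calculus is carried out over an abstract Lie-Rinehart pair, where every identity is a
computation in modules over a commutative ring. -/

namespace ContactPseudo

/-! ### Contact pseudo-metric identities over a Lie-Rinehart pair -/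

/-- The algebraic data of a generalized `(κ, μ)`-contact pseudo-metric structure with its
Levi-Civita connection, over a Lie-Rinehart pair `(A, L)` (smooth functions and vector fields). -/
structure KappaMuAlgebra (A L : Type*) [CommRing A] [LieRing L] [Module A L] [LieRingModule L A]
    [LieRinehartRing A L] where
  /-- the metric -/
  g : L →ₗ[A] L →ₗ[A] A
  /-- the Levi-Civita connection -/
  nab : L → L → L
  /-- the structure tensor -/
  φ : L →ₗ[A] L
  /-- the characteristic field -/
  ξ : L
  /-- the contact form -/
  η : L →ₗ[A] A
  /-- the sign -/
  e : A
  /-- the first coefficient function -/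
  κ : A
  /-- the second coefficient function -/
  μ : A
  /-- half the Lie derivative of `φ` along `ξ` -/
  h : L → L
  two_cancel (a : A) : 2 * a = 0 → a = 0
  g_symm (X Y : L) : g X Y = g Y X
  g_nondeg (X : L) : (∀ Z, g X Z = 0) → X = 0
  nab_add_right (X Y Z : L) : nab X (Y + Z) = nab X Y + nab X Z
  nab_smul_right (X Y : L) (f : A) : nab X (f • Y) = f • nab X Y + ⁅X, f⁆ • Y
  nab_add_left (X Y Z : L) : nab (X + Y) Z = nab X Z + nab Y Z
  nab_smul_left (X Y : L) (f : A) : nab (f • X) Y = f • nab X Y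
  metric (X Y Z : L) : ⁅X, g Y Z⁆ = g (nab X Y) Z + g Y (nab X Z)
  torsion (X Y : L) : nab X Y - nab Y X = ⁅X, Y⁆
  e_sq : e * e = 1
  lie_e (X : L) : ⁅X, e⁆ = 0
  η_ξ : η ξ = 1
  φ_ξ : φ ξ = 0
  φ_φ (X : L) : φ (φ X) = -X + η X • ξ
  compat (X Y : L) : g (φ X) (φ Y) = g X Y - e * η X * η Y
  contact (X Y : L) : ⁅X, η Y⁆ - ⁅Y, η X⁆ - η ⁅X, Y⁆ = 2 * g X (φ Y)
  h_def (X : L) : (2 : A) • h X = ⁅ξ, φ X⁆ - φ ⁅ξ, X⁆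
  curv_ξ (X Y : L) : nab X (nab Y ξ) - nab Y (nab X ξ) - nab ⁅X, Y⁆ ξ =
    (e * κ) • (η Y • X - η X • Y) + (e * μ) • (η Y • h X - η X • h Y)

namespace KappaMuAlgebra

variable {A L : Type*} [CommRing A] [LieRing L] [Module A L] [LieRingModule L A]
  [LieRinehartRing A L] (C : KappaMuAlgebra A L)

theorem lie_one' (X : L) : ⁅X, (1 : A)⁆ = 0 := by
  have h := LieRinehartRing.leibniz_mul_right X (1 : A) 1
  simp only [mul_one, smul_eq_mul, one_mul] at h
  linear_combination -h

theorem lie_two {A L : Type*} [CommRing A] [LieRing L] [LieRingModule L A] (X : L) (a : A) : ⁅X, 2 * a⁆ = 2 * ⁅X, a⁆ := by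
  rw [two_mul, lie_add, two_mul]

theorem two_inj (C : KappaMuAlgebra A L) {a b : A} (h : 2 * a = 2 * b) : a = b :=
  sub_eq_zero.1 (C.two_cancel _ (by linear_combination h))

theorem ext_g {X Y : L} (h : ∀ Z, C.g X Z = C.g Y Z) : X = Y :=
  sub_eq_zero.1 (C.g_nondeg _ fun Z => by simp [h Z])

theorem nab_neg_right (X Y : L) : C.nab X (-Y) = -C.nab X Y := by
  have h := C.nab_smul_right X Y (-1 : A)
  rw [lie_neg, lie_one'] at h
  simpa using h

theorem nab_sub_right (X Y Z : L) : C.nab X (Y - Z) = C.nab X Y - C.nab X Z := by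
  rw [sub_eq_add_neg, C.nab_add_right, C.nab_neg_right, ← sub_eq_add_neg]

theorem nab_neg_left (X Y : L) : C.nab (-X) Y = -C.nab X Y := by
  have h := C.nab_smul_left X Y (-1 : A)
  simpa using h

theorem nab_sub_left (X Y Z : L) : C.nab (X - Y) Z = C.nab X Z - C.nab Y Z := by
  rw [sub_eq_add_neg, C.nab_add_left, C.nab_neg_left, ← sub_eq_add_neg]

theorem g_ξ (X : L) : C.g X C.ξ = C.e * C.η X := by
  have h := C.compat X C.ξ
  rw [C.φ_ξ, C.η_ξ] at h
  simp only [map_zero] at h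
  linear_combination -h

theorem η_eq (X : L) : C.η X = C.e * C.g X C.ξ := by
  rw [C.g_ξ]; linear_combination (-C.η X) * C.e_sq

theorem η_φ (X : L) : C.η (C.φ X) = 0 := by
  have h1 := C.φ_φ (C.φ X)
  rw [C.φ_φ X] at h1
  simp only [map_add, map_neg, map_smul, C.φ_ξ, smul_zero, add_zero] at h1
  have h2 : C.η (C.φ X) • C.ξ = 0 := by simpa using h1.symm
  simpa [C.η_ξ] using congrArg C.η h2

theorem φ_skew (X Y : L) : C.g (C.φ X) Y = -C.g X (C.φ Y) := by
  have h := C.compat X (C.φ Y)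
  rw [C.φ_φ, C.η_φ] at h
  simp only [map_add, map_neg, map_smul, smul_eq_mul, C.g_ξ, C.η_φ] at h
  linear_combination -h

theorem φ_skew' (X Y : L) : C.g X (C.φ Y) = -C.g (C.φ X) Y := by
  rw [C.φ_skew, neg_neg]

theorem nab_ξ_skew (X Y : L) :
    C.g (C.nab X C.ξ) Y - C.g (C.nab Y C.ξ) X = 2 * C.e * C.g X (C.φ Y) := by
  have h := C.contact X Y
  rw [C.η_eq X, C.η_eq Y, C.η_eq ⁅X, Y⁆, ← C.torsion X Y] at h
  simp only [LieRinehartRing.leibniz_mul_right, C.lie_e, C.metric, map_sub,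
    LinearMap.sub_apply, smul_eq_mul] at h
  rw [C.g_symm X, C.g_symm Y] at h
  linear_combination C.e * h -
    (C.g (C.nab X C.ξ) Y - C.g (C.nab Y C.ξ) X) * C.e_sq

/-- The symmetric part `s` of `∇ξ`. -/
def s : L →ₗ[A] L where
  toFun X := C.nab X C.ξ + C.e • C.φ X
  map_add' X Y := by rw [C.nab_add_left, map_add, smul_add]; abel
  map_smul' f X := by
    rw [C.nab_smul_left, map_smul, smul_comm, smul_add]; rfl

theorem s_apply (X : L) : C.s X = C.nab X C.ξ + C.e • C.φ X := rfl

theorem nab_ξ (X : L) : C.nab X C.ξ = C.s X - C.e • C.φ X := by simp [s_apply]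

theorem s_symm (X Y : L) : C.g (C.s X) Y = C.g X (C.s Y) := by
  have h := C.nab_ξ_skew X Y
  rw [C.g_symm X (C.s Y)]
  simp only [s_apply, map_add, LinearMap.add_apply, map_smul, LinearMap.smul_apply, smul_eq_mul]
  rw [C.φ_skew X Y, C.g_symm (C.φ Y) X]
  linear_combination h

theorem lie_g_ξ_ξ (X : L) : C.g (C.nab X C.ξ) C.ξ = 0 := by
  have h := C.metric X C.ξ C.ξ
  rw [C.g_ξ C.ξ, C.η_ξ, mul_one, C.lie_e, C.g_symm C.ξ] at h
  exact C.two_cancel _ (by linear_combination -h)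

theorem nab_ξ_ξ : C.nab C.ξ C.ξ = 0 := by
  refine C.g_nondeg _ fun Z => ?_
  have h := C.nab_ξ_skew C.ξ Z
  rw [C.lie_g_ξ_ξ, C.g_symm C.ξ, C.g_ξ, C.η_φ] at h
  linear_combination h

@[simp] theorem s_ξ : C.s C.ξ = 0 := by simp [s_apply, C.nab_ξ_ξ, C.φ_ξ]

theorem η_s (X : L) : C.η (C.s X) = 0 := by
  rw [C.η_eq, C.s_symm, C.s_ξ]; simp

theorem η_nab_ξ (X : L) : C.η (C.nab X C.ξ) = 0 := by
  rw [C.η_eq, C.lie_g_ξ_ξ, mul_zero]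

/-- The fundamental form is exact, hence closed: differentiate the contact condition and apply `η`
to the Jacobi identity. -/
theorem dω (X Y Z : L) :
    ⁅X, C.g Y (C.φ Z)⁆ + ⁅Y, C.g Z (C.φ X)⁆ + ⁅Z, C.g X (C.φ Y)⁆
      - C.g ⁅X, Y⁆ (C.φ Z) - C.g ⁅Y, Z⁆ (C.φ X) - C.g ⁅Z, X⁆ (C.φ Y) = 0 := by
  apply C.two_cancel
  have e1 := congrArg (fun a : A => ⁅X, a⁆) (C.contact Y Z)
  have e2 := congrArg (fun a : A => ⁅Y, a⁆) (C.contact Z X)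
  have e3 := congrArg (fun a : A => ⁅Z, a⁆) (C.contact X Y)
  have f1 := C.contact ⁅X, Y⁆ Z
  have f2 := C.contact ⁅Y, Z⁆ X
  have f3 := C.contact ⁅Z, X⁆ Y
  have j := congrArg C.η (lie_jacobi X Y Z)
  have r1 : ⁅⁅X, Y⁆, Z⁆ = -⁅Z, ⁅X, Y⁆⁆ := (lie_skew _ _).symm
  have r2 : ⁅⁅Y, Z⁆, X⁆ = -⁅X, ⁅Y, Z⁆⁆ := (lie_skew _ _).symm
  have r3 : ⁅⁅Z, X⁆, Y⁆ = -⁅Y, ⁅Z, X⁆⁆ := (lie_skew _ _).symm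
  rw [r1, lie_lie] at f1
  rw [r2, lie_lie] at f2
  rw [r3, lie_lie] at f3
  simp only [lie_sub, lie_two, map_neg, map_add, map_zero] at e1 e2 e3 f1 f2 f3 j
  linear_combination -e1 - e2 - e3 + f1 + f2 + f3 - j

/-- The covariant derivative of `φ`, as a trilinear form `g((∇_X φ) Y, Z)`. -/
def P (X Y Z : L) : A := C.g (C.nab X (C.φ Y)) Z - C.g (C.φ (C.nab X Y)) Z

theorem P_skew (X Y Z : L) : C.P X Y Z = -C.P X Z Y := by
  have h1 := C.metric X (C.φ Y) Z
  have h2 := C.metric X Y (C.φ Z)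
  have h3 := congrArg (fun a : A => ⁅X, a⁆) (C.φ_skew Y Z)
  simp only [lie_neg] at h3
  simp only [P]
  rw [C.φ_skew (C.nab X Y), C.φ_skew (C.nab X Z), C.g_symm (C.nab X (C.φ Z)) Y,
    C.g_symm (C.nab X Z) (C.φ Y)]
  linear_combination -h1 - h2 + h3

/-- Closedness of the fundamental form, with brackets replaced by covariant derivatives through
torsion-freeness. -/
theorem P_cyc (X Y Z : L) : C.P X Y Z + C.P Y Z X + C.P Z X Y = 0 := by
  have h := C.dω X Y Z
  simp only [C.metric, ← C.torsion, map_sub, LinearMap.sub_apply] at h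
  have h1 := C.P_skew X Y Z
  have h2 := C.P_skew Y Z X
  have h3 := C.P_skew Z X Y
  rw [h1, h2, h3]
  simp only [P, C.φ_skew]
  rw [C.g_symm (C.nab X (C.φ Z)) Y, C.g_symm (C.nab Y (C.φ X)) Z,
    C.g_symm (C.nab Z (C.φ Y)) X]
  linear_combination -h

theorem lie_ξ_η (Y : L) : ⁅C.ξ, C.η Y⁆ = C.η ⁅C.ξ, Y⁆ := by
  have h := C.contact C.ξ Y
  rw [C.η_ξ, lie_one', C.g_symm, C.g_ξ, C.η_φ] at h
  linear_combination h

/-- The fundamental form is invariant under `ξ`, so the Lie derivative of `φ` compensates that of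
`g`, which is `2 g(s·, ·)`. -/
theorem lieφ_eq (Y : L) : ⁅C.ξ, C.φ Y⁆ - C.φ ⁅C.ξ, Y⁆ = -((2 : A) • C.s (C.φ Y)) := by
  refine C.ext_g fun X => ?_
  have h := C.dω C.ξ X Y
  have z : ∀ W, C.g C.ξ (C.φ W) = 0 := fun W => by rw [C.g_symm, C.g_ξ, C.η_φ, mul_zero]
  have e1 : C.nab C.ξ X = ⁅C.ξ, X⁆ + C.nab X C.ξ := by rw [← C.torsion]; abel
  have e2 : C.nab C.ξ (C.φ Y) = ⁅C.ξ, C.φ Y⁆ + C.nab (C.φ Y) C.ξ := by rw [← C.torsion]; abel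
  rw [C.φ_ξ, z, C.metric, e1, e2, C.nab_ξ, C.nab_ξ] at h
  have e4 : C.g ⁅Y, C.ξ⁆ (C.φ X) = C.g X (C.φ ⁅C.ξ, Y⁆) := by
    rw [← lie_skew, map_neg, LinearMap.neg_apply, C.φ_skew', neg_neg, C.g_symm]
  have e5 : C.g ⁅X, Y⁆ 0 = 0 := map_zero _
  simp only [map_zero, lie_zero, map_add, map_sub, LinearMap.add_apply, LinearMap.sub_apply,
    map_smul, LinearMap.smul_apply, smul_eq_mul, e4] at h
  have e6 := C.φ_skew X (C.φ Y)
  have e7 := C.s_symm X (C.φ Y)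
  simp only [map_sub, LinearMap.sub_apply, map_neg, LinearMap.neg_apply, map_smul,
    LinearMap.smul_apply, smul_eq_mul]
  rw [C.g_symm _ X, C.g_symm _ X, C.g_symm _ X]
  linear_combination h + C.e * e6 - e7

/-- The Lie derivative of `φ² = -id + η ⊗ ξ` along `ξ` vanishes, so the Lie derivative of `φ`, which
is `-2sφ`, anticommutes with `φ`. -/
theorem φ_s (X : L) : C.φ (C.s X) = -C.s (C.φ X) := by
  have a1 := C.lieφ_eq (C.φ X)
  have a2 := congrArg C.φ (C.lieφ_eq X)
  have a3 := C.lie_ξ_η X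
  have e1 : ∀ Y, C.s (C.φ (C.φ Y)) = -C.s Y := fun Y => by rw [C.φ_φ]; simp
  rw [map_sub, C.φ_φ ⁅C.ξ, X⁆] at a2
  rw [C.φ_φ X, lie_add, lie_neg, LieRinehartRing.leibniz_smul_right, lie_self, a3] at a1
  have key : C.s X = C.φ (C.s (C.φ X)) := by
    refine C.ext_g fun Z => C.two_inj ?_
    have := congrArg (fun W => C.g W Z) (congrArg₂ (· + ·) a1 a2)
    simp only [map_add, map_sub, map_neg, map_smul, LinearMap.add_apply, LinearMap.sub_apply,
      LinearMap.neg_apply, LinearMap.smul_apply, smul_eq_mul, C.s_ξ, smul_zero, map_zero,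
      LinearMap.zero_apply] at this
    linear_combination -this
  rw [key, C.φ_φ, C.η_s]; simp

theorem h_eq (X : L) : C.h X = C.φ (C.s X) := by
  refine C.ext_g fun Z => C.two_inj ?_
  have h := congrArg (fun W => C.g W Z) ((C.h_def X).trans (C.lieφ_eq X))
  simp only [map_neg, map_smul, LinearMap.neg_apply, LinearMap.smul_apply, smul_eq_mul] at h
  rw [C.φ_s]
  simp only [map_neg, LinearMap.neg_apply]
  linear_combination h

theorem φs_symm (X Y : L) : C.g (C.φ (C.s X)) Y = C.g X (C.φ (C.s Y)) := by
  rw [C.φ_skew, C.s_symm, C.φ_s]; simp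

theorem s_φ_φ (X : L) : C.s (C.φ (C.φ X)) = -C.s X := by rw [C.φ_φ]; simp

theorem φ_φ_s (X : L) : C.φ (C.φ (C.s X)) = -C.s X := by rw [C.φ_φ, C.η_s]; simp

theorem P_ξ (X Y : L) : C.P C.ξ X Y = 0 := by
  have h := C.P_cyc C.ξ X Y
  have h1 : C.P X Y C.ξ = C.g (C.nab X C.ξ) (C.φ Y) * (-1) := by
    have := C.metric X (C.φ Y) C.ξ
    rw [C.g_ξ, C.η_φ, mul_zero, lie_zero] at this
    simp only [P]
    rw [C.g_ξ (C.φ _), C.η_φ, C.g_symm (C.nab X C.ξ)]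
    linear_combination -this
  have h2 : C.P Y C.ξ X = C.g (C.nab Y C.ξ) (C.φ X) := by
    simp only [P]
    rw [C.φ_ξ, C.φ_skew]
    have := C.nab_add_right Y 0 0
    simp at this
    rw [this]; simp
  rw [h1, h2, C.nab_ξ, C.nab_ξ] at h
  simp only [map_sub, LinearMap.sub_apply, map_smul, LinearMap.smul_apply, smul_eq_mul] at h
  have e1 := C.compat X Y
  have e2 := C.compat Y X
  have e3 : C.g (C.s X) (C.φ Y) = C.g (C.s Y) (C.φ X) := by
    rw [C.g_symm (C.s Y), C.φ_skew, C.φ_skew' (C.s X), C.φs_symm]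
  rw [C.g_symm Y X] at e2
  linear_combination h + e3 - C.e * e1 + C.e * e2

end KappaMuAlgebra

/-! ### First consequences of the curvature condition: `s²`, `∇s` and `∇φ` -/

namespace KappaMuAlgebra

variable {A L : Type*} [CommRing A] [LieRing L] [Module A L] [LieRingModule L A]
  [LieRinehartRing A L] (C : KappaMuAlgebra A L)

theorem s_φ (X : L) : C.s (C.φ X) = -C.φ (C.s X) := by rw [C.φ_s, neg_neg]

theorem nab_zero_right (X : L) : C.nab X 0 = 0 := by
  simpa using C.nab_sub_right X 0 0

theorem nab_e_smul (X Y : L) : C.nab X (C.e • Y) = C.e • C.nab X Y := by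
  rw [C.nab_smul_right, C.lie_e, zero_smul, add_zero]

theorem nab_ξ_φ (X : L) : C.nab C.ξ (C.φ X) = C.φ (C.nab C.ξ X) :=
  C.ext_g fun Z => sub_eq_zero.1 (C.P_ξ X Z)

theorem η_nab (X Y : L) : C.η (C.nab X Y) = ⁅X, C.η Y⁆ - C.e * C.g Y (C.nab X C.ξ) := by
  rw [C.η_eq, C.η_eq Y, LieRinehartRing.leibniz_mul_right, C.metric, C.lie_e, smul_eq_mul]
  ring

theorem h_ξ : C.h C.ξ = 0 := by rw [C.h_eq, C.s_ξ, map_zero]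

/-- A Riccati equation along `ξ`: the curvature condition with second argument `ξ`, after
substituting `∇ξ = s - eφ`. -/
theorem radial_curv (X : L) :
    C.nab C.ξ (C.s X) - C.s (C.nab C.ξ X) + C.s (C.s X) + C.φ (C.φ X) =
      (C.e * C.κ) • C.φ (C.φ X) - (C.e * C.μ) • C.φ (C.s X) := by
  have h := C.curv_ξ X C.ξ
  rw [C.nab_ξ_ξ, C.nab_zero_right, C.nab_ξ X, ← C.torsion, C.nab_ξ X, C.nab_sub_right,
    C.nab_e_smul, C.nab_ξ_φ, C.nab_ξ, C.η_ξ, C.h_ξ, C.h_eq] at h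
  refine C.ext_g fun Z => ?_
  have h' := congrArg (fun W => C.g W Z) h
  simp only [map_sub, map_add, map_neg, map_smul, map_zero, LinearMap.add_apply,
    LinearMap.sub_apply, LinearMap.neg_apply, LinearMap.smul_apply, smul_eq_mul, C.φ_φ, C.φ_s,
    LinearMap.zero_apply] at h' ⊢
  linear_combination -h' + (C.g X Z - C.η X * C.g C.ξ Z) * C.e_sq

/-- In the Riccati equation `∇_ξ s` and `φs` anticommute with `φ`, whereas `s²` and `φ²` commute
with it. This is the anticommuting half; the other half is `s_s`. -/
theorem nab_ξ_s (X : L) :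
    C.nab C.ξ (C.s X) - C.s (C.nab C.ξ X) = -((C.e * C.μ) • C.φ (C.s X)) := by
  have a1 := C.radial_curv (C.φ X)
  have a2 := congrArg C.φ (C.radial_curv X)
  have key : C.φ (C.nab C.ξ (C.s X) - C.s (C.nab C.ξ X)) = (C.e * C.μ) • C.s X := by
    refine C.ext_g fun Z => C.two_inj ?_
    rw [C.s_φ, C.nab_neg_right, map_neg, C.nab_ξ_φ, C.nab_ξ_φ, C.s_φ, C.s_φ, map_neg] at a1
    have a3 := congrArg (fun W => C.g W Z) (congrArg₂ (fun a b => a - b) a2 a1)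
    simp only [map_sub, map_add, map_neg, map_smul, LinearMap.add_apply,
      LinearMap.sub_apply, LinearMap.neg_apply, LinearMap.smul_apply, smul_eq_mul, C.φ_φ_s] at a3 ⊢
    linear_combination a3
  have k2 := congrArg C.φ key
  rw [C.φ_φ, map_sub, C.η_nab, C.η_s, C.η_s, C.nab_ξ_ξ] at k2
  simp only [lie_zero, map_zero, mul_zero, sub_zero, zero_smul, add_zero, map_smul] at k2
  rw [← k2, neg_neg]

theorem s_s (X : L) : C.s (C.s X) = (C.e * C.κ - 1) • C.φ (C.φ X) := by
  have h := C.radial_curv X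
  rw [C.nab_ξ_s] at h
  rw [sub_smul, one_smul]
  linear_combination (norm := module) h

/-- Differentiate `s² = (eκ - 1)φ²` along `ξ`. Since `∇_ξ s` is a multiple of `φs`, it anticommutes
with `s`, and the derivative of `s²` drops out. -/
theorem lie_ξ_κ (X : L) : ⁅C.ξ, C.κ⁆ • C.φ (C.φ X) = 0 := by
  have h := congrArg (fun W => C.nab C.ξ W) (C.s_s X)
  have h1 := C.nab_ξ_s (C.s X)
  have h2 := congrArg C.s (C.nab_ξ_s X)
  have h3 := C.s_s (C.nab C.ξ X)
  have h4 : ⁅C.ξ, C.e * C.κ - 1⁆ = C.e * ⁅C.ξ, C.κ⁆ := by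
    rw [lie_sub, lie_one', LieRinehartRing.leibniz_mul_right, C.lie_e]; simp
  simp only [C.nab_smul_right, C.nab_ξ_φ, h4] at h
  refine C.ext_g fun Z => ?_
  replace h := congrArg (fun W => C.g W Z) h
  replace h1 := congrArg (fun W => C.g W Z) h1
  replace h2 := congrArg (fun W => C.g W Z) h2
  replace h3 := congrArg (fun W => C.g W Z) h3
  have h5 := C.s_φ (C.s X)
  simp only [map_sub, map_add, map_neg, map_smul, map_zero, LinearMap.add_apply,
      LinearMap.sub_apply, LinearMap.neg_apply, LinearMap.smul_apply, smul_eq_mul, h5,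
      LinearMap.zero_apply] at h h1 h2 h3 ⊢
  linear_combination (-C.e) * h + C.e * (h1 + h2 + h3) -
    (⁅C.ξ, C.κ⁆ * C.g (C.φ (C.φ X)) Z) * C.e_sq

theorem φ_φ_of_hor {X : L} (hX : C.η X = 0) : C.φ (C.φ X) = -X := by
  rw [C.φ_φ, hX, zero_smul, add_zero]

theorem s_s_of_hor {X : L} (hX : C.η X = 0) : C.s (C.s X) = (1 - C.e * C.κ) • X := by
  rw [C.s_s, C.φ_φ_of_hor hX, smul_neg, ← neg_smul, neg_sub]

theorem P_neg_left (X Y Z : L) : C.P (-X) Y Z = -C.P X Y Z := by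
  simp only [P, C.nab_neg_left, map_neg, LinearMap.neg_apply]; ring

theorem P_neg_mid (X Y Z : L) : C.P X (-Y) Z = -C.P X Y Z := by
  simp only [P, C.nab_neg_right, map_neg, LinearMap.neg_apply]; ring

theorem P_neg_right (X Y Z : L) : C.P X Y (-Z) = -C.P X Y Z := by
  simp only [P, map_neg]; ring

theorem P_φ_mid (X : L) {Y Z : L} (hY : C.η Y = 0) (hZ : C.η Z = 0) :
    C.P X (C.φ Y) Z = C.P X Y (C.φ Z) := by
  simp only [P]
  rw [C.compat, C.φ_φ_of_hor hY, C.nab_neg_right, C.φ_skew, hZ]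
  simp only [map_neg, LinearMap.neg_apply]
  ring

/-- The horizontal analogue of the fact that almost Kähler structures are quasi-Kähler. By `P_cyc`,
the defect is the cyclic sum `c`, which has to vanish. -/
theorem P_φ_left {X Y Z : L} (hX : C.η X = 0) (hY : C.η Y = 0) (hZ : C.η Z = 0) :
    C.P (C.φ X) Y Z = C.P X (C.φ Y) Z := by
  let c : L → L → L → A := fun X Y Z =>
    C.P X (C.φ Y) Z + C.P Y (C.φ Z) X + C.P Z (C.φ X) Y
  have hc : ∀ X Y Z, c X Y Z = C.P X (C.φ Y) Z + C.P Y (C.φ Z) X + C.P Z (C.φ X) Y :=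
    fun _ _ _ => rfl
  have f1 : ∀ X Y Z, C.η X = 0 → C.η Y = 0 → C.η Z = 0 →
      C.P (C.φ X) Y Z = C.P X (C.φ Y) Z - c X Y Z := by
    intro X Y Z hX hY hZ
    have h := C.P_cyc (C.φ X) Y Z
    rw [← C.P_φ_mid Y hZ hX] at h
    rw [hc]; linear_combination h
  have f2 : ∀ X Y Z, C.η X = 0 → C.η Y = 0 → C.η Z = 0 → c (C.φ X) Y Z = -c X (C.φ Y) Z := by
    intro X Y Z hX hY hZ
    have h1 := f1 (C.φ X) Y Z (C.η_φ X) hY hZ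
    have h2 := f1 X (C.φ Y) Z hX (C.η_φ Y) hZ
    rw [C.φ_φ_of_hor hX, C.P_neg_left] at h1
    rw [C.φ_φ_of_hor hY, C.P_neg_mid] at h2
    linear_combination h1 + h2
  have f3 : ∀ X Y Z, c X Y Z = c Y Z X := fun X Y Z => by simp only [hc]; ring
  -- Moving `φ` from one argument of `c` to the next changes the sign. Three moves bring it back to
  -- the start, so `c` equals its own negative.
  have f4 : ∀ X Y Z, C.η X = 0 → C.η Y = 0 → C.η Z = 0 → c (C.φ X) Y Z = 0 := by
    intro X Y Z hX hY hZ
    apply C.two_cancel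
    have h1 := f2 X Y Z hX hY hZ
    have h2 := f2 Y Z X hY hZ hX
    have h3 := f2 Z X Y hZ hX hY
    rw [f3 X, h2, f3 Y, h3, f3 Z] at h1
    linear_combination h1
  have h := f4 (C.φ X) Y Z (C.η_φ X) hY hZ
  have h0 : c (C.φ (C.φ X)) Y Z = -c X Y Z := by
    simp only [hc, C.φ_φ_of_hor hX, map_neg, C.P_neg_left, C.P_neg_mid, C.P_neg_right]; ring
  rw [f1 X Y Z hX hY hZ]
  linear_combination h - h0

/-- The covariant derivative of `s`, as a trilinear form `g((∇_X s) Y, Z)`. -/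
def Q (X Y Z : L) : A := C.g (C.nab X (C.s Y)) Z - C.g (C.s (C.nab X Y)) Z

theorem Q_symm (X Y Z : L) : C.Q X Y Z = C.Q X Z Y := by
  have h1 := C.metric X (C.s Y) Z
  have h2 := C.metric X Y (C.s Z)
  rw [C.s_symm Y Z] at h1
  simp only [Q]
  rw [C.s_symm (C.nab X Y), C.s_symm (C.nab X Z), C.g_symm (C.nab X (C.s Z)),
    C.g_symm (C.nab X Z) (C.s Y)]
  linear_combination h2 - h1

theorem lie_S (X Y Z : L) : ⁅X, C.g (C.s Y) Z⁆ =
    C.Q X Y Z + C.g (C.s (C.nab X Y)) Z + C.g (C.s Y) (C.nab X Z) := by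
  rw [C.metric, Q]; ring

/-- On horizontal fields `R(X, Y)ξ = 0`; with `∇ξ = s - eφ` this is a Codazzi equation whose error,
a skew difference of `∇φ`, collapses to one term by `P_cyc`. -/
theorem codazzi {X Y : L} (hX : C.η X = 0) (hY : C.η Y = 0) (Z : L) :
    C.Q X Y Z - C.Q Y X Z = -C.e * C.P Z X Y := by
  have h := congrArg (fun W => C.g W Z) (C.curv_ξ X Y)
  rw [hX, hY, C.nab_ξ X, C.nab_ξ Y, ← C.torsion, C.nab_ξ, C.nab_sub_right, C.nab_sub_right,
    C.nab_e_smul, C.nab_e_smul] at h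
  simp only [map_sub, map_add, map_smul, map_zero, LinearMap.add_apply,
      LinearMap.sub_apply, LinearMap.smul_apply, smul_eq_mul, zero_smul,
      LinearMap.zero_apply] at h
  have h1 := C.P_cyc X Y Z
  have h2 := C.P_skew Y Z X
  simp only [P, Q] at h1 h2 ⊢
  linear_combination h + C.e * h1 - C.e * h2

theorem Q_φ (X Y Z : L) :
    C.Q X (C.φ Y) Z - C.Q X Y (C.φ Z) = -C.P X (C.s Y) Z - C.P X Y (C.s Z) := by
  have b2 : C.g (C.s (C.nab X Y)) (C.φ Z) = C.g (C.φ (C.nab X Y)) (C.s Z) := by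
    rw [C.φ_skew, C.φ_s, C.s_symm]; simp
  simp only [P, Q]
  rw [C.s_φ, C.nab_neg_right, b2, C.s_symm, C.φ_skew (C.nab X (C.s Y))]
  simp only [map_neg, LinearMap.neg_apply]
  ring

theorem Q_neg_left (X Y Z : L) : C.Q (-X) Y Z = -C.Q X Y Z := by
  simp only [Q, C.nab_neg_left, map_neg, LinearMap.neg_apply]; ring

theorem Q_neg_mid (X Y Z : L) : C.Q X (-Y) Z = -C.Q X Y Z := by
  simp only [Q, C.nab_neg_right, map_neg, LinearMap.neg_apply]; ring

/-- The `(0,1)`-part of the covariant derivative of `s`. -/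
def t (X Y Z : L) : A := C.Q X Y Z + C.Q (C.φ X) (C.φ Y) Z

/-- The failure of `t` to be symmetric in its last two arguments. -/
def r (X Y Z : L) : A := -C.P (C.φ X) (C.s Y) Z - C.P (C.φ X) Y (C.s Z)

theorem t_symm {X Y Z : L} (hX : C.η X = 0) (hY : C.η Y = 0) : C.t X Y Z = C.t Y X Z := by
  have h1 := C.codazzi hX hY Z
  have h2 := C.codazzi (C.η_φ X) (C.η_φ Y) Z
  rw [C.P_φ_mid Z hX (C.η_φ Y), C.φ_φ_of_hor hY, C.P_neg_right] at h2
  simp only [t]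
  linear_combination h1 + h2

theorem t_sub (X Y Z : L) : C.t X Y Z - C.t X Z Y = C.r X Y Z := by
  have h := C.Q_φ (C.φ X) Y Z
  simp only [t, r]
  rw [C.Q_symm X Z Y, C.Q_symm (C.φ X) (C.φ Z) Y]
  linear_combination h

theorem t_φ {X Y : L} (hX : C.η X = 0) (hY : C.η Y = 0) (Z : L) :
    C.t (C.φ X) Y Z = -C.t X (C.φ Y) Z := by
  simp only [t, C.φ_φ_of_hor hX, C.φ_φ_of_hor hY, C.Q_neg_left, C.Q_neg_mid]; ring

/-- The form `t` is symmetric in its first two arguments, symmetric up to `r` in the last two, and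
changes sign when `φ` moves between the first two. With `r = 0` these rules would force `t = 0`, so
`t` is a combination of values of `r`, which contain no derivative of `s`. -/
theorem two_t_φ {X Y Z : L} (hX : C.η X = 0) (hY : C.η Y = 0) (hZ : C.η Z = 0) :
    2 * C.t (C.φ X) Y Z =
      C.r (C.φ X) Y Z + C.r X Y (C.φ Z) - C.r (C.φ Y) X Z - C.r Y X (C.φ Z) := by
  have f : ∀ {X Y : L}, C.η X = 0 → C.η Y = 0 →
      C.t X Y (C.φ Z) = -C.t (C.φ X) Y Z + C.r (C.φ X) Y Z + C.r X Y (C.φ Z) := by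
    intro X Y hX hY
    have h1 := C.t_sub X Y (C.φ Z)
    have h2 := C.t_φ hX hZ Y
    have h3 := C.t_sub (C.φ X) Y Z
    linear_combination h1 + h2 + h3
  have h1 := f hX hY
  have h2 := f hY hX
  have h3 := C.t_symm (Z := C.φ Z) hX hY
  have h4 := C.t_φ hY hX Z
  have h5 := C.t_symm (Z := Z) (C.η_φ X) hY
  linear_combination h1 - h2 - h3 + h4 + h5

/-- The cyclic sum of the differences `t_sub` telescopes to zero by `t_symm`, leaving a purely
algebraic relation between `s` and `∇φ`. -/
theorem P_s_left {X Y Z : L} (hX : C.η X = 0) (hY : C.η Y = 0) (hZ : C.η Z = 0) :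
    C.P (C.s X) Y Z = 0 := by
  have g1 : ∀ {X Y Z : L}, C.η X = 0 → C.η Y = 0 → C.η Z = 0 →
      C.P (C.s X) (C.φ Y) Z + C.P (C.s Y) (C.φ Z) X + C.P (C.s Z) (C.φ X) Y = 0 := by
    intro X Y Z hX hY hZ
    have a1 := C.t_sub X Y Z
    have a2 := C.t_sub Y Z X
    have a3 := C.t_sub Z X Y
    have b1 := C.t_symm (Z := Z) hX hY
    have b2 := C.t_symm (Z := X) hY hZ
    have b3 := C.t_symm (Z := Y) hZ hX
    have c1 : ∀ {U V W : L}, C.η U = 0 → C.η V = 0 → C.η W = 0 →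
        C.P (C.φ U) (C.s V) W + C.P (C.φ W) U (C.s V) + C.P (C.s V) (C.φ W) U = 0 := by
      intro U V W hU hV hW
      have h := C.P_cyc U (C.s V) (C.φ W)
      rw [C.P_φ_left hU (C.η_s V) hW, C.P_φ_mid _ (C.η_s V) hW]
      linear_combination h
    have d1 := c1 hX hY hZ
    have d2 := c1 hY hZ hX
    have d3 := c1 hZ hX hY
    simp only [r] at a1 a2 a3
    linear_combination -a1 - a2 - a3 + b1 + b2 + b3 + d1 + d2 + d3
  have g2 : ∀ {X Y Z : L}, C.η X = 0 → C.η Y = 0 → C.η Z = 0 → C.P (C.s X) (C.φ Y) Z = 0 := by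
    intro X Y Z hX hY hZ
    apply C.two_cancel
    have a1 := g1 hX hY hZ
    -- Replacing `Y, Z` by `φY, φZ` changes the sign of the first term and fixes the other two, so
    -- subtraction isolates the first.
    have a2 := g1 hX (C.η_φ Y) (C.η_φ Z)
    rw [C.s_φ, C.s_φ, C.P_neg_left, C.P_neg_left, C.P_φ_left (C.η_s Y) (C.η_φ _) hX,
      C.P_φ_left (C.η_s Z) (C.η_φ _) (C.η_φ _), C.φ_φ_of_hor hY, C.φ_φ_of_hor hZ,
      map_neg, C.P_neg_mid, C.P_neg_mid, C.φ_φ_of_hor hX, C.P_neg_mid, ← C.P_φ_mid _ hY hZ,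
      ← C.P_φ_mid _ hX hY] at a2
    linear_combination a1 - a2
  have h := g2 hX (C.η_φ Y) hZ
  rw [C.φ_φ_of_hor hY, C.P_neg_mid] at h
  linear_combination -h

end KappaMuAlgebra

/-! ### Curvature, the second Bianchi identity and the ideal of `s` -/

namespace KappaMuAlgebra

variable {A L : Type*} [CommRing A] [LieRing L] [Module A L] [LieRingModule L A]
  [LieRinehartRing A L] (C : KappaMuAlgebra A L)

/-- The curvature of the connection. -/
def R (X Y Z : L) : L := C.nab X (C.nab Y Z) - C.nab Y (C.nab X Z) - C.nab ⁅X, Y⁆ Z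

theorem R_anti (X Y Z : L) : C.R X Y Z = -C.R Y X Z := by
  simp only [R]
  rw [← lie_skew X Y, C.nab_neg_left]
  abel

theorem R_skew (X Y Z W : L) : C.g (C.R X Y Z) W = -C.g (C.R X Y W) Z := by
  have h := lie_lie X Y (C.g Z W)
  simp only [C.metric, lie_add] at h
  simp only [R, map_sub, LinearMap.sub_apply]
  rw [C.g_symm _ Z, C.g_symm _ Z, C.g_symm _ Z]
  linear_combination -h

theorem R_bianchi (X Y Z : L) : C.R X Y Z + C.R Y Z X + C.R Z X Y = 0 := by
  have h1 := C.torsion X ⁅Y, Z⁆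
  have h2 := C.torsion Y ⁅Z, X⁆
  have h3 := C.torsion Z ⁅X, Y⁆
  have j := lie_jacobi X Y Z
  rw [← h1, ← h2, ← h3] at j
  simp only [← C.torsion, C.nab_sub_left, C.nab_sub_right] at j
  simp only [R, ← C.torsion, C.nab_sub_left]
  linear_combination (norm := module) j

theorem R_pair (X Y Z W : L) : C.g (C.R X Y Z) W = C.g (C.R Z W X) Y := by
  apply C.two_inj
  have b : ∀ X Y Z W, C.g (C.R X Y Z) W + C.g (C.R Y Z X) W + C.g (C.R Z X Y) W = 0 :=
    fun X Y Z W => by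
      simpa using congrArg (fun V => C.g V W) (C.R_bianchi X Y Z)
  have a : ∀ X Y Z W, C.g (C.R X Y Z) W = -C.g (C.R Y X Z) W := fun X Y Z W => by
    rw [C.R_anti]; simp
  have s := C.R_skew
  linear_combination b X Y Z W + b Y Z W X - b Z W X Y - b W X Y Z
    - s Y Z W X - s Z W Y X - a W Y Z X + s W X Z Y + s X Z W Y - a X Z Y W
    + s X Y W Z + s Y W X Z

theorem R_second_bianchi (X Y Z V : L) :
    C.nab X (C.R Y Z V) + C.nab Y (C.R Z X V) + C.nab Z (C.R X Y V)
      - C.R ⁅X, Y⁆ Z V - C.R ⁅Y, Z⁆ X V - C.R ⁅Z, X⁆ Y V =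
    C.R X Y (C.nab Z V) + C.R Y Z (C.nab X V) + C.R Z X (C.nab Y V) := by
  have j := congrArg (fun W => C.nab W V) (lie_jacobi X Y Z)
  have r1 : ⁅⁅X, Y⁆, Z⁆ = -⁅Z, ⁅X, Y⁆⁆ := (lie_skew _ _).symm
  have r2 : ⁅⁅Y, Z⁆, X⁆ = -⁅X, ⁅Y, Z⁆⁆ := (lie_skew _ _).symm
  have r3 : ⁅⁅Z, X⁆, Y⁆ = -⁅Y, ⁅Z, X⁆⁆ := (lie_skew _ _).symm
  have z : C.nab 0 V = 0 := by simpa using C.nab_sub_left 0 0 V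
  simp only [C.nab_add_left, z] at j
  simp only [R, C.nab_sub_right, r1, r2, r3, C.nab_neg_left]
  linear_combination (norm := module) -j

theorem R_ξ (X Y : L) : C.R X Y C.ξ =
    (C.e * C.κ) • (C.η Y • X - C.η X • Y) + (C.e * C.μ) • (C.η Y • C.h X - C.η X • C.h Y) :=
  C.curv_ξ X Y

theorem R_ξ_hor {X Y : L} (hX : C.η X = 0) (hY : C.η Y = 0) : C.R X Y C.ξ = 0 := by
  rw [C.R_ξ, hX, hY]; simp

theorem R_hor_ξ {X : L} (hX : C.η X = 0) :
    C.R X C.ξ C.ξ = (C.e * C.κ) • X + (C.e * C.μ) • C.φ (C.s X) := by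
  rw [C.R_ξ, hX, C.η_ξ, C.h_eq]; simp

theorem g_R_ξ_left (X : L) {W Z : L} (hW : C.η W = 0) (hZ : C.η Z = 0) :
    C.g (C.R X C.ξ W) Z = 0 := by
  rw [C.R_pair, C.R_skew, C.R_ξ_hor hW hZ]; simp

/-- The second Bianchi identity on `X, Y, ξ` applied to `ξ`. The terms `R(X, ξ)∇_Y ξ` have no
horizontal component by pair symmetry, and derivatives of `s` enter only through the difference
governed by `codazzi`. This is the only source of information on the derivatives of `κ` and `μ`
along `ker η`. -/
theorem bianchi_hor {X Y Z : L} (hX : C.η X = 0) (hY : C.η Y = 0) (hZ : C.η Z = 0) :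
    ⁅X, C.κ⁆ * C.g Y Z - ⁅Y, C.κ⁆ * C.g X Z
      + ⁅X, C.μ⁆ * C.g (C.φ (C.s Y)) Z - ⁅Y, C.μ⁆ * C.g (C.φ (C.s X)) Z
      + C.μ * (C.P X (C.s Y) Z - C.P Y (C.s X) Z + C.e * C.P (C.φ Z) X Y) = 0 := by
  have h := congrArg (fun W => C.g W Z) (C.R_second_bianchi X Y C.ξ C.ξ)
  have e1 : C.η ⁅Y, C.ξ⁆ = 0 := by rw [← lie_skew, map_neg, ← C.lie_ξ_η, hY]; simp
  have e2 : C.η ⁅C.ξ, X⁆ = 0 := by rw [← C.lie_ξ_η, hX]; simp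
  have e3 : C.R C.ξ X C.ξ = -C.R X C.ξ C.ξ := C.R_anti _ _ _
  have e4 : C.g (C.R C.ξ X (C.nab Y C.ξ)) Z = -C.g (C.R X C.ξ (C.nab Y C.ξ)) Z := by
    rw [C.R_anti]; simp
  have e5 : C.R X Y 0 = 0 := by simp [R, C.nab_zero_right]
  have e6 : C.g C.ξ Z = 0 := by rw [C.g_symm, C.g_ξ, hZ, mul_zero]
  have e7 : C.g (C.R ⁅X, Y⁆ C.ξ C.ξ) Z =
      C.e * C.κ * (C.g (C.nab X Y) Z - C.g (C.nab Y X) Z) +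
      C.e * C.μ * (C.g (C.s (C.nab Y X)) (C.φ Z) - C.g (C.s (C.nab X Y)) (C.φ Z)) := by
    rw [C.R_ξ, C.η_ξ, C.h_ξ, C.h_eq, ← C.torsion]
    simp only [map_add, map_sub, map_smul, LinearMap.add_apply, LinearMap.sub_apply,
      LinearMap.smul_apply, smul_eq_mul, e6, one_mul, smul_zero, map_zero,
      LinearMap.zero_apply, C.φ_skew (C.s _) Z]
    ring
  simp only [C.R_ξ_hor hX hY, C.R_ξ_hor e1 hX, C.R_ξ_hor e2 hY, e3, C.R_hor_ξ hX, C.R_hor_ξ hY,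
    C.nab_ξ_ξ, e5, C.nab_zero_right, e7, map_add, map_sub,
    LinearMap.add_apply, LinearMap.sub_apply, map_zero, LinearMap.zero_apply,
    C.g_R_ξ_left Y (C.η_nab_ξ X) hZ, e4, C.g_R_ξ_left X (C.η_nab_ξ Y) hZ, C.nab_neg_right,
    C.nab_add_right, C.nab_smul_right, LieRinehartRing.leibniz_mul_right, C.lie_e, map_neg,
    LinearMap.neg_apply, map_smul, LinearMap.smul_apply, smul_eq_mul] at h
  have c := C.codazzi hX hY (C.φ Z)
  have q1 : C.g (C.nab X (C.s Y)) (C.φ Z) = C.Q X Y (C.φ Z) + C.g (C.s (C.nab X Y)) (C.φ Z) := by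
    rw [Q]; ring
  have q2 : C.g (C.nab Y (C.s X)) (C.φ Z) = C.Q Y X (C.φ Z) + C.g (C.s (C.nab Y X)) (C.φ Z) := by
    rw [Q]; ring
  have p1 : C.g (C.nab X (C.φ (C.s Y))) Z = C.P X (C.s Y) Z - C.g (C.nab X (C.s Y)) (C.φ Z) := by
    rw [P, C.φ_skew]; ring
  have p2 : C.g (C.nab Y (C.φ (C.s X))) Z = C.P Y (C.s X) Z - C.g (C.nab Y (C.s X)) (C.φ Z) := by
    rw [P, C.φ_skew]; ring
  rw [p1, p2, q1, q2] at h
  linear_combination C.e * h + C.μ * c - (⁅X, C.κ⁆ * C.g Y Z - ⁅Y, C.κ⁆ * C.g X Z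
      + ⁅X, C.μ⁆ * C.g (C.φ (C.s Y)) Z - ⁅Y, C.μ⁆ * C.g (C.φ (C.s X)) Z
      + C.μ * (C.P X (C.s Y) Z - C.P Y (C.s X) Z - (C.Q X Y (C.φ Z) - C.Q Y X (C.φ Z)))) * C.e_sq

/-- The ideal of functions generated by the components of `s`. -/
def sIdeal : Ideal A := Ideal.span (Set.range fun p : L × L => C.g (C.s p.1) p.2)

theorem S_mem (X Y : L) : C.g (C.s X) Y ∈ C.sIdeal :=
  Ideal.subset_span ⟨(X, Y), rfl⟩

theorem P_s_mid_mem (X Y Z : L) : C.P X (C.s Y) Z ∈ C.sIdeal := by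
  rw [C.P_skew, P, ← C.s_symm, ← C.s_symm]
  exact neg_mem (sub_mem (C.S_mem _ _) (C.S_mem _ _))

theorem P_s_right_mem (X Y Z : L) : C.P X Y (C.s Z) ∈ C.sIdeal := by
  rw [C.P_skew]; exact neg_mem (C.P_s_mid_mem _ _ _)

theorem r_mem (X Y Z : L) : C.r X Y Z ∈ C.sIdeal :=
  sub_mem (neg_mem (C.P_s_mid_mem _ _ _)) (C.P_s_right_mem _ _ _)

/-- The derivatives of the components of `s` combine to `t(X, Y, Z)` plus terms linear in `s`, and
`two_t_φ` places `2t` in the ideal. Membership in `sIdeal` thus plays the role of an error `O(s)`.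
-/
theorem cauchyRiemann_mem {X Y Z : L} (hX : C.η X = 0) (hY : C.η Y = 0) (hZ : C.η Z = 0) :
    2 * (⁅X, C.g (C.s Y) Z⁆ + ⁅C.φ X, C.g (C.s (C.φ Y)) Z⁆) ∈ C.sIdeal := by
  have h := C.two_t_φ (C.η_φ X) hY hZ
  have h1 : C.t (C.φ (C.φ X)) Y Z = -C.t X Y Z := by
    simp only [t, C.φ_φ_of_hor hX, C.Q_neg_left, map_neg]; ring
  have h2 : 2 * (⁅X, C.g (C.s Y) Z⁆ + ⁅C.φ X, C.g (C.s (C.φ Y)) Z⁆) =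
      -(C.r (C.φ (C.φ X)) Y Z + C.r (C.φ X) Y (C.φ Z) - C.r (C.φ Y) (C.φ X) Z
        - C.r Y (C.φ X) (C.φ Z)) + 2 * (C.g (C.s (C.nab X Y)) Z + C.g (C.s Y) (C.nab X Z)
        + C.g (C.s (C.nab (C.φ X) (C.φ Y))) Z + C.g (C.s (C.φ Y)) (C.nab (C.φ X) Z)) := by
    rw [← h, h1, C.lie_S, C.lie_S, t]; ring
  rw [h2]
  refine add_mem (neg_mem ?_) (Ideal.mul_mem_left _ _ ?_)
  · exact sub_mem (sub_mem (add_mem (C.r_mem _ _ _) (C.r_mem _ _ _)) (C.r_mem _ _ _)) (C.r_mem _ _ _)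
  · exact add_mem (add_mem (add_mem (C.S_mem _ _) (C.S_mem _ _)) (C.S_mem _ _)) (C.S_mem _ _)

theorem lie_ξ_S_mem (Y Z : L) : ⁅C.ξ, C.g (C.s Y) Z⁆ ∈ C.sIdeal := by
  have h : ⁅C.ξ, C.g (C.s Y) Z⁆ = (C.e * C.μ) * C.g (C.s Y) (C.φ Z) + C.g (C.s (C.nab C.ξ Y)) Z
      + C.g (C.s Y) (C.nab C.ξ Z) := by
    have := congrArg (fun W => C.g W Z) (C.nab_ξ_s Y)
    simp only [map_sub, LinearMap.sub_apply, map_neg, LinearMap.neg_apply, map_smul,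
      LinearMap.smul_apply, smul_eq_mul] at this
    rw [C.φ_skew] at this
    rw [C.metric]
    linear_combination this
  rw [h]
  exact add_mem (add_mem (Ideal.mul_mem_left _ _ (C.S_mem _ _)) (C.S_mem _ _)) (C.S_mem _ _)

/-- With `∇ξ = -eφ`, the formula for `R(X, Y)ξ` is a formula for `∇φ`, namely the Sasakian one, and
torsion-freeness expresses `[φ, φ]` through `∇φ`. -/
theorem nijenhuis_eq_zero (hs : ∀ X, C.s X = 0) (hκ : C.e * C.κ = 1) (X Y : L) :
    C.φ (C.φ ⁅X, Y⁆) + ⁅C.φ X, C.φ Y⁆ - C.φ ⁅C.φ X, Y⁆ - C.φ ⁅X, C.φ Y⁆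
      + (2 * C.g X (C.φ Y)) • C.ξ = 0 := by
  have hP : ∀ Z X Y, C.P Z X Y = C.e * (C.η Y * C.g X Z - C.η X * C.g Y Z) := by
    intro Z X Y
    have h := congrArg (fun W => C.g W Z) (C.R_ξ X Y)
    have h1 := C.P_cyc X Y Z
    have h2 := C.P_skew Y Z X
    simp only [R, C.nab_ξ, hs, C.h_eq, ← C.torsion X Y, C.nab_e_smul, hκ, map_zero, smul_zero, sub_zero, add_zero, zero_sub,
      map_sub, map_neg, C.nab_neg_right, one_smul, map_smul, LinearMap.sub_apply,
      LinearMap.neg_apply, LinearMap.smul_apply, smul_eq_mul] at h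
    simp only [P] at h1 h2 ⊢
    linear_combination h1 - h2 + C.e * h + (C.g (C.nab X (C.φ Y)) Z - C.g (C.nab Y (C.φ X)) Z
      - C.g (C.φ (C.nab X Y)) Z + C.g (C.φ (C.nab Y X)) Z) * C.e_sq
  refine C.g_nondeg _ fun Z => ?_
  have h1 := hP (C.φ X) Y Z
  have h2 := hP (C.φ Y) X Z
  have h3 := hP X Y (C.φ Z)
  have h4 := hP Y X (C.φ Z)
  rw [C.η_φ] at h3 h4
  simp only [P] at h1 h2 h3 h4
  simp only [← C.torsion, map_add, map_sub, map_smul, LinearMap.add_apply, LinearMap.sub_apply,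
    LinearMap.smul_apply, smul_eq_mul]
  have k1 := C.φ_skew (C.nab X (C.φ Y)) Z
  have k2 := C.φ_skew (C.φ (C.nab X Y)) Z
  have k3 := C.φ_skew (C.nab Y (C.φ X)) Z
  have k4 := C.φ_skew (C.φ (C.nab Y X)) Z
  have k5 := C.φ_skew X Z
  have k6 := C.φ_skew Y Z
  have k7 := C.φ_skew X Y
  rw [C.g_symm (C.φ X)] at k5 k7
  rw [C.g_symm (C.φ Y)] at k6
  have k8 := C.g_ξ Z
  rw [C.g_symm] at k8
  rw [C.g_symm (C.φ Z)] at h3 h4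
  linear_combination h1 - h2 + h3 - h4 - k1 + k2 + k3 - k4 + C.e * C.η Z * k7
    - C.e * C.η Y * k5 + C.e * C.η X * k6 + 2 * C.g X (C.φ Y) * k8

theorem P_smul_left (f : A) (X Y Z : L) : C.P (f • X) Y Z = f * C.P X Y Z := by
  simp only [P, C.nab_smul_left, map_smul, LinearMap.smul_apply, smul_eq_mul]; ring

theorem g_hor_φ_φ {X : L} (hX : C.η X = 0) (Z : L) : C.g X (-C.φ (C.φ Z)) = C.g X Z := by
  rw [C.φ_φ, map_neg, map_add, map_neg, map_smul, C.g_ξ, hX]; simp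

theorem g_φ_φ_hor {X : L} (hX : C.η X = 0) (Z : L) : C.g (C.φ X) (C.φ Z) = C.g X Z := by
  rw [C.compat, hX]; simp

/-! ### Relations between `dκ` and `dμ` at a point -/

section Pointwise

variable (ev : A →+* ℝ)

/-- The metric is indefinite, so `h` need not be diagonalizable. Instead of eigenvectors, the proof
uses the defect `m X = Xκ - (hX)μ` and a sum of two real squares. -/
theorem ev_lie_κ (hne : ev (C.e * C.κ) ≠ 1)
    (hev : ∀ X, (∀ Z, ev (C.g X Z) = 0) → ∀ f : A, ev ⁅X, f⁆ = 0) {X : L} (hX : C.η X = 0) :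
    ev ⁅X, C.κ⁆ = ev ⁅C.φ (C.s X), C.μ⁆ := by
  have hlam : ev (1 - C.e * C.κ) ≠ 0 := by
    rw [map_sub, map_one]; exact fun h => hne (by linarith)
  -- Here `s` is invertible at the point: `P_s_left` at `sX` reads `(1 - eκ) P(X, Y, Z) = 0`.
  have hP : ∀ {X Y Z : L}, C.η X = 0 → C.η Y = 0 → C.η Z = 0 → ev (C.P X Y Z) = 0 := by
    intro X Y Z hX hY hZ
    have h := C.P_s_left (C.η_s X) hY hZ
    rw [C.s_s_of_hor hX, C.P_smul_left] at h
    have := congrArg ev h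
    rw [map_mul, map_zero] at this
    exact (mul_eq_zero.1 this).resolve_left hlam
  have hh : ∀ {X : L}, C.η X = 0 →
      C.φ (C.s (C.φ (C.s X))) = (1 - C.e * C.κ) • X := by
    intro X hX
    rw [C.s_φ, map_neg, C.φ_φ_s, neg_neg, C.s_s_of_hor hX]
  let m : L → ℝ := fun X => ev ⁅X, C.κ⁆ - ev ⁅C.φ (C.s X), C.μ⁆
  have hm : ∀ X, m X = ev ⁅X, C.κ⁆ - ev ⁅C.φ (C.s X), C.μ⁆ := fun _ => rfl
  have hadd : ∀ X Y, m (X + Y) = m X + m Y := by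
    intro X Y; simp only [hm, map_add, add_lie]; ring
  have hneg : ∀ X, m (-X) = -m X := by
    intro X; simp only [hm, map_neg, neg_lie]; ring
  -- The Bianchi identity with `Y = hX`, using `h² = 1 - eκ`.
  have key : ∀ {X Z : L}, C.η X = 0 → C.η Z = 0 →
      m X * ev (C.g (C.φ (C.s X)) Z) = m (C.φ (C.s X)) * ev (C.g X Z) := by
    intro X Z hX hZ
    have h := congrArg ev (C.bianchi_hor hX (C.η_φ (C.s X)) hZ)
    rw [hh hX] at h
    simp only [map_add, map_sub, map_mul, hP hX (C.η_s _) hZ, hP (C.η_φ _) (C.η_s _) hZ,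
      hP (C.η_φ _) hX (C.η_φ _), map_smul, LinearMap.smul_apply, smul_eq_mul, map_zero] at h
    rw [hm, hm, hh hX, LieRinehartRing.lie_smul_eq_mul]
    simp only [map_mul, map_sub]
    linear_combination h
  -- Polarize `key` at `X + φX` and use `key` again with `φZ` in place of `Z`.
  have key2 : ∀ {Z : L}, C.η Z = 0 →
      m (C.φ X) * ev (C.g (C.φ (C.s X)) Z) = m X * ev (C.g (C.φ (C.φ (C.s X))) Z) := by
    intro Z hZ
    have a0 := key hX hZ
    have a1 := key (C.η_φ X) hZ
    have a2 := key (X := X + C.φ X) (Z := Z) (by rw [map_add, hX, C.η_φ, add_zero]) hZ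
    have a3 := key hX (C.η_φ Z)
    have a4 := key (C.η_φ X) (C.η_φ Z)
    simp only [map_add, LinearMap.add_apply, C.s_φ, map_neg, LinearMap.neg_apply, hadd, hneg] at a1 a2 a4
    rw [C.g_φ_φ_hor (C.η_φ _), C.g_φ_φ_hor hX] at a4
    rw [C.φ_skew' _ Z, C.φ_skew' _ Z] at a3
    simp only [map_neg] at a3
    linarith
  by_contra hne'
  have hmX : m X ≠ 0 := sub_ne_zero.2 hne'
  -- Using `key2` at `Z` and at `φZ` gives `m X (a² + b²) = 0`. If `m X ≠ 0`, then `hX`, and with it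
  -- `X`, vanishes at the point, whence `m X = 0`.
  have z1 : ∀ {Z : L}, C.η Z = 0 → ev (C.g (C.φ (C.s X)) Z) = 0 := by
    intro Z hZ
    have b1 := key2 hZ
    have b2 := key2 (C.η_φ Z)
    rw [C.g_φ_φ_hor (C.η_φ _), C.φ_skew' _ Z, map_neg] at b2
    set a := ev (C.g (C.φ (C.s X)) Z)
    set b := ev (C.g (C.φ (C.φ (C.s X))) Z)
    have : m X * (a ^ 2 + b ^ 2) = 0 := by linear_combination (-a) * b2 - b * b1
    have := (mul_eq_zero.1 this).resolve_left hmX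
    nlinarith [sq_nonneg a, sq_nonneg b]
  have hor : ∀ Z, C.η (-C.φ (C.φ Z)) = 0 := fun Z => by rw [map_neg, C.η_φ, neg_zero]
  have z2 : ∀ Z, ev (C.g (C.φ (C.s X)) Z) = 0 := fun Z => by
    rw [← C.g_hor_φ_φ (C.η_φ _)]; exact z1 (hor Z)
  have z3 : ∀ Z, ev (C.g X Z) = 0 := fun Z => by
    have h := z2 (C.φ (C.s Z))
    rw [← C.φs_symm, hh hX, map_smul, LinearMap.smul_apply, smul_eq_mul, map_mul] at h
    exact (mul_eq_zero.1 h).resolve_left hlam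
  exact hne' (by rw [hev X z3, hev _ z2])

/-- Now `s² = 0`, and `∇φ` cannot be removed by inverting `s`. The Bianchi identity with one
argument in the image of `s` kills `(sU)μ` first, then `μ P(W, X, sU)`, and after that the pair `X,
φX` gives `Xμ`. -/
theorem ev_lie_μ (hκ : C.κ = C.e) {X₀ W₀ : L} (hX₀ : C.η X₀ = 0) (hW₀ : C.η W₀ = 0)
    (h₀ : ev (C.g (C.s X₀) W₀) ≠ 0) {Y : L} (hY : C.η Y = 0) : ev ⁅Y, C.μ⁆ = 0 := by
  have hss : ∀ {X : L}, C.η X = 0 → C.s (C.s X) = 0 := by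
    intro X hX; rw [C.s_s_of_hor hX, hκ, C.e_sq, sub_self, zero_smul]
  have hlκ : ∀ X : L, ⁅X, C.κ⁆ = 0 := fun X => by rw [hκ, C.lie_e]
  have st : ∀ {U X W : L}, C.η U = 0 → C.η X = 0 → C.η W = 0 →
      ⁅C.s U, C.μ⁆ * C.g (C.s X) W + C.μ * C.e * C.P W X (C.s U) = 0 := by
    intro U X W hU hX hW
    have h := C.bianchi_hor hX (C.η_s U) (C.η_φ (-W))
    have h1 : C.g (C.φ (C.s X)) (C.φ (-W)) = -C.g (C.s X) W := by
      rw [map_neg, map_neg, C.g_φ_φ_hor (C.η_s X)]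
    rw [hlκ, hlκ, hss hU, C.P_s_left hU (C.η_s X) (C.η_φ _), C.φ_φ_of_hor (by simp [hW]), neg_neg,
      h1, C.P_skew X 0] at h
    simp only [map_zero, LinearMap.zero_apply, P] at h ⊢
    linear_combination h
  -- The two instances of `st` carry the same `∇φ` term up to sign, because `φ` can be moved across
  -- the last two arguments of `P`.
  have st2 : ∀ {U X W : L}, C.η U = 0 → C.η X = 0 → C.η W = 0 →
      ⁅C.s (C.φ U), C.μ⁆ * C.g (C.s X) W = -⁅C.s U, C.μ⁆ * C.g (C.s (C.φ X)) W := by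
    intro U X W hU hX hW
    have h1 := st (C.η_φ U) hX hW
    have h2 := st hU (C.η_φ X) hW
    rw [C.s_φ U, C.P_neg_right, ← C.P_φ_mid W hX (C.η_s U)] at h1
    rw [C.s_φ U]
    linear_combination h1 + h2
  have α0 : ∀ {U : L}, C.η U = 0 → ev ⁅C.s U, C.μ⁆ = 0 := by
    intro U hU
    have h1 := congrArg ev (st2 hU hX₀ hW₀)
    have h2 := congrArg ev (st2 hU (C.η_φ X₀) hW₀)
    rw [C.s_φ_φ] at h2
    simp only [map_mul, map_neg, LinearMap.neg_apply] at h1 h2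
    set a := ev (C.g (C.s X₀) W₀)
    set b := ev (C.g (C.s (C.φ X₀)) W₀)
    have h3 : ev ⁅C.s U, C.μ⁆ * (a ^ 2 + b ^ 2) = 0 := by linear_combination (-a) * h2 + b * h1
    refine (mul_eq_zero.1 h3).resolve_right fun h => h₀ ?_
    nlinarith [sq_nonneg a, sq_nonneg b]
  have Pz : ∀ {U X W : L}, C.η U = 0 → C.η X = 0 → C.η W = 0 →
      ev C.μ * ev (C.P W X (C.s U)) = 0 := by
    intro U X W hU hX hW
    have h := congrArg ev (st hU hX hW)
    have he := congrArg ev C.e_sq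
    simp only [map_add, map_mul, α0 hU, map_zero, map_one] at h he
    linear_combination ev C.e * h - ev C.μ * ev (C.P W X (C.s U)) * he
  have key : ∀ {X Z : L}, C.η X = 0 → C.η Z = 0 →
      ev ⁅X, C.μ⁆ * ev (C.g (C.φ (C.φ (C.s X))) Z) = -(ev ⁅C.φ X, C.μ⁆ * ev (C.g (C.φ (C.s X)) Z)) := by
    intro X Z hX hZ
    have h := congrArg ev (C.bianchi_hor hX (C.η_φ X) hZ)
    have p0 : C.P (C.φ Z) X (C.φ X) = 0 := by
      apply C.two_cancel
      have h1 := C.P_φ_mid (C.φ Z) hX hX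
      have h2 := C.P_skew (C.φ Z) X (C.φ X)
      linear_combination h2 - h1
    have p1 := Pz (C.η_φ X) hZ hX
    have p2 := Pz hX hZ (C.η_φ X)
    rw [p0, hlκ, hlκ, C.P_skew X, C.P_skew (C.φ X)] at h
    rw [C.s_φ] at h p1
    simp only [map_add, map_sub, map_mul, map_neg, map_zero, LinearMap.neg_apply] at h p1
    linear_combination -h - p1 + p2
  have fin : ∀ {X Z : L}, C.η X = 0 → C.η Z = 0 → ev (C.g (C.φ (C.s X)) Z) ≠ 0 →
      ev ⁅X, C.μ⁆ = 0 := by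
    intro X Z hX hZ hne
    have b1 := key hX hZ
    have b2 := key hX (C.η_φ Z)
    rw [C.g_φ_φ_hor (C.η_φ _), C.φ_skew' _ Z, map_neg] at b2
    set a := ev (C.g (C.φ (C.s X)) Z)
    set b := ev (C.g (C.φ (C.φ (C.s X))) Z)
    have : ev ⁅X, C.μ⁆ * (a ^ 2 + b ^ 2) = 0 := by linear_combination a * b2 + b * b1
    refine (mul_eq_zero.1 this).resolve_right fun h => hne ?_
    nlinarith [sq_nonneg a, sq_nonneg b]
  have hA : ev (C.g (C.φ (C.s X₀)) (C.φ W₀)) ≠ 0 := by rwa [C.g_φ_φ_hor (C.η_s _)]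
  -- When `hY` pairs to zero with `φW₀`, the sum `Y + X₀` does not; `fin` applies to it and to `X₀`,
  -- and the difference gives `Y`.
  by_cases hYZ : ev (C.g (C.φ (C.s Y)) (C.φ W₀)) = 0
  · have h1 := fin hX₀ (C.η_φ W₀) hA
    have h2 := fin (X := Y + X₀) (Z := C.φ W₀) (by rw [map_add, hY, hX₀, add_zero]) (C.η_φ W₀)
      (by simpa [hYZ] using hA)
    rw [add_lie, map_add, h1, add_zero] at h2
    exact h2
  · exact fin hY (C.η_φ W₀) hYZ

end Pointwise

end KappaMuAlgebra

/-! ### Smooth functions and vector fields as a Lie-Rinehart pair -/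

section SmoothAlgebra

variable (m : ℕ) (M : Type*) [TopologicalSpace M] [ChartedSpace (EuclideanSpace ℝ (Fin m)) M]
  [IsManifold (𝓡 m) ∞ M]

/-- The algebra of smooth functions. -/
abbrev Fn := C^∞⟮𝓡 m, M; 𝓘(ℝ, ℝ), ℝ⟯

/-- The module of smooth vector fields. -/
abbrev Fld := Cₛ^∞⟮𝓡 m; EuclideanSpace ℝ (Fin m), fun x : M => TangentSpace (𝓡 m) x⟯

variable {m M}

theorem Fld.isSmoothField (X : Fld m M) : IsSmoothField (X : ∀ x : M, TangentSpace (𝓡 m) x) :=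
  X.contMDiff

/-- Bundle a smooth vector field. -/
def IsSmoothField.toFld {X : ∀ x : M, TangentSpace (𝓡 m) x} (hX : IsSmoothField X) : Fld m M :=
  ⟨X, hX⟩

theorem IsSmoothField.mdifferentiableAt {X : ∀ x : M, TangentSpace (𝓡 m) x}
    (hX : IsSmoothField X) (x : M) :
    MDifferentiableAt (𝓡 m) ((𝓡 m).prod 𝓘(ℝ, EuclideanSpace ℝ (Fin m)))
      (fun y ↦ (⟨y, X y⟩ : TangentBundle (𝓡 m) M)) x :=
  (hX x).mdifferentiableAt (by simp)

theorem Fld.mdiff (X : Fld m M) (x : M) :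
    MDifferentiableAt (𝓡 m) ((𝓡 m).prod 𝓘(ℝ, EuclideanSpace ℝ (Fin m)))
      (fun y ↦ (⟨y, X y⟩ : TangentBundle (𝓡 m) M)) x :=
  X.isSmoothField.mdifferentiableAt x

theorem Fn.mdiff (f : Fn m M) (x : M) : MDifferentiableAt (𝓡 m) 𝓘(ℝ, ℝ) f x :=
  (f.contMDiff x).mdifferentiableAt (by simp)

instance : SMul (Fn m M) (Fld m M) :=
  ⟨fun f X => ⟨fun x => f x • X x, f.contMDiff.smul_section X.contMDiff⟩⟩

@[simp] theorem Fld.smul_apply (f : Fn m M) (X : Fld m M) (x : M) : (f • X) x = f x • X x := rfl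

theorem Fld.coe_fn_smul (f : Fn m M) (X : Fld m M) :
    ((f • X : Fld m M) : ∀ x : M, TangentSpace (𝓡 m) x) = (f : M → ℝ) • (X : ∀ x : M, TangentSpace (𝓡 m) x) := rfl

instance : Module (Fn m M) (Fld m M) where
  one_smul X := by ext x : 1; simp
  mul_smul f g X := by ext x : 1; simp [mul_smul]
  smul_zero f := by ext x : 1; simp
  smul_add f X Y := by ext x : 1; simp
  add_smul f g X := by ext x : 1; simp [add_smul]
  zero_smul X := by ext x : 1; simp

theorem isSmoothField_bracket {X Y : ∀ x : M, TangentSpace (𝓡 m) x} (hX : IsSmoothField X)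
    (hY : IsSmoothField Y) : IsSmoothField (bracket X Y) := by
  have : IsManifold (𝓡 m) (minSmoothness ℝ 2) M :=
    .of_le (n := ∞) (by simp only [minSmoothness_of_isRCLikeNormedField]; exact WithTop.coe_le_coe.2 le_top)
  have : IsManifold (𝓡 m) (∞ + 1) M := by simpa using (inferInstance : IsManifold (𝓡 m) ∞ M)
  exact ContDiff.mlieBracket_vectorField (m := ⊤) (n := ⊤) hX hY (by simp)

theorem contMDiff_dirDeriv {X : ∀ x : M, TangentSpace (𝓡 m) x} (hX : IsSmoothField X) {f : M → ℝ}
    (hf : ContMDiff (𝓡 m) 𝓘(ℝ, ℝ) ∞ f) : ContMDiff (𝓡 m) 𝓘(ℝ, ℝ) ∞ (dirDeriv X f) := by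
  have h1 := (hf.contMDiff_tangentMap (m := ∞) (by simp)).comp hX
  exact (contMDiff_snd_tangentBundle_modelSpace ℝ 𝓘(ℝ, ℝ)).comp h1

instance : LieRing (Fld m M) where
  bracket X Y := (isSmoothField_bracket X.isSmoothField Y.isSmoothField).toFld
  add_lie X Y Z := by
    have : IsManifold (𝓡 m) 2 M := .of_le (n := ∞) (by exact WithTop.coe_le_coe.2 le_top)
    ext x : 1
    exact mlieBracket_add_left (X.mdiff x) (Y.mdiff x)
  lie_add X Y Z := by
    have : IsManifold (𝓡 m) 2 M := .of_le (n := ∞) (by exact WithTop.coe_le_coe.2 le_top)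
    ext x : 1
    exact mlieBracket_add_right (Y.mdiff x) (Z.mdiff x)
  lie_self X := by
    ext x : 1
    exact congrFun (mlieBracket_self (I := 𝓡 m) (V := X)) x
  leibniz_lie X Y Z := by
    have : IsManifold (𝓡 m) (minSmoothness ℝ 3) M :=
      .of_le (n := ∞) (by simp only [minSmoothness_of_isRCLikeNormedField]; exact WithTop.coe_le_coe.2 le_top)
    have h : ∀ X : Fld m M, ContMDiff (𝓡 m) ((𝓡 m).prod 𝓘(ℝ, EuclideanSpace ℝ (Fin m)))
        (minSmoothness ℝ 2) (fun y ↦ (⟨y, X y⟩ : TangentBundle (𝓡 m) M)) := fun X =>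
      X.contMDiff.of_le (by simp only [minSmoothness_of_isRCLikeNormedField]; exact WithTop.coe_le_coe.2 le_top)
    ext x : 1
    exact leibniz_identity_mlieBracket_apply (h X x) (h Y x) (h Z x)

theorem Fld.lie_apply (X Y : Fld m M) (x : M) : ⁅X, Y⁆ x = bracket X Y x := rfl

instance : Bracket (Fld m M) (Fn m M) :=
  ⟨fun X f => ⟨dirDeriv X f, contMDiff_dirDeriv X.isSmoothField f.contMDiff⟩⟩

theorem Fn.lie_apply (X : Fld m M) (f : Fn m M) (x : M) : ⁅X, f⁆ x = dirDeriv X f x := rfl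

theorem Fn.lie_apply' (X : Fld m M) (f : Fn m M) (x : M) :
    ⁅X, f⁆ x = mvfderiv (𝓡 m) f x (X x) := rfl

theorem Fn.lie_mul (X : Fld m M) (f g : Fn m M) : ⁅X, f * g⁆ = f * ⁅X, g⁆ + ⁅X, f⁆ * g := by
  ext x
  change mvfderiv (𝓡 m) ((f : M → ℝ) * (g : M → ℝ)) x (X x) = _
  rw [mvfderiv_mul (f.mdiff x) (g.mdiff x)]
  simp [Fn.lie_apply']
  ring

theorem Fld.lie_smul' (X : Fld m M) (f : Fn m M) (Y : Fld m M) :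
    ⁅X, f • Y⁆ = f • ⁅X, Y⁆ + ⁅X, f⁆ • Y := by
  have : IsManifold (𝓡 m) 2 M := .of_le (n := ∞) (by exact WithTop.coe_le_coe.2 le_top)
  ext x : 1
  rw [Fld.lie_apply, Fld.coe_fn_smul]
  refine (mlieBracket_smul_right (f.mdiff x) (Y.mdiff x)).trans ?_
  rw [add_comm]; rfl

variable [T2Space M]

theorem exists_fn_eventuallyEq {f : M → ℝ} {u : Set M} {x : M} (hu : u ∈ 𝓝 x)
    (hf : ContMDiffOn (𝓡 m) 𝓘(ℝ, ℝ) ∞ f u) : ∃ F : Fn m M, ∀ᶠ y in 𝓝 x, F y = f y := by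
  obtain ⟨v, hvu, hv, hxv⟩ := mem_nhds_iff.1 hu
  obtain ⟨ψ, -, hψ⟩ := (SmoothBumpFunction.nhds_basis_tsupport (I := 𝓡 m) x).mem_iff.1
    (hv.mem_nhds hxv)
  refine ⟨⟨fun y => ψ y * f y, contMDiff_of_tsupport fun y hy => ?_⟩, ?_⟩
  · have hy' : y ∈ v := hψ (tsupport_mul_subset_left hy)
    exact ψ.contMDiffAt.mul ((hf.mono hvu).contMDiffAt (hv.mem_nhds hy'))
  · filter_upwards [ψ.eventuallyEq_one] with y hy
    change ψ y * f y = f y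
    rw [hy]; simp

theorem exists_fld_eventuallyEq {X : ∀ x : M, TangentSpace (𝓡 m) x} {u : Set M} {x : M}
    (hu : u ∈ 𝓝 x) (hX : ContMDiffOn (𝓡 m) ((𝓡 m).prod 𝓘(ℝ, EuclideanSpace ℝ (Fin m))) ∞
      (fun y ↦ (⟨y, X y⟩ : TangentBundle (𝓡 m) M)) u) :
    ∃ F : Fld m M, ∀ᶠ y in 𝓝 x, F y = X y := by
  obtain ⟨v, hvu, hv, hxv⟩ := mem_nhds_iff.1 hu
  obtain ⟨ψ, -, hψ⟩ := (SmoothBumpFunction.nhds_basis_tsupport (I := 𝓡 m) x).mem_iff.1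
    (hv.mem_nhds hxv)
  refine ⟨⟨fun y => ψ y • X y, ?_⟩, ?_⟩
  · exact ContMDiffOn.smul_section_of_tsupport ψ.contMDiff.contMDiffOn hv hψ (hX.mono hvu)
  · filter_upwards [ψ.eventuallyEq_one] with y hy
    change ψ y • X y = X y
    rw [hy]; simp

/-- Near every point there is a frame of smooth vector fields, and every smooth vector field has
smooth coefficients with respect to it. -/
theorem exists_frame (x : M) : ∃ E : Fin m → Fld m M,
    (∀ᶠ y in 𝓝 x, LinearIndependent ℝ (fun i => E i y) ∧
      ∀ v : TangentSpace (𝓡 m) y, ∃ c : Fin m → ℝ, v = ∑ i, c i • E i y) ∧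
    ∀ W : Fld m M, ∃ c : Fin m → Fn m M, ∀ᶠ y in 𝓝 x, W y = ∑ i, c i y • E i y := by
  let e := trivializationAt (EuclideanSpace ℝ (Fin m)) (TangentSpace (𝓡 m) : M → Type _) x
  let b := (EuclideanSpace.basisFun (Fin m) ℝ).toBasis
  have hx : x ∈ e.baseSet := FiberBundle.mem_baseSet_trivializationAt' x
  have hu : e.baseSet ∈ 𝓝 x := e.open_baseSet.mem_nhds hx
  have hE : ∀ i, ∃ F : Fld m M, ∀ᶠ y in 𝓝 x, F y = e.localFrame b i y := fun i =>
    exists_fld_eventuallyEq hu (e.contMDiffOn_localFrame_baseSet (I := 𝓡 m) ∞ b i)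
  choose E hE using hE
  have hE' := Filter.eventually_all.2 hE
  refine ⟨E, ?_, fun W => ?_⟩
  · filter_upwards [hE', hu] with y hy hyu
    have h1 : (fun i => E i y) = e.basisAt b hyu := by
      funext i; rw [hy i, e.localFrame_apply_of_mem_baseSet b hyu]
    rw [h1]
    refine ⟨(e.basisAt b hyu).linearIndependent, fun v => ⟨(e.basisAt b hyu).repr v, ?_⟩⟩
    have h2 : ∀ i, E i y = e.basisAt b hyu i := fun i => congrFun h1 i
    simp only [h2]
    exact ((e.basisAt b hyu).sum_repr v).symm
  · have hc : ∀ i, ∃ F : Fn m M, ∀ᶠ y in 𝓝 x, F y = e.localFrameCoeff (𝓡 m) b i y (W y) := fun i =>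
      exists_fn_eventuallyEq hu (contMDiffOn_baseSet_localFrameCoeff (e := e) b (W.contMDiff.contMDiffOn) i)
    choose c hc using hc
    refine ⟨c, ?_⟩
    filter_upwards [hE', hu, Filter.eventually_all.2 hc] with y hy hyu hyc
    simp only [hy, hyc]
    exact e.eq_sum_localFrameCoeff_smul (I := 𝓡 m) (s := fun y => W y) hyu

theorem exists_fld_apply_eq {x : M} (v : TangentSpace (𝓡 m) x) : ∃ X : Fld m M, X x = v := by
  obtain ⟨E, hE, -⟩ := exists_frame (m := m) x
  obtain ⟨c, hc⟩ := (hE.self_of_nhds).2 v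
  let C : Fin m → Fn m M := fun i => ⟨fun _ => c i, contMDiff_const⟩
  refine ⟨∑ i, C i • E i, ?_⟩
  rw [hc]
  have : ∀ (s : Finset (Fin m)) (F : Fin m → Fld m M), (∑ i ∈ s, F i : Fld m M) x = ∑ i ∈ s, F i x :=
    fun s F => by
      induction s using Finset.cons_induction with
      | empty => rfl
      | cons a s ha ih => rw [Finset.sum_cons, Finset.sum_cons, ← ih]; rfl
  rw [this]; rfl

/-- Compare both sides of the Jacobi identity for `X, Y, fZ`: only the required identity times `Z`
remains, and `Z` can be chosen nonzero at the point unless the tangent space is trivial. -/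
theorem Fn.lie_lie' (X Y : Fld m M) (f : Fn m M) : ⁅⁅X, Y⁆, f⁆ = ⁅X, ⁅Y, f⁆⁆ - ⁅Y, ⁅X, f⁆⁆ := by
  ext x
  by_cases h : ∃ v : TangentSpace (𝓡 m) x, v ≠ 0
  · obtain ⟨v, hv⟩ := h
    obtain ⟨Z, rfl⟩ := exists_fld_apply_eq v
    have h1 := lie_lie X Y (f • Z)
    simp only [Fld.lie_smul', lie_add] at h1
    have h2 : (⁅⁅X, Y⁆, f⁆ - (⁅X, ⁅Y, f⁆⁆ - ⁅Y, ⁅X, f⁆⁆)) • Z = 0 := by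
      rw [lie_lie X Y Z] at h1
      linear_combination (norm := module) h1
    have h3 := congrArg (fun F : Fld m M => F x) h2
    have h4 := (smul_eq_zero.1 h3).resolve_right hv
    exact sub_eq_zero.1 h4
  · push Not at h
    have z : ∀ (X : Fld m M) (f : Fn m M), ⁅X, f⁆ x = 0 := fun X f => by
      rw [Fn.lie_apply', h (X x), map_zero]
    change ⁅⁅X, Y⁆, f⁆ x = ⁅X, ⁅Y, f⁆⁆ x - ⁅Y, ⁅X, f⁆⁆ x
    rw [z, z, z, sub_zero]

instance : LieRingModule (Fld m M) (Fn m M) where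
  add_lie X Y f := by
    ext x
    change mvfderiv (𝓡 m) f x (X x + Y x) = _
    rw [map_add]; rfl
  lie_add X f g := by
    ext x
    change mvfderiv (𝓡 m) ((f : M → ℝ) + (g : M → ℝ)) x (X x) = _
    rw [mvfderiv_add (f.mdiff x) (g.mdiff x)]; rfl
  leibniz_lie X Y f := by rw [Fn.lie_lie']; abel

instance : LieRinehartRing (Fn m M) (Fld m M) where
  lie_smul_eq_mul' f g X := by
    ext x
    change mvfderiv (𝓡 m) g x (f x • X x) = _
    rw [map_smul]; rfl
  leibniz_mul_right' X f g := Fn.lie_mul X f g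
  leibniz_smul_right' X Y f := Fld.lie_smul' X f Y

end SmoothAlgebra

/-! ### The Levi-Civita connection on smooth fields -/

section Concrete

variable {m : ℕ} {M : Type*} [TopologicalSpace M] [ChartedSpace (EuclideanSpace ℝ (Fin m)) M]
  [IsManifold (𝓡 m) ∞ M]

/-- Evaluation of smooth functions at a point. -/
def Fn.ev (x : M) : Fn m M →+* ℝ := ContMDiffMap.evalRingHom x

theorem Fn.ev_apply (x : M) (f : Fn m M) : Fn.ev x f = f x := rfl

theorem Fld.sum_apply {ι : Type*} (s : Finset ι) (F : ι → Fld m M) (x : M) :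
    (∑ i ∈ s, F i) x = ∑ i ∈ s, F i x := by
  induction s using Finset.cons_induction with
  | empty => rfl
  | cons a s ha ih => rw [Finset.sum_cons, Finset.sum_cons, ← ih]; rfl

/-- A constant function, as a smooth function. -/
def Fn.const (c : ℝ) : Fn m M := ⟨fun _ => c, contMDiff_const⟩

@[simp] theorem Fn.const_apply (c : ℝ) (x : M) : (Fn.const c : Fn m M) x = c := rfl

theorem Fn.lie_const (X : Fld m M) (c : ℝ) : ⁅X, (Fn.const c : Fn m M)⁆ = 0 := by
  ext x
  change mvfderiv (𝓡 m) (fun _ : M => c) x (X x) = 0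
  rw [mvfderiv_const]; rfl

theorem Fn.two_mul_apply (f : Fn m M) (x : M) : (2 * f) x = 2 * f x := by
  rw [two_mul, two_mul]; rfl

namespace PseudoRiemannianMetric

variable (g : PseudoRiemannianMetric m M)

theorem contMDiff_pair {X Y : ∀ x : M, TangentSpace (𝓡 m) x} (hX : IsSmoothField X)
    (hY : IsSmoothField Y) : ContMDiff (𝓡 m) 𝓘(ℝ, ℝ) ∞ (g.pair X Y) := fun x => by
  have := ContMDiffAt.clm_bundle_apply₂ (F₁ := EuclideanSpace ℝ (Fin m))
    (F₂ := EuclideanSpace ℝ (Fin m)) (F₃ := ℝ) (E₃ := fun _ : M => ℝ) (g.contMDiff x) (hX x) (hY x)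
  rw [contMDiffAt_totalSpace] at this
  exact this.2

/-- The metric as a bilinear form on vector fields. -/
def bilin : Fld m M →ₗ[Fn m M] Fld m M →ₗ[Fn m M] Fn m M :=
  LinearMap.mk₂ (Fn m M) (fun X Y => ⟨g.pair X Y, g.contMDiff_pair X.isSmoothField Y.isSmoothField⟩)
    (fun X X' Y => by ext x; simp [pair]; rfl)
    (fun c X Y => by ext x; simp [pair]; rfl)
    (fun X Y Y' => by ext x; simp [pair]; rfl)
    (fun c X Y => by ext x; simp [pair]; rfl)

theorem bilin_apply (X Y : Fld m M) (x : M) : g.bilin X Y x = g.inner x (X x) (Y x) := rfl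

theorem bilin_symm (X Y : Fld m M) : g.bilin X Y = g.bilin Y X := by
  ext x; exact g.symm x _ _

variable [T2Space M]

theorem ext_inner {x : M} {v w : TangentSpace (𝓡 m) x}
    (h : ∀ Z : Fld m M, g.inner x v (Z x) = g.inner x w (Z x)) : v = w := by
  refine sub_eq_zero.1 (g.nondegenerate x _ fun u => ?_)
  obtain ⟨Z, rfl⟩ := exists_fld_apply_eq u
  simp [h Z]

theorem ext_bilin {X Y : Fld m M} (h : ∀ Z, g.bilin X Z = g.bilin Y Z) : X = Y := by
  ext x : 1
  exact g.ext_inner fun Z => congrArg (fun f : Fn m M => f x) (h Z)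

/-- Cramer's rule for the Gram matrix of a local frame, whose determinant is nonzero by
nondegeneracy. It is needed because `nabla` is chosen separately at each point. -/
theorem isSmoothField_of_inner {W : ∀ x : M, TangentSpace (𝓡 m) x}
    (hW : ∀ Z : Fld m M, ∃ f : Fn m M, ∀ x, g.inner x (W x) (Z x) = f x) : IsSmoothField W := by
  choose f hf using hW
  intro x
  obtain ⟨E, hE, -⟩ := exists_frame (m := m) x
  let G : Matrix (Fin m) (Fin m) (Fn m M) := fun i j => g.bilin (E i) (E j)
  let F : Fld m M := ∑ i, (∑ j, f (E j) * G.adjugate j i) • E i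
  have hdet : ∀ y, LinearIndependent ℝ (fun i => E i y) →
      (∀ v : TangentSpace (𝓡 m) y, ∃ c : Fin m → ℝ, v = ∑ i, c i • E i y) → G.det y ≠ 0 := by
    intro y hli hsp h0
    have h1 : ((Fn.ev y).mapMatrix G).det = 0 := by rw [← RingHom.map_det]; exact h0
    obtain ⟨v, hv, hv0⟩ := Matrix.exists_vecMul_eq_zero_iff.2 h1
    have h2 : ∑ i, v i • E i y = 0 := by
      refine g.nondegenerate y _ fun w => ?_
      obtain ⟨c, rfl⟩ := hsp w
      have h3 : ∀ j, g.inner y (∑ i, v i • E i y) (E j y) = 0 := fun j => by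
        have := congrFun hv0 j
        rw [map_sum, FunLike.coe_sum, Finset.sum_apply]
        simp only [map_smul]
        exact this
      rw [map_sum]
      exact Finset.sum_eq_zero fun j _ => by rw [map_smul, h3, smul_zero]
    exact hv (funext fun i => Fintype.linearIndependent_iff.1 hli v h2 i)
  have key : ∀ᶠ y in 𝓝 x, W y = (G.det y)⁻¹ • F y := by
    filter_upwards [hE] with y hy
    have hd := hdet y hy.1 hy.2
    rw [eq_inv_smul_iff₀ hd]
    obtain ⟨c, hc⟩ := hy.2 (W y)
    have h1 : ∀ j, f (E j) y = ∑ k, c k * G k j y := fun j => by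
      rw [← hf, hc]; simp [G, bilin_apply]
    have h2 : ∀ i, (∑ j, f (E j) * G.adjugate j i) y = G.det y * c i := fun i => by
      have h3 : ∀ k, ∑ j, G k j y * G.adjugate j i y = if k = i then G.det y else 0 := fun k => by
        have := congrArg (fun A : Matrix (Fin m) (Fin m) (Fn m M) => Fn.ev y (A k i)) G.mul_adjugate
        simp only [Matrix.mul_apply, map_sum, map_mul, Matrix.smul_apply, smul_eq_mul] at this
        simp only [Fn.ev_apply, Matrix.one_apply] at this
        rw [this]
        split_ifs <;> simp
      change Fn.ev y _ = _
      simp only [map_sum, map_mul]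
      simp only [Fn.ev_apply, h1, Finset.sum_mul]
      rw [Finset.sum_comm]
      simp only [mul_assoc, ← Finset.mul_sum, h3]
      simp [mul_comm]
    change _ = (∑ i, (∑ j, f (E j) * G.adjugate j i) • E i : Fld m M) y
    rw [Fld.sum_apply, hc, Finset.smul_sum]
    refine Finset.sum_congr rfl fun i _ => ?_
    rw [Fld.smul_apply, h2, smul_smul]
  have hs : ContMDiffAt (𝓡 m) ((𝓡 m).prod 𝓘(ℝ, EuclideanSpace ℝ (Fin m))) ∞
      (fun y ↦ (⟨y, (G.det y)⁻¹ • F y⟩ : TangentBundle (𝓡 m) M)) x := by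
    refine ContMDiffAt.smul_section ?_ (F.contMDiff x)
    exact (G.det.contMDiff x).inv₀ (hdet x hE.self_of_nhds.1 hE.self_of_nhds.2)
  exact hs.congr_of_eventuallyEq (key.mono fun y hy => by simp only [hy])

theorem two_mul_inner_nabla (X Y Z : Fld m M) (x : M) :
    2 * g.inner x (g.nabla X Y x) (Z x) = g.koszul X Y Z x := by
  have h := g.exists_koszul x X.isSmoothField Y.isSmoothField
  rw [nabla, dif_pos h]
  exact h.choose_spec Z Z.isSmoothField

/-- The Koszul expression as a smooth function. -/
def koszulFn (X Y Z : Fld m M) : Fn m M :=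
  ⁅X, g.bilin Y Z⁆ + ⁅Y, g.bilin Z X⁆ - ⁅Z, g.bilin X Y⁆
    + g.bilin ⁅X, Y⁆ Z - g.bilin ⁅Y, Z⁆ X + g.bilin ⁅Z, X⁆ Y

theorem koszulFn_apply (X Y Z : Fld m M) (x : M) : g.koszulFn X Y Z x = g.koszul X Y Z x := rfl

theorem isSmoothField_nabla (X Y : Fld m M) : IsSmoothField (g.nabla X Y) :=
  g.isSmoothField_of_inner fun Z => ⟨Fn.const (1 / 2) * g.koszulFn X Y Z, fun x => by
    have := g.two_mul_inner_nabla X Y Z x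
    change _ = 1 / 2 * g.koszulFn X Y Z x
    rw [koszulFn_apply, ← this]; ring⟩

/-- The Levi-Civita connection on smooth vector fields. -/
def nab (X Y : Fld m M) : Fld m M := (g.isSmoothField_nabla X Y).toFld

theorem two_mul_bilin_nab (X Y Z : Fld m M) : 2 * g.bilin (g.nab X Y) Z = g.koszulFn X Y Z := by
  ext x
  rw [Fn.two_mul_apply]
  exact g.two_mul_inner_nabla X Y Z x

theorem fn_two_cancel (f : Fn m M) (h : 2 * f = 0) : f = 0 := by
  ext x
  have : 2 * f x = 0 := (Fn.two_mul_apply f x).symm.trans (congrArg (fun F : Fn m M => F x) h)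
  simpa using this

theorem ext_koszul {X Y : Fld m M} (h : ∀ Z, 2 * g.bilin X Z = 2 * g.bilin Y Z) : X = Y :=
  g.ext_bilin fun Z => sub_eq_zero.1 (fn_two_cancel _ (by linear_combination h Z))

theorem nab_add_right (X Y Z : Fld m M) : g.nab X (Y + Z) = g.nab X Y + g.nab X Z :=
  g.ext_koszul fun W => by
    simp only [map_add, LinearMap.add_apply, mul_add, two_mul_bilin_nab]
    simp only [koszulFn, map_add, LinearMap.add_apply, lie_add, add_lie]
    abel

theorem nab_add_left (X Y Z : Fld m M) : g.nab (X + Y) Z = g.nab X Z + g.nab Y Z :=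
  g.ext_koszul fun W => by
    simp only [map_add, LinearMap.add_apply, mul_add, two_mul_bilin_nab]
    simp only [koszulFn, map_add, LinearMap.add_apply, lie_add, add_lie]
    abel

theorem lie_smul_left (f : Fn m M) (X Y : Fld m M) : ⁅f • X, Y⁆ = f • ⁅X, Y⁆ - ⁅Y, f⁆ • X := by
  rw [← lie_skew, Fld.lie_smul', ← lie_skew X Y]
  module

theorem fn_smul_lie (f : Fn m M) (X : Fld m M) (a : Fn m M) : ⁅f • X, a⁆ = f * ⁅X, a⁆ :=
  LieRinehartRing.lie_smul_eq_mul f a X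

theorem nab_smul_right (X Y : Fld m M) (f : Fn m M) :
    g.nab X (f • Y) = f • g.nab X Y + ⁅X, f⁆ • Y :=
  g.ext_koszul fun W => by
    have e : 2 * g.bilin (f • g.nab X Y + ⁅X, f⁆ • Y) W =
        f * g.koszulFn X Y W + 2 * ⁅X, f⁆ * g.bilin Y W := by
      rw [← two_mul_bilin_nab]
      simp only [map_add, map_smul, LinearMap.add_apply, LinearMap.smul_apply, smul_eq_mul]; ring
    rw [e, two_mul_bilin_nab]
    simp only [koszulFn, map_smul, LinearMap.smul_apply, smul_eq_mul, Fld.lie_smul', lie_smul_left,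
      Fn.lie_mul, fn_smul_lie, map_add, map_sub, LinearMap.add_apply, LinearMap.sub_apply]
    rw [g.bilin_symm W X, g.bilin_symm Y X]
    ring

theorem nab_smul_left (X Y : Fld m M) (f : Fn m M) : g.nab (f • X) Y = f • g.nab X Y :=
  g.ext_koszul fun W => by
    have e : 2 * g.bilin (f • g.nab X Y) W = f * g.koszulFn X Y W := by
      rw [← two_mul_bilin_nab]
      simp only [map_smul, LinearMap.smul_apply, smul_eq_mul]; ring
    rw [e, two_mul_bilin_nab]
    simp only [koszulFn, map_smul, LinearMap.smul_apply, smul_eq_mul, Fld.lie_smul', lie_smul_left,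
      Fn.lie_mul, fn_smul_lie, map_add, map_sub, LinearMap.add_apply, LinearMap.sub_apply]
    rw [g.bilin_symm W X]
    ring

theorem torsion (X Y : Fld m M) : g.nab X Y - g.nab Y X = ⁅X, Y⁆ :=
  g.ext_koszul fun W => by
    simp only [map_sub, LinearMap.sub_apply, mul_sub, two_mul_bilin_nab]
    simp only [koszulFn]
    rw [← lie_skew X Y, ← lie_skew X W, ← lie_skew Y W, g.bilin_symm W X, g.bilin_symm W Y,
      g.bilin_symm Y X]
    simp only [map_neg, LinearMap.neg_apply]
    ring

theorem metric (X Y Z : Fld m M) :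
    ⁅X, g.bilin Y Z⁆ = g.bilin (g.nab X Y) Z + g.bilin Y (g.nab X Z) := by
  refine sub_eq_zero.1 (fn_two_cancel _ ?_)
  have e : 2 * (⁅X, g.bilin Y Z⁆ - (g.bilin (g.nab X Y) Z + g.bilin Y (g.nab X Z))) =
      2 * ⁅X, g.bilin Y Z⁆ - (g.koszulFn X Y Z + g.koszulFn X Z Y) := by
    rw [← two_mul_bilin_nab, ← two_mul_bilin_nab, g.bilin_symm Y (g.nab X Z)]; ring
  rw [e]
  simp only [koszulFn]
  rw [← lie_skew X Y, ← lie_skew X Z, ← lie_skew Y Z, g.bilin_symm Z X, g.bilin_symm Z Y,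
      g.bilin_symm Y X]
  simp only [map_neg, LinearMap.neg_apply]
  ring

end PseudoRiemannianMetric

end Concrete

/-! ### The geometric structure as an instance of the algebraic one -/

section Structure

variable {n : ℕ} {M : Type*} [TopologicalSpace M]
  [ChartedSpace (EuclideanSpace ℝ (Fin (2 * n + 1))) M] [IsManifold (𝓡 (2 * n + 1)) ∞ M]

namespace ContactPseudoMetric

variable (S : ContactPseudoMetric n M)

theorem isSmoothField_φf (X : Fld (2 * n + 1) M) : IsSmoothField (S.φf X) := fun x =>
  ContMDiffAt.clm_bundle_apply (F₁ := EuclideanSpace ℝ (Fin (2 * n + 1)))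
    (F₂ := EuclideanSpace ℝ (Fin (2 * n + 1))) (S.φ_smooth x) (X.contMDiff x)

theorem contMDiff_η (X : Fld (2 * n + 1) M) :
    ContMDiff (𝓡 (2 * n + 1)) 𝓘(ℝ, ℝ) ∞ (fun x => S.η x (X x)) := fun x => by
  have := ContMDiffAt.clm_bundle_apply (F₁ := EuclideanSpace ℝ (Fin (2 * n + 1)))
    (F₂ := ℝ) (E₂ := fun _ : M => ℝ) (S.η_smooth x) (X.contMDiff x)
  rw [contMDiffAt_totalSpace] at this
  exact this.2

/-- `φ` acting on smooth vector fields. -/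
def φL : Fld (2 * n + 1) M →ₗ[Fn (2 * n + 1) M] Fld (2 * n + 1) M where
  toFun X := (S.isSmoothField_φf X).toFld
  map_add' X Y := by ext x : 1; exact map_add (S.φ x) _ _
  map_smul' c X := by ext x : 1; exact map_smul (S.φ x) _ _

/-- `η` acting on smooth vector fields. -/
def ηL : Fld (2 * n + 1) M →ₗ[Fn (2 * n + 1) M] Fn (2 * n + 1) M where
  toFun X := ⟨fun x => S.η x (X x), S.contMDiff_η X⟩
  map_add' X Y := by ext x : 1; exact map_add (S.η x) _ _
  map_smul' c X := by ext x : 1; exact map_smul (S.η x) _ _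

/-- The characteristic field as a bundled field. -/
def ξL : Fld (2 * n + 1) M := S.ξ_smooth.toFld

/-- From `φ²ξ = 0` one gets `φξ = η(φξ)ξ`; applying `φ` again gives `η(φξ)²ξ = 0`. -/
theorem φ_ξ (x : M) : S.φ x (S.ξ x) = 0 := by
  have h1 : S.φ x (S.φ x (S.ξ x)) = 0 := by rw [S.φ_φ, S.η_ξ]; simp
  have h2 := S.φ_φ x (S.φ x (S.ξ x))
  rw [h1, map_zero] at h2
  have h3 : S.φ x (S.ξ x) = S.η x (S.φ x (S.ξ x)) • S.ξ x := by
    linear_combination (norm := module) h2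
  have h4 : (S.η x (S.φ x (S.ξ x)) * S.η x (S.φ x (S.ξ x))) • S.ξ x = 0 := by
    rw [mul_smul, ← h3, ← map_smul, ← h3, h1]
  have h5 := congrArg (S.η x) h4
  rw [map_smul, S.η_ξ, map_zero, smul_eq_mul, mul_one, mul_self_eq_zero] at h5
  rw [h3, h5, zero_smul]

/-- `h` acting on smooth vector fields. -/
def hL (X : Fld (2 * n + 1) M) : Fld (2 * n + 1) M :=
  (Fn.const (1 / 2) : Fn (2 * n + 1) M) • (⁅S.ξL, S.φL X⁆ - S.φL ⁅S.ξL, X⁆)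

variable [T2Space M]

/-- The algebraic data of a generalized `(κ, μ)`-contact pseudo-metric manifold. -/
def toKappaMuAlgebra {κ μ : M → ℝ} (hκμ : S.IsGeneralizedKappaMu κ μ) :
    KappaMuAlgebra (Fn (2 * n + 1) M) (Fld (2 * n + 1) M) where
  g := S.g.bilin
  nab := S.g.nab
  φ := S.φL
  ξ := S.ξL
  η := S.ηL
  e := Fn.const S.ε
  κ := ⟨κ, hκμ.1⟩
  μ := ⟨μ, hκμ.2.1⟩
  h := S.hL
  two_cancel := PseudoRiemannianMetric.fn_two_cancel
  g_symm := S.g.bilin_symm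
  g_nondeg X h := S.g.ext_bilin fun Z => by simp [h Z]
  nab_add_right := S.g.nab_add_right
  nab_smul_right := S.g.nab_smul_right
  nab_add_left := S.g.nab_add_left
  nab_smul_left := S.g.nab_smul_left
  metric := S.g.metric
  torsion := S.g.torsion
  e_sq := by
    ext x
    change S.ε * S.ε = 1
    rcases S.ε_eq with h | h <;> rw [h] <;> norm_num
  lie_e X := Fn.lie_const X _
  η_ξ := by ext x; exact S.η_ξ x
  φ_ξ := by ext x : 1; exact S.φ_ξ x
  φ_φ X := by ext x : 1; exact S.φ_φ x (X x)
  compat X Y := by ext x; exact S.compatible x (X x) (Y x)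
  contact X Y := by
    ext x
    have h := S.contact X Y X.isSmoothField Y.isSmoothField x
    rw [dForm] at h
    rw [Fn.two_mul_apply]
    change _ = 2 * S.g.inner x (X x) (S.φ x (Y x))
    rw [← h]
    change ⁅X, S.ηL Y⁆ x - ⁅Y, S.ηL X⁆ x - S.ηL ⁅X, Y⁆ x = 2 * (1 / 2 * (⁅X, S.ηL Y⁆ x - ⁅Y, S.ηL X⁆ x - S.ηL ⁅X, Y⁆ x))
    ring
  h_def X := by
    ext x : 1
    rw [two_smul]
    have h : ∀ v : TangentSpace (𝓡 (2 * n + 1)) x, (1 / 2 : ℝ) • v + (1 / 2 : ℝ) • v = v :=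
      fun v => by rw [← add_smul]; norm_num
    exact h _
  curv_ξ X Y := by
    ext x : 1
    exact hκμ.2.2 X Y X.isSmoothField Y.isSmoothField x

end ContactPseudoMetric

end Structure

/-! ### Inequalities behind the maximum principle -/

section PointwiseBounds

theorem quadratic_lower_bound_aux {C G N α β u p : ℝ} (hC : 0 ≤ C) (hG : 0 ≤ G) (hN : 0 ≤ N)
    (hp0 : 0 ≤ p) (h3 : |u - N * β / 2| ≤ C) (h4 : N ^ 2 * α ^ 2 / 4 + u ^ 2 ≤ p ^ 2) :
    N ^ 2 * (α ^ 2 + β ^ 2) / 2 - 2 * C * (N * |β|) - G * (N * (|α| + |β|) / 2 + C) - G ^ 2 / 8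
      ≤ 2 * p ^ 2 - G * p := by
  set A := Real.sqrt (N ^ 2 * α ^ 2 / 4 + u ^ 2) with hA
  have hA0 : 0 ≤ A := Real.sqrt_nonneg _
  have hA2 : A ^ 2 = N ^ 2 * α ^ 2 / 4 + u ^ 2 := Real.sq_sqrt (by positivity)
  have hAp : A ≤ p := by
    rw [hA]; exact (Real.sqrt_le_left hp0).2 h4
  have hNβ : |N * β| = N * |β| := by rw [abs_mul, abs_of_nonneg hN]
  have hNα : |N * α| = N * |α| := by rw [abs_mul, abs_of_nonneg hN]
  have hu1 : |u| ≤ N * |β| / 2 + C := by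
    have : |u| ≤ |u - N * β / 2| + |N * β / 2| := by
      simpa using abs_add_le (u - N * β / 2) (N * β / 2)
    rw [abs_div, hNβ, abs_two] at this
    linarith
  have hA1 : A ≤ N * (|α| + |β|) / 2 + C := by
    rw [hA]
    refine (Real.sqrt_le_left (by positivity)).2 ?_
    have e1 : N ^ 2 * α ^ 2 = (N * |α|) ^ 2 := by rw [mul_pow, sq_abs]
    have e2 : u ^ 2 = |u| ^ 2 := (sq_abs u).symm
    rw [e1, e2]
    have : 0 ≤ N * |α| := by positivity
    nlinarith [abs_nonneg u]
  have hu2 : N ^ 2 * β ^ 2 / 4 - C * (N * |β|) ≤ u ^ 2 := by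
    have e1 : N ^ 2 * β ^ 2 = (N * |β|) ^ 2 := by rw [mul_pow, sq_abs]
    have h5 : N * |β| / 2 - C ≤ |u| := by
      have : |N * β / 2| ≤ |u - N * β / 2| + |u| := by
        have := abs_sub_abs_le_abs_sub (N * β / 2) u
        rw [abs_sub_comm] at this; linarith
      rw [abs_div, hNβ, abs_two] at this
      linarith
    rw [e1, ← sq_abs u]
    have h0 : 0 ≤ N * |β| := by positivity
    rcases le_total C (N * |β| / 2) with h | h
    · have := pow_le_pow_left₀ (by linarith) h5 2
      nlinarith [sq_nonneg C]
    · nlinarith [mul_nonneg h0 (sub_nonneg.2 h), sq_nonneg |u|, mul_nonneg h0 h0]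
  -- The quadratic `2p² - Gp` is not monotone in `p`; passing from `p` to the smaller `A` costs at
  -- most `G² / 8`.
  have h8 : 2 * A ^ 2 - G * A - G ^ 2 / 8 ≤ 2 * p ^ 2 - G * p := by
    nlinarith [sq_nonneg (p - A - G / 4), mul_nonneg hA0 (sub_nonneg.2 hAp)]
  have := mul_le_mul_of_nonneg_left hA1 hG
  linarith

variable {V : Type*} [NormedAddCommGroup V] [InnerProductSpace ℂ V]

open Complex in
-- Since `x + iy` is small, the real parts of `⟨w, x⟩` and `⟨w, y⟩` determine all of `⟨w, x⟩` up to
-- an error. Cauchy-Schwarz then bounds `‖x‖²` below by about `N²(α² + β²)‖w‖²/4`, twice what the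
-- real part of `⟨w, x⟩` gives on average over `x` and `y`.
theorem quadratic_lower_bound {w x y : V} (hw : w ≠ 0) {C G N α β : ℝ} (hC : 0 ≤ C) (hG : 0 ≤ G)
    (hN : 0 ≤ N) (hxy : ‖x + I • y‖ ≤ C * ‖w‖)
    (hx : 2 * (inner ℂ w x).re = -(N * α * ‖w‖ ^ 2))
    (hy : 2 * (inner ℂ w y).re = -(N * β * ‖w‖ ^ 2)) :
    (N ^ 2 * (α ^ 2 + β ^ 2) / 2 - 2 * C * (N * |β|) - G * (N * (|α| + |β|) / 2 + C) - G ^ 2 / 8) *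
      ‖w‖ ^ 2 ≤ 2 * ‖x‖ ^ 2 - G * (‖x‖ * ‖w‖) := by
  have hr : 0 < ‖w‖ := norm_pos_iff.2 hw
  set r := ‖w‖ with hr_def
  set e := x + I • y with he
  have h1 : (inner ℂ w e).re = (inner ℂ w x).re - (inner ℂ w y).im := by
    simp [he, inner_add_right, inner_smul_right]; ring
  have h1' : (inner ℂ w e).im = (inner ℂ w x).im + (inner ℂ w y).re := by
    simp [he, inner_add_right, inner_smul_right]
  have h2 : |(inner ℂ w e).im| ≤ C * r ^ 2 :=
    (abs_im_le_norm _).trans ((norm_inner_le_norm w e).trans (by nlinarith))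
  obtain ⟨u, hu⟩ : ∃ u, (inner ℂ w x).im = u * r ^ 2 := ⟨(inner ℂ w x).im / r ^ 2, by field_simp⟩
  obtain ⟨p, hp⟩ : ∃ p, ‖x‖ = p * r := ⟨‖x‖ / r, by field_simp⟩
  have hr2 : 0 < r ^ 2 := by positivity
  have hp0 : 0 ≤ p := nonneg_of_mul_nonneg_left (hp ▸ norm_nonneg x) hr
  have h3 : |u - N * β / 2| ≤ C := by
    have : (inner ℂ w e).im = (u - N * β / 2) * r ^ 2 := by rw [h1', hu]; linarith
    rw [this, abs_mul, abs_of_pos hr2] at h2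
    exact le_of_mul_le_mul_right h2 hr2
  have h4 : N ^ 2 * α ^ 2 / 4 + u ^ 2 ≤ p ^ 2 := by
    have h5 : ‖inner ℂ w x‖ ^ 2 ≤ (r * ‖x‖) ^ 2 :=
      pow_le_pow_left₀ (norm_nonneg _) (norm_inner_le_norm w x) 2
    rw [← normSq_eq_norm_sq, normSq_apply, hu, hp] at h5
    have h6 : (inner ℂ w x).re = -(N * α / 2) * r ^ 2 := by linarith
    rw [h6] at h5
    have h7 : (N ^ 2 * α ^ 2 / 4 + u ^ 2) * (r ^ 2 * r ^ 2) ≤ p ^ 2 * (r ^ 2 * r ^ 2) := by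
      linarith
    exact le_of_mul_le_mul_right h7 (by positivity)
  have h9 := quadratic_lower_bound_aux hC hG hN hp0 h3 h4
  calc _ ≤ (2 * p ^ 2 - G * p) * r ^ 2 := mul_le_mul_of_nonneg_right h9 hr2.le
    _ = _ := by rw [hp]; ring

open Complex in
/-- At a critical maximum of `log ‖w‖² + N b`, for an approximately holomorphic vector `w`, the
Hessian trace of `b` is controlled by its gradient. -/
theorem second_order_bound {K : Type*} [Fintype K] {C : ℝ} (hC : 0 ≤ C) :
    ∃ D : ℝ, 0 ≤ D ∧ ∀ (w : V) (x y q : K → V) (N : ℝ) (α β τ : K → ℝ), 0 ≤ N → w ≠ 0 →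
      (∀ k, ‖x k + I • y k‖ ≤ C * ‖w‖) →
      (∀ k, 2 * (inner ℂ w (x k)).re = -(N * α k * ‖w‖ ^ 2)) →
      (∀ k, 2 * (inner ℂ w (y k)).re = -(N * β k * ‖w‖ ^ 2)) →
      (∀ k, ‖q k‖ ≤ C * (‖w‖ + ∑ l, (‖x l‖ + ‖y l‖))) →
      (∑ k, (2 * ‖x k‖ ^ 2 + 2 * ‖y k‖ ^ 2 + 2 * (inner ℂ w (q k)).re + N * τ k * ‖w‖ ^ 2) ≤
        ∑ k, N ^ 2 * (α k ^ 2 + β k ^ 2) * ‖w‖ ^ 2) →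
      N * ∑ k, τ k ≤ D * (1 + N * ∑ k, (|α k| + |β k|)) := by
  set c : ℝ := (Fintype.card K : ℝ)
  -- Each `‖x l‖` occurs in the bound on every `q k`, so summation over `k` gives it the coefficient
  -- `2cC`.
  set G : ℝ := 2 * c * C with hG_def
  have hG : 0 ≤ G := by positivity
  refine ⟨G + c * (2 * G * C + G ^ 2 / 4) + (2 * C + G), by positivity, ?_⟩
  intro w x y q N α β τ hN hw hxy hx hy hq hsum
  have hr : 0 < ‖w‖ := norm_pos_iff.2 hw
  have hr2 : 0 < ‖w‖ ^ 2 := by positivity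
  have hq' : ∀ k, -(2 * C * (‖w‖ ^ 2 + ∑ l, (‖x l‖ * ‖w‖ + ‖y l‖ * ‖w‖))) ≤ 2 * (inner ℂ w (q k)).re :=
    fun k => by
      have h1 : |(inner ℂ w (q k)).re| ≤ ‖w‖ * ‖q k‖ :=
        (abs_re_le_norm _).trans (norm_inner_le_norm _ _)
      have h2 := mul_le_mul_of_nonneg_left (hq k) hr.le
      have h3 : ∑ l, (‖x l‖ * ‖w‖ + ‖y l‖ * ‖w‖) = ‖w‖ * ∑ l, (‖x l‖ + ‖y l‖) := by
        rw [Finset.mul_sum]; exact Finset.sum_congr rfl fun l _ => by ring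
      rw [h3]
      have := neg_abs_le (inner ℂ w (q k)).re
      nlinarith
  have hlow : ∀ k, (N ^ 2 * (α k ^ 2 + β k ^ 2) - (2 * C + G) * (N * (|α k| + |β k|)) - (2 * G * C + G ^ 2 / 4)) *
      ‖w‖ ^ 2 ≤ 2 * ‖x k‖ ^ 2 + 2 * ‖y k‖ ^ 2 - G * (‖x k‖ * ‖w‖ + ‖y k‖ * ‖w‖) := fun k => by
    have h1 := quadratic_lower_bound hw hC hG hN (hxy k) (hx k) (hy k)
    -- The bound for `y` uses the pair `(y, -x)`, as `y - ix = -i(x + iy)`. Together the two bounds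
    -- cancel the quadratic gradient term `N²(α² + β²)` of the second order condition exactly.
    have h2 := quadratic_lower_bound (x := y k) (y := -x k) (α := β k) (β := -α k) hw hC hG hN ?_
      (hy k) ?_
    · rw [abs_neg] at h2
      linarith
    · have : y k + I • -x k = (-I) • (x k + I • y k) := by
        rw [smul_add, smul_smul]; simp; abel
      rw [this, norm_smul]
      simpa using hxy k
    · rw [inner_neg_right, neg_re]
      linarith [hx k]
  have h1 := Finset.sum_le_sum fun k (_ : k ∈ Finset.univ) => hlow k
  have h2 := Finset.sum_le_sum fun k (_ : k ∈ Finset.univ) => hq' k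
  simp only [Finset.sum_const, Finset.card_univ, nsmul_eq_mul] at h2
  simp only [Finset.sum_add_distrib, Finset.sum_sub_distrib, ← Finset.sum_mul, ← Finset.mul_sum,
    Finset.sum_const, Finset.card_univ, nsmul_eq_mul] at h1 h2 hsum ⊢
  refine le_of_mul_le_mul_right ?_ hr2
  have hS : 0 ≤ ∑ k, |α k| + ∑ k, |β k| := by positivity
  have h3 : 0 ≤ (G + c * (2 * G * C + G ^ 2 / 4)) * (N * (∑ k, |α k| + ∑ k, |β k|)) * ‖w‖ ^ 2 := by
    positivity
  have h4 : 0 ≤ (2 * C + G) * ‖w‖ ^ 2 := by positivity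
  nlinarith

/-- The parameters of an exponential barrier. -/
theorem exists_barrier_parameter {D C R δ : ℝ} (hD : 0 ≤ D) (hR : 0 ≤ R) (hδ : 0 < δ) :
    ∃ α : ℝ, 0 < α ∧ ∀ β : ℝ, 0 < β → ∃ N₀ : ℝ, 0 ≤ N₀ ∧ ∀ N : ℝ, N₀ ≤ N → ∀ Q s z t B : ℝ,
      δ ≤ Q + z ^ 2 → s ≤ R → t ≤ R → β ≤ B →
      N * (B * (α ^ 2 * Q - α * t)) ≤ D * (1 + N * (α * B * s)) → N * (α * B * |z|) ≤ C → False := by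
  -- Chosen so that `αδ/2` exceeds all error terms. It must not depend on `β`, because the lower
  -- bound `β` of the barrier is itself defined through `α`.
  set α := 2 * (R + D * R + D + 1) / δ with hα
  have hα0 : 0 < α := by positivity
  refine ⟨α, hα0, fun β hβ => ?_⟩
  set c := Real.sqrt (δ / 2) with hc
  have hc0 : 0 < c := Real.sqrt_pos.2 (by positivity)
  -- With `T = NαB`, this `N₀` gives `T ≥ 1` and `Tc > C`. The first order condition along `Z` then
  -- forces `z² < δ/2`, so at least `δ/2` of the gradient lies in `Q`.
  refine ⟨max 0 ((|C| / c + 1) / (α * β)) , le_max_left _ _, ?_⟩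
  intro N hN Q s z t B hQ hs ht hB h1 h2
  have hN0 : 0 ≤ N := (le_max_left _ _).trans hN
  have hN1 : |C| / c + 1 ≤ N * (α * B) := by
    have h3 := (le_max_right _ _).trans hN
    rw [div_le_iff₀ (by positivity)] at h3
    exact h3.trans (mul_le_mul_of_nonneg_left (mul_le_mul_of_nonneg_left hB hα0.le) hN0)
  set T := N * (α * B) with hT
  have hCc : 0 ≤ |C| / c := by positivity
  have hT1 : 1 ≤ T := by linarith
  have hz : |z| < c := by
    by_contra! h
    have : T * c ≤ C := by
      calc T * c ≤ T * |z| := mul_le_mul_of_nonneg_left h (by linarith)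
        _ ≤ C := by rw [hT]; linarith
    have h4 : (|C| / c + 1) * c ≤ T * c := mul_le_mul_of_nonneg_right hN1 hc0.le
    rw [add_mul, div_mul_cancel₀ _ hc0.ne'] at h4
    linarith [le_abs_self C]
  have hz2 : z ^ 2 < δ / 2 := by
    have : z ^ 2 < c ^ 2 := by rw [← sq_abs]; exact pow_lt_pow_left₀ hz (abs_nonneg _) two_ne_zero
    rwa [hc, Real.sq_sqrt (by positivity)] at this
  have hQ2 : δ / 2 < Q := by linarith
  have hαQ : R + D * R + D + 1 < α * Q := by
    have : α * (δ / 2) < α * Q := mul_lt_mul_of_pos_left hQ2 hα0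
    have e : α * (δ / 2) = R + D * R + D + 1 := by rw [hα]; field_simp
    linarith
  have h5 : T * (α * Q - t) ≤ D + D * (T * s) := by rw [hT]; linarith
  have h6 : D * (T * s) ≤ T * (D * R) := by
    have := mul_le_mul_of_nonneg_left hs (mul_nonneg hD (by linarith : 0 ≤ T))
    linarith
  have h7 : D ≤ T * D := by nlinarith
  have h8 : T * (α * Q - t) ≤ T * (D + D * R) := by linarith
  have h9 := le_of_mul_le_mul_left h8 (by linarith : 0 < T)
  linarith

end PointwiseBounds

/-! ### Maxima, locally constant functions and distance functions -/

section Calculus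

variable {m : ℕ} {M : Type*} [TopologicalSpace M] [ChartedSpace (EuclideanSpace ℝ (Fin m)) M]
  [IsManifold (𝓡 m) ∞ M]

/-- The exponential of a smooth function. -/
def Fn.exp (f : Fn m M) : Fn m M := ⟨fun x => Real.exp (f x), Real.contDiff_exp.comp_contMDiff f.contMDiff⟩

theorem Fn.lie_exp (X : Fld m M) (f : Fn m M) : ⁅X, Fn.exp f⁆ = Fn.exp f * ⁅X, f⁆ := by
  ext x
  change mvfderiv (𝓡 m) (Real.exp ∘ f) x (X x) = Real.exp (f x) * mvfderiv (𝓡 m) f x (X x)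
  rw [mvfderiv_comp_apply (I := 𝓘(ℝ, ℝ)) x (Real.differentiable_exp _).mdifferentiableAt (f.mdiff x)]
  have h : ∀ v : ℝ, mvfderiv 𝓘(ℝ, ℝ) Real.exp (f x) v = Real.exp (f x) * v := fun v => by
    change (mfderiv 𝓘(ℝ, ℝ) 𝓘(ℝ, ℝ) Real.exp (f x) : ℝ →L[ℝ] ℝ) v = _
    have h' : fderiv ℝ Real.exp (f x) v = Real.exp (f x) * v := by
      rw [fderiv_eq_smul_deriv, Real.deriv_exp, smul_eq_mul, mul_comm]
    rw [mfderiv_eq_fderiv]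
    exact h'
  exact h _

theorem Fn.hasDerivAt_comp (f : Fn m M) (X : Fld m M) {γ : ℝ → M} {t : ℝ}
    (h : HasMFDerivAt 𝓘(ℝ, ℝ) (𝓡 m) γ t ((1 : ℝ →L[ℝ] ℝ).smulRight (X (γ t)))) :
    HasDerivAt (f ∘ γ) (⁅X, f⁆ (γ t)) t := by
  have h1 := HasMFDerivAt.comp t (f.mdiff (γ t)).hasMFDerivAt h
  have h2 : HasFDerivAt (f ∘ γ) ((1 : ℝ →L[ℝ] ℝ).smulRight (⁅X, f⁆ (γ t))) t := by
    refine (hasMFDerivAt_iff_hasFDerivAt.1 h1).congr_fderiv ?_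
    ext
    change (mfderiv (𝓡 m) 𝓘(ℝ, ℝ) f (γ t)) ((1 : ℝ) • X (γ t)) = (1 : ℝ) • ⁅X, f⁆ (γ t)
    rw [one_smul, one_smul]; rfl
  simpa using! h2.hasDerivAt

variable [T2Space M]

/-- Along an integral curve of `X` the first two derivatives of `f` are `Xf` and `XXf`. If the
second were positive, the point would also be a local minimum, `f` would be constant along the
curve, and the second derivative would vanish. -/
theorem Fn.lie_eq_zero_of_isLocalMax {f : Fn m M} {x : M} (hx : IsLocalMax f x) (X : Fld m M) :
    ⁅X, f⁆ x = 0 ∧ ⁅X, ⁅X, f⁆⁆ x ≤ 0 := by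
  obtain ⟨γ, hγ0, hγ⟩ := exists_isMIntegralCurveAt_of_contMDiffAt_boundaryless (I := 𝓡 m) (t₀ := 0)
    (x₀ := x) (v := X) ((X.contMDiff x).of_le (by exact WithTop.coe_le_coe.2 le_top))
  have hc : ContinuousAt γ 0 := hγ.continuousAt
  have hmax : IsLocalMax (f ∘ γ) 0 := by
    have : Filter.Tendsto γ (𝓝 0) (𝓝 x) := hγ0 ▸ hc
    have h := this.eventually hx
    filter_upwards [h] with t ht
    simpa [hγ0] using ht
  have hd : ∀ᶠ t in 𝓝 (0 : ℝ), HasDerivAt (f ∘ γ) (⁅X, f⁆ (γ t)) t :=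
    Filter.Eventually.mono hγ fun t ht => f.hasDerivAt_comp X ht
  have hde : deriv (f ∘ γ) =ᶠ[𝓝 0] (⁅X, f⁆ : Fn m M) ∘ γ := hd.mono fun t ht => ht.deriv
  have hdd : HasDerivAt ((⁅X, f⁆ : Fn m M) ∘ γ) (⁅X, ⁅X, f⁆⁆ (γ 0)) 0 :=
    Fn.hasDerivAt_comp _ X hγ.self_of_nhds
  have h1 : ⁅X, f⁆ x = 0 := by
    have := hmax.deriv_eq_zero
    rwa [hd.self_of_nhds.deriv, hγ0] at this
  refine ⟨h1, ?_⟩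
  by_contra! hpos
  have h2 : deriv (deriv (f ∘ γ)) 0 > 0 := by
    rw [hde.deriv_eq, hdd.deriv, hγ0]; exact hpos
  have hmin := isLocalMin_of_deriv_deriv_pos h2 hmax.deriv_eq_zero hd.self_of_nhds.continuousAt
  have hconst : f ∘ γ =ᶠ[𝓝 0] fun _ => (f ∘ γ) 0 := by
    filter_upwards [hmax, hmin] with t ht ht'
    exact le_antisymm ht ht'
  have h3 : deriv (f ∘ γ) =ᶠ[𝓝 0] fun _ => 0 := by
    have := hconst.deriv
    simpa using this
  rw [h3.deriv_eq] at h2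
  simp at h2

theorem Fn.eventually_eq_of_lie_eq_zero {f : Fn m M} {x : M}
    (h : ∀ᶠ y in 𝓝 x, ∀ X : Fld m M, ⁅X, f⁆ y = 0) : ∀ᶠ y in 𝓝 x, f y = f x := by
  let φ := extChartAt (𝓡 m) x
  have htar : φ.target ∈ 𝓝 (φ x) := extChartAt_target_mem_nhds x
  have hsymm : ContinuousAt φ.symm (φ x) := continuousAt_extChartAt_symm x
  have hx : φ.symm (φ x) = x := φ.left_inv (mem_extChartAt_source x)
  have h1 : ∀ᶠ u in 𝓝 (φ x), u ∈ φ.target ∧ ∀ X : Fld m M, ⁅X, f⁆ (φ.symm u) = 0 :=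
    (Filter.eventually_mem_set.2 htar).and (hsymm.eventually (by rwa [hx]))
  obtain ⟨r, hr, hball⟩ := Metric.eventually_nhds_iff_ball.1 h1
  have hmd : ∀ u ∈ Metric.ball (φ x) r, HasFDerivAt (f ∘ φ.symm) (0 : EuclideanSpace ℝ (Fin m) →L[ℝ] ℝ) u := fun u hu => by
    have h2 : MDifferentiableAt 𝓘(ℝ, EuclideanSpace ℝ (Fin m)) (𝓡 m) φ.symm u :=
      (((contMDiffOn_extChartAt_symm (n := ∞) x).contMDiffAt
        ((isOpen_extChartAt_target x).mem_nhds (hball u hu).1))).mdifferentiableAt (by simp)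
    have h3 := HasMFDerivAt.comp u (f.mdiff (φ.symm u)).hasMFDerivAt h2.hasMFDerivAt
    have h4 := hasMFDerivAt_iff_hasFDerivAt.1 h3
    refine h4.congr_fderiv ?_
    ext v
    obtain ⟨X, hX⟩ := exists_fld_apply_eq (mfderiv 𝓘(ℝ, EuclideanSpace ℝ (Fin m)) (𝓡 m) φ.symm u v)
    have h5 := (hball u hu).2 X
    rw [Fn.lie_apply', hX] at h5
    exact h5
  have hconst : ∀ u ∈ Metric.ball (φ x) r, f (φ.symm u) = f x := fun u hu => by
    have := (convex_ball (φ x) r).is_const_of_fderivWithin_eq_zero (𝕜 := ℝ) (f := f ∘ φ.symm)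
      (fun v hv => (hmd v hv).differentiableAt.differentiableWithinAt)
      (fun v hv => by
        rw [fderivWithin_of_isOpen Metric.isOpen_ball hv]; exact (hmd v hv).fderiv)
      hu (Metric.mem_ball_self hr)
    simpa [hx] using this
  have hφ : ∀ᶠ y in 𝓝 x, φ y ∈ Metric.ball (φ x) r :=
    (continuousAt_extChartAt (I := 𝓡 m) x) (Metric.ball_mem_nhds _ hr)
  filter_upwards [hφ, extChartAt_source_mem_nhds (I := 𝓡 m) x] with y hy hys
  have := hconst _ hy
  rwa [φ.left_inv hys] at this

theorem Fn.exists_eq_const [ConnectedSpace M] {f : Fn m M}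
    (h : ∀ (X : Fld m M) (x : M), ⁅X, f⁆ x = 0) : ∃ c, ∀ x, f x = c := by
  have hloc : IsLocallyConstant f := IsLocallyConstant.iff_eventually_eq f |>.2 fun x =>
    Fn.eventually_eq_of_lie_eq_zero (Filter.Eventually.of_forall fun y X => h X y)
  obtain ⟨x₀⟩ : Nonempty M := inferInstance
  exact ⟨f x₀, fun x => hloc.apply_eq_of_preconnectedSpace x x₀⟩

/-- The functions `|φ - q|²`, for a chart `φ` at `p`, extended from a neighbourhood of `p`
independent of `q`. -/
theorem exists_dist_sq (p : M) : ∃ ρ : EuclideanSpace ℝ (Fin m) → Fn m M,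
    ∀ᶠ y in 𝓝 p, ∀ q, ρ q y = ‖extChartAt (𝓡 m) p y - q‖ ^ 2 ∧
      (y ∈ (extChartAt (𝓡 m) p).source) ∧
      (extChartAt (𝓡 m) p y ≠ q → ∃ X : Fld m M, ⁅X, ρ q⁆ y ≠ 0) := by
  have hu := (isOpen_extChartAt_source (I := 𝓡 m) p).mem_nhds (mem_extChartAt_source p)
  obtain ⟨ψ, -, hψ⟩ := (SmoothBumpFunction.nhds_basis_tsupport (I := 𝓡 m) p).mem_iff.1 hu
  let U : M → EuclideanSpace ℝ (Fin m) := fun y => ψ y • extChartAt (𝓡 m) p y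
  have hU : ContMDiff (𝓡 m) 𝓘(ℝ, EuclideanSpace ℝ (Fin m)) ∞ U :=
    contMDiff_of_tsupport fun y hy => by
      have hy' : y ∈ (extChartAt (𝓡 m) p).source := hψ (tsupport_smul_subset_left _ _ hy)
      rw [extChartAt_source] at hy'
      exact ψ.contMDiffAt.smul (contMDiffAt_extChartAt' hy')
  have hUe : ∀ᶠ y in 𝓝 p, U y = extChartAt (𝓡 m) p y := by
    filter_upwards [ψ.eventuallyEq_one] with y hy
    change ψ y • _ = _
    rw [hy]; simp
  have hsq : ∀ q : EuclideanSpace ℝ (Fin m), ContDiff ℝ ∞ (fun z => ‖z - q‖ ^ 2) := fun q =>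
    (contDiff_norm_sq ℝ).comp (contDiff_id.sub contDiff_const)
  refine ⟨fun q => ⟨fun y => ‖U y - q‖ ^ 2, (hsq q).comp_contMDiff hU⟩, ?_⟩
  filter_upwards [hUe.eventually_nhds, hu] with y hy hys q
  refine ⟨?_, hys, fun hne => ?_⟩
  · change ‖U y - q‖ ^ 2 = _
    rw [hy.self_of_nhds]
  · obtain ⟨e, he⟩ := isInvertible_mfderiv_extChartAt (I := 𝓡 m) hys
    let z := extChartAt (𝓡 m) p y
    -- The radial direction, along which the derivative is `2‖z - q‖²`.
    obtain ⟨X, hX⟩ := exists_fld_apply_eq (m := m) (x := y) (e.symm (z - q))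
    refine ⟨X, ?_⟩
    have hmd : MDifferentiableAt (𝓡 m) 𝓘(ℝ, EuclideanSpace ℝ (Fin m)) (extChartAt (𝓡 m) p) y :=
      mdifferentiableAt_extChartAt (by rwa [extChartAt_source] at hys)
    have h1 : HasFDerivAt (fun z => ‖z - q‖ ^ 2) (2 • (innerSL ℝ (z - q))) z := by
      have := ((hasFDerivAt_id z).sub_const q).norm_sq
      simpa using! this
    have h2 := HasMFDerivAt.comp y h1.hasMFDerivAt hmd.hasMFDerivAt
    have h3 : (fun y => ‖U y - q‖ ^ 2) =ᶠ[𝓝 y] (fun z => ‖z - q‖ ^ 2) ∘ extChartAt (𝓡 m) p :=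
      hy.mono fun y' hy' => by simp only [Function.comp, hy']
    have h4 := (h2.congr_of_eventuallyEq h3).mfderiv
    have h5 : mfderiv (𝓡 m) 𝓘(ℝ, EuclideanSpace ℝ (Fin m)) (extChartAt (𝓡 m) p) y (X y) = z - q := by
      rw [hX, ← he]; exact e.apply_symm_apply _
    change mfderiv (𝓡 m) 𝓘(ℝ, ℝ) (fun y => ‖U y - q‖ ^ 2) y (X y) ≠ 0
    rw [h4]
    change (2 • (innerSL ℝ (z - q))) (mfderiv (𝓡 m) 𝓘(ℝ, EuclideanSpace ℝ (Fin m)) (extChartAt (𝓡 m) p) y (X y)) ≠ 0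
    rw [h5]
    simp only [_root_.smul_apply, innerSL_apply_apply, real_inner_self_eq_norm_sq]
    have : ‖z - q‖ ≠ 0 := norm_ne_zero_iff.2 (sub_ne_zero.2 hne)
    simpa using this

end Calculus

/-! ### Complex vectors from real and imaginary parts -/

section ComplexVector

variable {ι : Type*} [Fintype ι]

/-- The complex vector with prescribed real and imaginary parts. -/
def cvec (u v : ι → ℝ) : EuclideanSpace ℂ ι := WithLp.toLp 2 fun i => (⟨u i, v i⟩ : ℂ)

theorem norm_cvec_sq (u v : ι → ℝ) : ‖cvec u v‖ ^ 2 = ∑ i, (u i * u i + v i * v i) := by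
  rw [EuclideanSpace.norm_sq_eq]
  refine Finset.sum_congr rfl fun i _ => ?_
  rw [← Complex.normSq_eq_norm_sq, Complex.normSq_apply]; rfl

theorem inner_cvec_re (u v u' v' : ι → ℝ) :
    (inner ℂ (cvec u v) (cvec u' v')).re = ∑ i, (u i * u' i + v i * v' i) := by
  rw [PiLp.inner_apply, Complex.re_sum]
  refine Finset.sum_congr rfl fun i _ => ?_
  simp [cvec]
  ring

theorem cvec_add_I_smul (u v u' v' : ι → ℝ) :
    cvec u v + Complex.I • cvec u' v' = cvec (fun i => u i - v' i) (fun i => v i + u' i) := by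
  ext i
  apply Complex.ext <;> simp [cvec]
  ring

theorem abs_re_le_norm_cvec (u v : ι → ℝ) (i : ι) : |u i| ≤ ‖cvec u v‖ :=
  (Complex.abs_re_le_norm (cvec u v i)).trans (PiLp.norm_apply_le _ i)

theorem abs_im_le_norm_cvec (u v : ι → ℝ) (i : ι) : |v i| ≤ ‖cvec u v‖ :=
  (Complex.abs_im_le_norm (cvec u v i)).trans (PiLp.norm_apply_le _ i)

theorem norm_cvec_le (u v : ι → ℝ) : ‖cvec u v‖ ≤ ∑ i, (|u i| + |v i|) := by
  refine (abs_le_of_sq_le_sq' ?_ (by positivity)).2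
  rw [norm_cvec_sq]
  refine le_trans ?_ (Finset.sum_sq_le_sq_sum_of_nonneg (s := Finset.univ) fun i _ => by positivity)
  refine Finset.sum_le_sum fun i _ => ?_
  nlinarith [abs_mul_abs_self (u i), abs_mul_abs_self (v i), abs_nonneg (u i), abs_nonneg (v i)]

end ComplexVector

/-! ### Estimates for systems of Cauchy-Riemann type -/

section UniqueContinuation

variable {m : ℕ} {M : Type*} [TopologicalSpace M] [ChartedSpace (EuclideanSpace ℝ (Fin m)) M]
  [IsManifold (𝓡 m) ∞ M]

theorem Fn.sum_apply {ι : Type*} (s : Finset ι) (f : ι → Fn m M) (x : M) :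
    (∑ i ∈ s, f i) x = ∑ i ∈ s, f i x := map_sum (Fn.ev x) f s

theorem Fn.mul_apply (f g : Fn m M) (x : M) : (f * g) x = f x * g x := rfl

theorem Fn.add_apply (f g : Fn m M) (x : M) : (f + g) x = f x + g x := rfl

theorem Fn.lie_eventuallyEq {f g : Fn m M} {x : M} (h : ∀ᶠ y in 𝓝 x, f y = g y) (X : Fld m M) :
    ∀ᶠ y in 𝓝 x, ⁅X, f⁆ y = ⁅X, g⁆ y := by
  filter_upwards [h.eventually_nhds] with y hy
  have : (f : M → ℝ) =ᶠ[𝓝 y] g := hy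
  have h' : mfderiv (𝓡 m) 𝓘(ℝ, ℝ) f y = mfderiv (𝓡 m) 𝓘(ℝ, ℝ) g y := this.mfderiv_eq
  change mfderiv (𝓡 m) 𝓘(ℝ, ℝ) f y (X y) = mfderiv (𝓡 m) 𝓘(ℝ, ℝ) g y (X y)
  rw [h']; rfl

variable [T2Space M]

theorem Fn.lie_sum {ι : Type*} (X : Fld m M) (s : Finset ι) (f : ι → Fn m M) :
    ⁅X, ∑ i ∈ s, f i⁆ = ∑ i ∈ s, ⁅X, f i⁆ := by
  induction s using Finset.cons_induction with
  | empty => simp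
  | cons a s ha ih => rw [Finset.sum_cons, Finset.sum_cons, lie_add, ih]

variable {ι K : Type*} [Fintype ι] [Fintype K]

/-- Near `p`, the function `f` is a combination of the functions `a i` with smooth coefficients. -/
def NearCombo (p : M) (a : ι → Fn m M) (f : Fn m M) : Prop :=
  ∃ c : ι → Fn m M, ∀ᶠ y in 𝓝 p, f y = ∑ i, c i y * a i y

/-- The complex vector of values of the functions `a i + √-1 b i`. -/
def fvec (a b : ι → Fn m M) (y : M) : EuclideanSpace ℂ ι := cvec (fun i => a i y) (fun i => b i y)

theorem Fn.isBigO_one (f : Fn m M) (p : M) : (f : M → ℝ) =O[𝓝 p] (fun _ => (1 : ℝ)) :=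
  f.contMDiff.continuous.continuousAt.isBigO_one ℝ

theorem Fn.mul_isBigO {f : M → ℝ} {g : M → ℝ} {p : M} (c : Fn m M) (h : f =O[𝓝 p] g) :
    (fun y => c y * f y) =O[𝓝 p] g := by
  simpa using (c.isBigO_one p).mul h

theorem NearCombo.isBigO {p : M} {a : ι → Fn m M} {f : Fn m M} (h : NearCombo p a f) (b : ι → Fn m M) :
    (f : M → ℝ) =O[𝓝 p] (fun y => ‖fvec a b y‖) := by
  obtain ⟨c, hc⟩ := h
  refine Asymptotics.IsBigO.congr' (f₁ := fun y => ∑ i, c i y * a i y) ?_ (hc.mono fun y hy => hy.symm)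
    Filter.EventuallyEq.rfl
  refine Asymptotics.IsBigO.fun_sum fun i _ => (c i).mul_isBigO ?_
  refine Asymptotics.IsBigO.of_norm_le fun y => ?_
  exact abs_re_le_norm_cvec (fun i => a i y) _ i

theorem NearCombo.lie_isBigO {p : M} {a : ι → Fn m M} {f : Fn m M} (h : NearCombo p a f)
    (b : ι → Fn m M) (X : Fld m M) {G : M → ℝ}
    (hG : ∀ y, ‖fvec a b y‖ ≤ G y)
    (hG' : ∀ y, ‖fvec (fun i => ⁅X, a i⁆) (fun i => ⁅X, b i⁆) y‖ ≤ G y) :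
    (⁅X, f⁆ : Fn m M) =O[𝓝 p] G := by
  obtain ⟨c, hc⟩ := h
  have hc' : ∀ᶠ y in 𝓝 p, f y = (∑ i, c i * a i) y := hc.mono fun y hy => by
    rw [hy, Fn.sum_apply]; rfl
  have h1 := Fn.lie_eventuallyEq hc' X
  have e : ⁅X, ∑ i, c i * a i⁆ = ∑ i, (c i * ⁅X, a i⁆ + ⁅X, c i⁆ * a i) := by
    rw [Fn.lie_sum]; exact Finset.sum_congr rfl fun i _ => Fn.lie_mul _ _ _
  rw [e] at h1
  refine Asymptotics.IsBigO.congr' (f₁ := fun y => ∑ i, (c i y * ⁅X, a i⁆ y + ⁅X, c i⁆ y * a i y)) ?_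
    (h1.mono fun y hy => by rw [hy, Fn.sum_apply]; rfl) Filter.EventuallyEq.rfl
  refine Asymptotics.IsBigO.fun_sum fun i _ => ?_
  refine Asymptotics.IsBigO.add ((c i).mul_isBigO ?_) ((⁅X, c i⁆ : Fn m M).mul_isBigO ?_)
  · refine Asymptotics.IsBigO.of_norm_le fun y => ?_
    exact (abs_re_le_norm_cvec (fun i => ⁅X, a i⁆ y) (fun i => ⁅X, b i⁆ y) i).trans (hG' y)
  · refine Asymptotics.IsBigO.of_norm_le fun y => ?_
    exact (abs_re_le_norm_cvec (fun i => a i y) (fun i => b i y) i).trans (hG y)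

theorem isBigO_cvec {p : M} {u v : ι → M → ℝ} {G : M → ℝ} (hu : ∀ i, u i =O[𝓝 p] G)
    (hv : ∀ i, v i =O[𝓝 p] G) : (fun y => ‖cvec (fun i => u i y) (fun i => v i y)‖) =O[𝓝 p] G := by
  refine Asymptotics.IsBigO.trans (g := fun y => ∑ i, (|u i y| + |v i y|)) ?_ ?_
  · refine Asymptotics.IsBigO.of_norm_le fun y => ?_
    rw [norm_norm]; exact norm_cvec_le _ _
  · exact Asymptotics.IsBigO.fun_sum fun i _ => ((hu i).abs_left).add ((hv i).abs_left)

/-- A system of equations `(X k + √-1 Y k) (a + √-1 b) = O(a)`, `Z (a + √-1 b) = O(a)` near `p`, for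
a bracket generating family of vector fields. -/
structure CRSystem (p : M) (X Y : K → Fld m M) (Z : Fld m M) (a b : ι → Fn m M) : Prop where
  span : ∀ᶠ y in 𝓝 p, ∀ f : Fn m M, (∀ k, ⁅X k, f⁆ y = 0) → (∀ k, ⁅Y k, f⁆ y = 0) → ⁅Z, f⁆ y = 0 →
    ∀ W : Fld m M, ⁅W, f⁆ y = 0
  re k i : NearCombo p a (⁅X k, a i⁆ - ⁅Y k, b i⁆)
  im k i : NearCombo p a (⁅X k, b i⁆ + ⁅Y k, a i⁆)
  lie_a i : NearCombo p a ⁅Z, a i⁆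
  lie_b i : NearCombo p a ⁅Z, b i⁆
  bracket k : ∃ (c : K → Fn m M) (d : Fn m M), ∀ᶠ y in 𝓝 p, ∀ f : Fn m M,
    ⁅⁅X k, Y k⁆, f⁆ y = ∑ l, c l y * ⁅X l, f⁆ y + d y * ⁅Z, f⁆ y

/-- The squared length of `a + √-1 b`. -/
def sqLen (a b : ι → Fn m M) : Fn m M := ∑ i, (a i * a i + b i * b i)

theorem sqLen_apply (a b : ι → Fn m M) (y : M) : sqLen a b y = ‖fvec a b y‖ ^ 2 := by
  rw [fvec, norm_cvec_sq, sqLen, Fn.sum_apply]; rfl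

theorem lie_sqLen (T : Fld m M) (a b : ι → Fn m M) (y : M) :
    ⁅T, sqLen a b⁆ y = 2 * (inner ℂ (fvec a b y) (fvec (fun i => ⁅T, a i⁆) (fun i => ⁅T, b i⁆) y)).re := by
  rw [fvec, fvec, inner_cvec_re, sqLen, Fn.lie_sum, Fn.sum_apply, Finset.mul_sum]
  refine Finset.sum_congr rfl fun i _ => ?_
  rw [lie_add, Fn.lie_mul, Fn.lie_mul]
  simp only [Fn.add_apply, Fn.mul_apply]
  ring

theorem lie_lie_sqLen (T : Fld m M) (a b : ι → Fn m M) (y : M) :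
    ⁅T, ⁅T, sqLen a b⁆⁆ y = 2 * ‖fvec (fun i => ⁅T, a i⁆) (fun i => ⁅T, b i⁆) y‖ ^ 2 +
      2 * (inner ℂ (fvec a b y) (fvec (fun i => ⁅T, ⁅T, a i⁆⁆) (fun i => ⁅T, ⁅T, b i⁆⁆) y)).re := by
  rw [fvec, fvec, fvec, inner_cvec_re, norm_cvec_sq, sqLen, Fn.lie_sum, Fn.lie_sum, Fn.sum_apply,
    Finset.mul_sum, Finset.mul_sum, ← Finset.sum_add_distrib]
  refine Finset.sum_congr rfl fun i _ => ?_
  simp only [lie_add, Fn.lie_mul, Fn.add_apply, Fn.mul_apply]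
  ring

/-- The size of the first jet of `a + √-1 b` in the directions `X`, `Y`. -/
def jetSize (X Y : K → Fld m M) (a b : ι → Fn m M) (y : M) : ℝ :=
  ‖fvec a b y‖ + ∑ l, (‖fvec (fun i => ⁅X l, a i⁆) (fun i => ⁅X l, b i⁆) y‖ +
    ‖fvec (fun i => ⁅Y l, a i⁆) (fun i => ⁅Y l, b i⁆) y‖)

theorem norm_fvec_le_jetSize (X Y : K → Fld m M) (a b : ι → Fn m M) (y : M) :
    ‖fvec a b y‖ ≤ jetSize X Y a b y := le_add_of_nonneg_right (by positivity)

theorem norm_lie_add_le_jetSize (X Y : K → Fld m M) (a b : ι → Fn m M) (l : K) (y : M) :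
    ‖fvec (fun i => ⁅X l, a i⁆) (fun i => ⁅X l, b i⁆) y‖ +
      ‖fvec (fun i => ⁅Y l, a i⁆) (fun i => ⁅Y l, b i⁆) y‖ ≤ jetSize X Y a b y := by
  refine le_trans ?_ (le_add_of_nonneg_left (norm_nonneg _))
  exact Finset.single_le_sum (f := fun l => ‖fvec (fun i => ⁅X l, a i⁆) (fun i => ⁅X l, b i⁆) y‖ +
    ‖fvec (fun i => ⁅Y l, a i⁆) (fun i => ⁅Y l, b i⁆) y‖) (fun _ _ => by positivity)
    (Finset.mem_univ l)

theorem norm_lie_left_le_jetSize (X Y : K → Fld m M) (a b : ι → Fn m M) (l : K) (y : M) :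
    ‖fvec (fun i => ⁅X l, a i⁆) (fun i => ⁅X l, b i⁆) y‖ ≤ jetSize X Y a b y :=
  (le_add_of_nonneg_right (norm_nonneg _)).trans (norm_lie_add_le_jetSize X Y a b l y)

theorem norm_lie_right_le_jetSize (X Y : K → Fld m M) (a b : ι → Fn m M) (l : K) (y : M) :
    ‖fvec (fun i => ⁅Y l, a i⁆) (fun i => ⁅Y l, b i⁆) y‖ ≤ jetSize X Y a b y :=
  (le_add_of_nonneg_left (norm_nonneg _)).trans (norm_lie_add_le_jetSize X Y a b l y)

namespace CRSystem

variable {p : M} {X Y : K → Fld m M} {Z : Fld m M} {a b : ι → Fn m M}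

theorem norm_isBigO_jetSize (X Y : K → Fld m M) (a b : ι → Fn m M) (p : M) :
    (fun y => ‖fvec a b y‖) =O[𝓝 p] jetSize X Y a b :=
  Asymptotics.IsBigO.of_norm_le fun y => by rw [norm_norm]; exact norm_fvec_le_jetSize X Y a b y

theorem lie_bracket_isBigO (h : CRSystem p X Y Z a b) (k : K) (f : Fn m M) {G : M → ℝ}
    (hf : ∀ l, (⁅X l, f⁆ : Fn m M) =O[𝓝 p] G) (hZ : (⁅Z, f⁆ : Fn m M) =O[𝓝 p] G) :
    (⁅⁅X k, Y k⁆, f⁆ : Fn m M) =O[𝓝 p] G := by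
  obtain ⟨c, d, hcd⟩ := h.bracket k
  refine Asymptotics.IsBigO.congr' (f₁ := fun y => ∑ l, c l y * ⁅X l, f⁆ y + d y * ⁅Z, f⁆ y) ?_
    (hcd.mono fun y hy => (hy f).symm) Filter.EventuallyEq.rfl
  exact (Asymptotics.IsBigO.fun_sum fun l _ => (c l).mul_isBigO (hf l)).add (d.mul_isBigO hZ)

theorem lie_bracket_a_isBigO (h : CRSystem p X Y Z a b) (k : K) (i : ι) :
    (⁅⁅X k, Y k⁆, a i⁆ : Fn m M) =O[𝓝 p] jetSize X Y a b :=
  h.lie_bracket_isBigO k _ (fun l => Asymptotics.IsBigO.of_norm_le fun y =>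
      (abs_re_le_norm_cvec (fun i => ⁅X l, a i⁆ y) (fun i => ⁅X l, b i⁆ y) i).trans
        (norm_lie_left_le_jetSize X Y a b l y))
    (((h.lie_a i).isBigO b).trans (norm_isBigO_jetSize X Y a b p))

theorem lie_bracket_b_isBigO (h : CRSystem p X Y Z a b) (k : K) (i : ι) :
    (⁅⁅X k, Y k⁆, b i⁆ : Fn m M) =O[𝓝 p] jetSize X Y a b :=
  h.lie_bracket_isBigO k _ (fun l => Asymptotics.IsBigO.of_norm_le fun y =>
      (abs_im_le_norm_cvec (fun i => ⁅X l, a i⁆ y) (fun i => ⁅X l, b i⁆ y) i).trans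
        (norm_lie_left_le_jetSize X Y a b l y))
    (((h.lie_b i).isBigO b).trans (norm_isBigO_jetSize X Y a b p))

theorem lie_isBigO (h : CRSystem p X Y Z a b) (k : K) :
    (fun y => ‖fvec (fun i => ⁅X k, a i⁆) (fun i => ⁅X k, b i⁆) y +
        Complex.I • fvec (fun i => ⁅Y k, a i⁆) (fun i => ⁅Y k, b i⁆) y‖) =O[𝓝 p]
        (fun y => ‖fvec a b y‖) := by
  simp only [fvec, cvec_add_I_smul]
  exact isBigO_cvec (u := fun i y => (⁅X k, a i⁆ - ⁅Y k, b i⁆ : Fn m M) y)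
    (v := fun i y => (⁅X k, b i⁆ + ⁅Y k, a i⁆ : Fn m M) y)
    (fun i => (h.re k i).isBigO b) (fun i => (h.im k i).isBigO b)

/-- Factor `X² + Y² = (X - iY)(X + iY) - i[X, Y]`. The first product differentiates an `O(w)` term
once, and the bracket involves only the directions `X l` and `Z`, so second derivatives are
controlled by the first jet. -/
theorem lie_lie_isBigO (h : CRSystem p X Y Z a b) (k : K) :
    (fun y => ‖fvec (fun i => ⁅X k, ⁅X k, a i⁆⁆ + ⁅Y k, ⁅Y k, a i⁆⁆)
      (fun i => ⁅X k, ⁅X k, b i⁆⁆ + ⁅Y k, ⁅Y k, b i⁆⁆) y‖) =O[𝓝 p] jetSize X Y a b := by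
  have e1 : ∀ i, ⁅X k, ⁅X k, a i⁆⁆ + ⁅Y k, ⁅Y k, a i⁆⁆ = ⁅X k, ⁅X k, a i⁆ - ⁅Y k, b i⁆⁆ +
      ⁅Y k, ⁅X k, b i⁆ + ⁅Y k, a i⁆⁆ + ⁅⁅X k, Y k⁆, b i⁆ := fun i => by
    rw [lie_lie, lie_sub, lie_add]; abel
  have e2 : ∀ i, ⁅X k, ⁅X k, b i⁆⁆ + ⁅Y k, ⁅Y k, b i⁆⁆ = ⁅X k, ⁅X k, b i⁆ + ⁅Y k, a i⁆⁆ -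
      ⁅Y k, ⁅X k, a i⁆ - ⁅Y k, b i⁆⁆ - ⁅⁅X k, Y k⁆, a i⁆ := fun i => by
    rw [lie_lie, lie_sub, lie_add]; abel
  have hw := norm_fvec_le_jetSize X Y a b
  refine isBigO_cvec (u := fun i y => (⁅X k, ⁅X k, a i⁆⁆ + ⁅Y k, ⁅Y k, a i⁆⁆ : Fn m M) y)
    (v := fun i y => (⁅X k, ⁅X k, b i⁆⁆ + ⁅Y k, ⁅Y k, b i⁆⁆ : Fn m M) y) (fun i => ?_) (fun i => ?_)
  · rw [e1]
    exact (((h.re k i).lie_isBigO b (X k) hw (norm_lie_left_le_jetSize X Y a b k)).add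
      ((h.im k i).lie_isBigO b (Y k) hw (norm_lie_right_le_jetSize X Y a b k))).add
      (h.lie_bracket_b_isBigO k i)
  · rw [e2]
    exact (((h.im k i).lie_isBigO b (X k) hw (norm_lie_left_le_jetSize X Y a b k)).sub
      ((h.re k i).lie_isBigO b (Y k) hw (norm_lie_right_le_jetSize X Y a b k))).sub
      (h.lie_bracket_a_isBigO k i)

theorem lie_sqLen_isBigO (h : CRSystem p X Y Z a b) :
    (⁅Z, sqLen a b⁆ : Fn m M) =O[𝓝 p] (fun y => ‖fvec a b y‖ ^ 2) := by
  have hz : (fun y => ‖fvec (fun i => ⁅Z, a i⁆) (fun i => ⁅Z, b i⁆) y‖) =O[𝓝 p]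
      (fun y => ‖fvec a b y‖) :=
    isBigO_cvec (u := fun i y => (⁅Z, a i⁆ : Fn m M) y) (v := fun i y => (⁅Z, b i⁆ : Fn m M) y)
      (fun i => (h.lie_a i).isBigO b) (fun i => (h.lie_b i).isBigO b)
  have hz2 := ((Asymptotics.isBigO_refl (fun y => ‖fvec a b y‖) (𝓝 p)).mul hz).const_mul_left 2
  refine Asymptotics.IsBigO.trans (Asymptotics.IsBigO.of_norm_le fun y => ?_)
    (hz2.congr_right fun y => (sq _).symm)
  rw [lie_sqLen, Real.norm_eq_abs, abs_mul, abs_two]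
  exact mul_le_mul_of_nonneg_left ((Complex.abs_re_le_norm _).trans (norm_inner_le_norm _ _))
    zero_le_two

theorem exists_uniform_bound {K N : Type*} [Fintype K] {l : Filter N} {u : K → N → ℝ} {G : N → ℝ}
    (hG : ∀ y, 0 ≤ G y) (h : ∀ k, u k =O[l] G) :
    ∃ C : ℝ, 0 ≤ C ∧ ∀ᶠ y in l, ∀ k, |u k y| ≤ C * G y := by
  choose C hC using fun k => (h k).bound
  refine ⟨∑ k, |C k|, by positivity, ?_⟩
  filter_upwards [Filter.eventually_all.2 hC] with y hy k
  have h1 := hy k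
  rw [Real.norm_eq_abs, Real.norm_of_nonneg (hG y)] at h1
  refine h1.trans (mul_le_mul_of_nonneg_right ((le_abs_self _).trans ?_) (hG y))
  exact Finset.single_le_sum (f := fun k => |C k|) (fun _ _ => abs_nonneg _) (Finset.mem_univ k)

theorem exists_bound (h : CRSystem p X Y Z a b) : ∃ C : ℝ, 0 ≤ C ∧ ∀ᶠ y in 𝓝 p,
      (∀ k, ‖fvec (fun i => ⁅X k, a i⁆) (fun i => ⁅X k, b i⁆) y +
        Complex.I • fvec (fun i => ⁅Y k, a i⁆) (fun i => ⁅Y k, b i⁆) y‖ ≤ C * ‖fvec a b y‖) ∧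
      (∀ k, ‖fvec (fun i => ⁅X k, ⁅X k, a i⁆⁆ + ⁅Y k, ⁅Y k, a i⁆⁆)
          (fun i => ⁅X k, ⁅X k, b i⁆⁆ + ⁅Y k, ⁅Y k, b i⁆⁆) y‖ ≤ C * jetSize X Y a b y) ∧
      |⁅Z, sqLen a b⁆ y| ≤ C * ‖fvec a b y‖ ^ 2 := by
  have hG : ∀ y, 0 ≤ jetSize X Y a b y := fun y =>
    (norm_nonneg _).trans (norm_fvec_le_jetSize X Y a b y)
  obtain ⟨C₁, h1, hC₁⟩ := exists_uniform_bound (fun y => norm_nonneg _) h.lie_isBigO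
  obtain ⟨C₂, h2, hC₂⟩ := exists_uniform_bound hG h.lie_lie_isBigO
  obtain ⟨C₃, h3, hC₃⟩ := exists_uniform_bound (K := Unit) (fun y => sq_nonneg ‖fvec a b y‖)
    (fun _ => h.lie_sqLen_isBigO)
  refine ⟨C₁ + C₂ + C₃, by positivity, ?_⟩
  filter_upwards [hC₁, hC₂, hC₃] with y h1 h2 h3
  refine ⟨fun k => ?_, fun k => ?_, ?_⟩
  · refine (le_abs_self _).trans ((h1 k).trans (mul_le_mul_of_nonneg_right (by linarith) (norm_nonneg _)))
  · refine (le_abs_self _).trans ((h2 k).trans (mul_le_mul_of_nonneg_right (by linarith) (hG y)))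
  · exact (h3 ()).trans (mul_le_mul_of_nonneg_right (by linarith) (sq_nonneg _))

end CRSystem

end UniqueContinuation

/-! ### The barrier argument and unique continuation -/

section UniqueContinuation

variable {m : ℕ} {M : Type*} [TopologicalSpace M] [ChartedSpace (EuclideanSpace ℝ (Fin m)) M]
  [IsManifold (𝓡 m) ∞ M] [T2Space M]

theorem Fn.lie_const_mul (X : Fld m M) (c : ℝ) (f : Fn m M) :
    ⁅X, Fn.const c * f⁆ = Fn.const c * ⁅X, f⁆ := by
  rw [Fn.lie_mul, Fn.lie_const, zero_mul, add_zero]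

/-- First and second order conditions at a maximum of `f exp (N b)`. -/
theorem Fn.lie_of_isLocalMax_mul_exp {f b : Fn m M} {N : ℝ} {x : M}
    (hx : IsLocalMax (f * Fn.exp (Fn.const N * b) : Fn m M) x) (T : Fld m M) :
    ⁅T, f⁆ x = -(N * ⁅T, b⁆ x * f x) ∧
      ⁅T, ⁅T, f⁆⁆ x + N * ⁅T, ⁅T, b⁆⁆ x * f x ≤ N ^ 2 * ⁅T, b⁆ x ^ 2 * f x := by
  obtain ⟨h1, h2⟩ := Fn.lie_eq_zero_of_isLocalMax hx T
  have hE : 0 < Fn.exp (Fn.const N * b) x := Real.exp_pos _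
  set E := Fn.exp (Fn.const N * b)
  have e1 : ⁅T, f * E⁆ = E * (⁅T, f⁆ + Fn.const N * ⁅T, b⁆ * f) := by
    rw [Fn.lie_mul, Fn.lie_exp, Fn.lie_const_mul]; ring
  have e2 : ⁅T, ⁅T, f * E⁆⁆ = E * (⁅T, ⁅T, f⁆⁆ + (Fn.const N * ⁅T, b⁆ * ⁅T, f⁆ + Fn.const N * ⁅T, b⁆ * ⁅T, f⁆) +
      Fn.const N * ⁅T, ⁅T, b⁆⁆ * f + Fn.const N * ⁅T, b⁆ * (Fn.const N * ⁅T, b⁆) * f) := by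
    rw [e1, Fn.lie_mul, lie_add, Fn.lie_mul, Fn.lie_const_mul, Fn.lie_exp, Fn.lie_const_mul]; ring
  rw [e1] at h1
  rw [e2] at h2
  have h1' : ⁅T, f⁆ x + N * ⁅T, b⁆ x * f x = 0 := (mul_eq_zero.1 h1).resolve_left hE.ne'
  have h2' := nonpos_of_mul_nonpos_right h2 hE
  simp only [Fn.add_apply, Fn.mul_apply, Fn.const_apply] at h2'
  have h3 : ⁅T, f⁆ x = -(N * ⁅T, b⁆ x * f x) := by linarith
  refine ⟨h3, ?_⟩
  rw [h3] at h2'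
  linarith

theorem Fn.lie_barrier (T : Fld m M) (α : ℝ) (ρ : Fn m M) (x : M) :
    ⁅T, Fn.exp (Fn.const (-α) * ρ)⁆ x = -(α * ⁅T, ρ⁆ x * Fn.exp (Fn.const (-α) * ρ) x) ∧
    ⁅T, ⁅T, Fn.exp (Fn.const (-α) * ρ)⁆⁆ x =
      (α ^ 2 * ⁅T, ρ⁆ x ^ 2 - α * ⁅T, ⁅T, ρ⁆⁆ x) * Fn.exp (Fn.const (-α) * ρ) x := by
  rw [Fn.lie_exp, Fn.lie_const_mul, Fn.lie_mul, Fn.lie_exp, Fn.lie_const_mul, Fn.lie_const_mul]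
  simp only [Fn.add_apply, Fn.mul_apply, Fn.const_apply]
  constructor <;> ring

variable {ι K : Type*} [Fintype ι] [Fintype K]
variable {X Y : K → Fld m M} {Z : Fld m M} {a b : ι → Fn m M}

theorem inner_fvec_add (u v u' v' : ι → Fn m M) (w : EuclideanSpace ℂ ι) (x : M) :
    inner ℂ w (fvec (fun i => u i + u' i) (fun i => v i + v' i) x) =
      inner ℂ w (fvec u v x) + inner ℂ w (fvec u' v' x) := by
  rw [← inner_add_right]
  congr 1

/-- For large parameters, `|a + √-1 b|² exp (N exp (-α ρ))` has no positive local maximum where the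
solution satisfies the differential inequalities and `ρ` is noncritical. -/
theorem exists_barrier_exponent {C R δ : ℝ} (hC : 0 ≤ C) (hR : 0 ≤ R) (hδ : 0 < δ) :
    ∃ α : ℝ, 0 < α ∧ ∀ β : ℝ, 0 < β → ∃ N₀ : ℝ, 0 ≤ N₀ ∧ ∀ N : ℝ, N₀ ≤ N → ∀ (ρ : Fn m M) (x : M),
      IsLocalMax (sqLen a b * Fn.exp (Fn.const N * Fn.exp (Fn.const (-α) * ρ)) : Fn m M) x →
      fvec a b x ≠ 0 →
      (∀ k, ‖fvec (fun i => ⁅X k, a i⁆) (fun i => ⁅X k, b i⁆) x +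
        Complex.I • fvec (fun i => ⁅Y k, a i⁆) (fun i => ⁅Y k, b i⁆) x‖ ≤ C * ‖fvec a b x‖) →
      (∀ k, ‖fvec (fun i => ⁅X k, ⁅X k, a i⁆⁆ + ⁅Y k, ⁅Y k, a i⁆⁆)
          (fun i => ⁅X k, ⁅X k, b i⁆⁆ + ⁅Y k, ⁅Y k, b i⁆⁆) x‖ ≤ C * jetSize X Y a b x) →
      |⁅Z, sqLen a b⁆ x| ≤ C * ‖fvec a b x‖ ^ 2 →
      δ ≤ ∑ k, (⁅X k, ρ⁆ x ^ 2 + ⁅Y k, ρ⁆ x ^ 2) + ⁅Z, ρ⁆ x ^ 2 →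
      ∑ k, (|⁅X k, ρ⁆ x| + |⁅Y k, ρ⁆ x|) ≤ R →
      ∑ k, (⁅X k, ⁅X k, ρ⁆⁆ x + ⁅Y k, ⁅Y k, ρ⁆⁆ x) ≤ R →
      β ≤ Fn.exp (Fn.const (-α) * ρ) x → False := by
  obtain ⟨D, hD, hD'⟩ := second_order_bound (V := EuclideanSpace ℂ ι) (K := K) hC
  obtain ⟨α, hα, h⟩ := exists_barrier_parameter (C := C) hD hR hδ
  refine ⟨α, hα, fun β hβ => ?_⟩
  obtain ⟨N₀, hN₀, h'⟩ := h β hβ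
  refine ⟨N₀, hN₀, fun N hN ρ x hx hw h1 h2 h3 hQ hs ht hB => ?_⟩
  have hN0 : 0 ≤ N := hN₀.trans hN
  set B := Fn.exp (Fn.const (-α) * ρ) with hBdef
  have hB0 : 0 < B x := Real.exp_pos _
  have hf : sqLen a b x = ‖fvec a b x‖ ^ 2 := sqLen_apply a b x
  have hf0 : 0 < ‖fvec a b x‖ ^ 2 := by have := norm_pos_iff.2 hw; positivity
  have hfirst : ∀ T : Fld m M, ⁅T, sqLen a b⁆ x = -(N * ⁅T, B⁆ x * ‖fvec a b x‖ ^ 2) := fun T => by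
    rw [← hf]; exact (Fn.lie_of_isLocalMax_mul_exp hx T).1
  have hsecond : ∀ T : Fld m M, ⁅T, ⁅T, sqLen a b⁆⁆ x + N * ⁅T, ⁅T, B⁆⁆ x * ‖fvec a b x‖ ^ 2 ≤
      N ^ 2 * ⁅T, B⁆ x ^ 2 * ‖fvec a b x‖ ^ 2 := fun T => by
    rw [← hf]; exact (Fn.lie_of_isLocalMax_mul_exp hx T).2
  have key := hD' (fvec a b x) (fun k => fvec (fun i => ⁅X k, a i⁆) (fun i => ⁅X k, b i⁆) x)
    (fun k => fvec (fun i => ⁅Y k, a i⁆) (fun i => ⁅Y k, b i⁆) x)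
    (fun k => fvec (fun i => ⁅X k, ⁅X k, a i⁆⁆ + ⁅Y k, ⁅Y k, a i⁆⁆)
          (fun i => ⁅X k, ⁅X k, b i⁆⁆ + ⁅Y k, ⁅Y k, b i⁆⁆) x) N
    (fun k => ⁅X k, B⁆ x) (fun k => ⁅Y k, B⁆ x)
    (fun k => ⁅X k, ⁅X k, B⁆⁆ x + ⁅Y k, ⁅Y k, B⁆⁆ x) hN0 hw h1
    (fun k => by rw [← lie_sqLen, hfirst]) (fun k => by rw [← lie_sqLen, hfirst]) h2
    (by
      refine Finset.sum_le_sum fun k _ => ?_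
      have hX := hsecond (X k)
      have hY := hsecond (Y k)
      rw [lie_lie_sqLen] at hX hY
      rw [inner_fvec_add, Complex.add_re]
      linarith)
  have e1 : ∀ T : Fld m M, ⁅T, B⁆ x = -(α * ⁅T, ρ⁆ x * B x) := fun T => (Fn.lie_barrier T α ρ x).1
  have e2 : ∀ T : Fld m M, ⁅T, ⁅T, B⁆⁆ x = (α ^ 2 * ⁅T, ρ⁆ x ^ 2 - α * ⁅T, ⁅T, ρ⁆⁆ x) * B x :=
    fun T => (Fn.lie_barrier T α ρ x).2
  have e3 : ∀ T : Fld m M, |⁅T, B⁆ x| = α * B x * |⁅T, ρ⁆ x| := fun T => by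
    rw [e1, abs_neg, abs_mul, abs_mul, abs_of_pos hα, abs_of_pos hB0]; ring
  refine h' N hN (∑ k, (⁅X k, ρ⁆ x ^ 2 + ⁅Y k, ρ⁆ x ^ 2)) (∑ k, (|⁅X k, ρ⁆ x| + |⁅Y k, ρ⁆ x|)) (⁅Z, ρ⁆ x)
    (∑ k, (⁅X k, ⁅X k, ρ⁆⁆ x + ⁅Y k, ⁅Y k, ρ⁆⁆ x)) (B x) hQ hs ht hB ?_ ?_
  · have e4 : ∑ k, (⁅X k, ⁅X k, B⁆⁆ x + ⁅Y k, ⁅Y k, B⁆⁆ x) = B x *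
        (α ^ 2 * ∑ k, (⁅X k, ρ⁆ x ^ 2 + ⁅Y k, ρ⁆ x ^ 2) - α * ∑ k, (⁅X k, ⁅X k, ρ⁆⁆ x + ⁅Y k, ⁅Y k, ρ⁆⁆ x)) := by
      rw [Finset.mul_sum, Finset.mul_sum, ← Finset.sum_sub_distrib, Finset.mul_sum]
      refine Finset.sum_congr rfl fun k _ => ?_
      rw [e2, e2]; ring
    have e5 : ∑ k, (|⁅X k, B⁆ x| + |⁅Y k, B⁆ x|) = α * B x * ∑ k, (|⁅X k, ρ⁆ x| + |⁅Y k, ρ⁆ x|) := by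
      rw [Finset.mul_sum]
      refine Finset.sum_congr rfl fun k _ => ?_
      rw [e3, e3]; ring
    rw [e4, e5] at key
    exact key
  · rw [hfirst, abs_neg, abs_mul, abs_of_pos hf0, abs_mul, e3, abs_of_nonneg hN0] at h3
    exact le_of_mul_le_mul_right h3 hf0

/-- Unique continuation for solutions of a system of Cauchy-Riemann type. -/
theorem CRSystem.eventually_eq_zero {p : M} (h : CRSystem p X Y Z a b)
    (hp : p ∈ closure {y : M | ∀ᶠ z in 𝓝 y, sqLen a b z = 0}) :
    ∀ᶠ z in 𝓝 p, sqLen a b z = 0 := by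
  obtain ⟨C, hC, hbound⟩ := h.exists_bound
  obtain ⟨ρ, hρ⟩ := exists_dist_sq (m := m) p
  set f := sqLen a b with hf_def
  have hf0 : ∀ y, 0 ≤ f y := fun y => by rw [hf_def, sqLen_apply]; positivity
  set φ := extChartAt (𝓡 m) p with hφ
  have hall := (hbound.and h.span).and hρ
  have htar : φ.target ∈ 𝓝 (φ p) := extChartAt_target_mem_nhds p
  have hleft : φ.symm (φ p) = p := φ.left_inv (mem_extChartAt_source p)
  have hsymm : ContinuousAt φ.symm (φ p) := continuousAt_extChartAt_symm p
  have hnear := (Filter.eventually_mem_set.2 htar).and (hsymm.eventually (hleft.symm ▸ hall))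
  obtain ⟨r', hr', hball⟩ := Metric.eventually_nhds_iff_ball.1 hnear
  -- The centre `q` is taken within `r` of the image of `p`, so the ball of radius `3r` about `q`
  -- stays inside radius `r'` and contains the `r`-ball about that image.
  obtain ⟨r, hr, hrr⟩ : ∃ r, 0 < r ∧ 4 * r < r' := ⟨r' / 5, by positivity, by linarith⟩
  have hφc : ContinuousAt φ p := continuousAt_extChartAt p
  obtain ⟨y₀, hy₀, hy₀V⟩ := mem_closure_iff_nhds.1 hp _
    (Filter.inter_mem (hφc (Metric.ball_mem_nhds _ hr)) (extChartAt_source_mem_nhds (I := 𝓡 m) p))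
  set q := φ y₀ with hq
  have hqp : dist q (φ p) < r := hy₀.1
  have hsub : Metric.closedBall q (3 * r) ⊆ Metric.ball (φ p) r' := fun u hu => by
    have := dist_triangle u q (φ p)
    rw [Metric.mem_closedBall] at hu
    rw [Metric.mem_ball]; linarith
  have hcont : ContinuousOn φ.symm (Metric.closedBall q (3 * r)) := fun u hu =>
    ((continuousOn_extChartAt_symm (I := 𝓡 m) p).continuousAt
      ((isOpen_extChartAt_target p).mem_nhds (hball u (hsub hu)).1)).continuousWithinAt
  have hq_symm : φ.symm q = y₀ := φ.left_inv hy₀.2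
  have hqmem : q ∈ Metric.closedBall q (3 * r) := Metric.mem_closedBall_self (by positivity)
  obtain ⟨d, hd, hdz⟩ : ∃ d > 0, ∀ u ∈ Metric.ball q d, f (φ.symm u) = 0 := by
    have : ContinuousAt φ.symm q := (continuousOn_extChartAt_symm (I := 𝓡 m) p).continuousAt
      ((isOpen_extChartAt_target p).mem_nhds (hball q (hsub hqmem)).1)
    have h1 : ∀ᶠ u in 𝓝 q, f (φ.symm u) = 0 := this.eventually (hq_symm.symm ▸ hy₀V)
    exact Metric.eventually_nhds_iff_ball.1 h1
  have hchart : ∀ u ∈ Metric.closedBall q (3 * r), φ (φ.symm u) = u := fun u hu =>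
    φ.right_inv (hball u (hsub hu)).1
  have hρu : ∀ u ∈ Metric.closedBall q (3 * r), ρ q (φ.symm u) = ‖u - q‖ ^ 2 := fun u hu => by
    rw [((hball u (hsub hu)).2.2 q).1, hchart u hu]
  -- bounds on the compact annulus
  set A := Metric.closedBall q (3 * r) \ Metric.ball q d with hA
  have hAc : IsCompact A := (isCompact_closedBall q (3 * r)).diff Metric.isOpen_ball
  have hAcont : ∀ F : Fn m M, ContinuousOn (fun u => F (φ.symm u)) A := fun F =>
    F.contMDiff.continuous.comp_continuousOn (hcont.mono Set.sdiff_subset)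
  -- The only critical point of the squared distance in the closed ball is `q`, and the ball of
  -- radius `d` about it, where `f` vanishes, has been removed. By `span`, the derivatives along
  -- `X`, `Y`, `Z` detect every nonzero gradient, so compactness gives `δ`.
  obtain ⟨δ, hδ, hδ'⟩ : ∃ δ, 0 < δ ∧ ∀ u ∈ A, δ ≤ ∑ k, (⁅X k, ρ q⁆ (φ.symm u) ^ 2 +
      ⁅Y k, ρ q⁆ (φ.symm u) ^ 2) + ⁅Z, ρ q⁆ (φ.symm u) ^ 2 := by
    refine hAc.exists_forall_le' ?_ fun u hu => ?_
    · refine ContinuousOn.add (continuousOn_finsetSum _ fun k _ => ?_) ((hAcont _).pow 2)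
      exact ((hAcont _).pow 2).add ((hAcont _).pow 2)
    · by_contra! hle
      have hnn : 0 ≤ ∑ k, (⁅X k, ρ q⁆ (φ.symm u) ^ 2 + ⁅Y k, ρ q⁆ (φ.symm u) ^ 2) :=
        Finset.sum_nonneg fun k _ => by positivity
      have hz : ⁅Z, ρ q⁆ (φ.symm u) = 0 := pow_eq_zero_iff two_ne_zero |>.1
        (le_antisymm (by linarith) (sq_nonneg _))
      have hsum0 : ∑ k, (⁅X k, ρ q⁆ (φ.symm u) ^ 2 + ⁅Y k, ρ q⁆ (φ.symm u) ^ 2) = 0 :=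
        le_antisymm (by nlinarith [sq_nonneg (⁅Z, ρ q⁆ (φ.symm u))]) hnn
      have hk := (Finset.sum_eq_zero_iff_of_nonneg fun k _ => by positivity).1 hsum0
      have hX : ∀ k, ⁅X k, ρ q⁆ (φ.symm u) = 0 := fun k => pow_eq_zero_iff two_ne_zero |>.1
        (le_antisymm (by nlinarith [hk k (Finset.mem_univ k), sq_nonneg (⁅Y k, ρ q⁆ (φ.symm u))]) (sq_nonneg _))
      have hY : ∀ k, ⁅Y k, ρ q⁆ (φ.symm u) = 0 := fun k => pow_eq_zero_iff two_ne_zero |>.1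
        (le_antisymm (by nlinarith [hk k (Finset.mem_univ k), sq_nonneg (⁅X k, ρ q⁆ (φ.symm u))]) (sq_nonneg _))
      have hfacts := (hball u (hsub hu.1)).2
      obtain ⟨W, hW⟩ := (hfacts.2 q).2.2 (by
        rw [hchart u hu.1]
        rintro rfl
        exact hu.2 (Metric.mem_ball_self hd))
      exact hW (hfacts.1.2 (ρ q) hX hY hz W)
  obtain ⟨R₁, hR₁⟩ := hAc.exists_bound_of_continuousOn
    (f := fun u => ∑ k, (|⁅X k, ρ q⁆ (φ.symm u)| + |⁅Y k, ρ q⁆ (φ.symm u)|))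
    (continuousOn_finsetSum _ fun k _ => ((hAcont _).abs).add ((hAcont _).abs))
  obtain ⟨R₂, hR₂⟩ := hAc.exists_bound_of_continuousOn
    (f := fun u => ∑ k, (⁅X k, ⁅X k, ρ q⁆⁆ (φ.symm u) + ⁅Y k, ⁅Y k, ρ q⁆⁆ (φ.symm u)))
    (continuousOn_finsetSum _ fun k _ => (hAcont _).add (hAcont _))
  obtain ⟨α, hα, hbar⟩ := exists_barrier_exponent (m := m) (M := M) (X := X) (Y := Y) (Z := Z) (a := a)
    (b := b) (R := max 0 (max R₁ R₂)) hC (le_max_left _ _) hδ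
  set B := Fn.exp (Fn.const (-α) * ρ q) with hB
  have hBu : ∀ u ∈ Metric.closedBall q (3 * r), B (φ.symm u) = Real.exp (-α * ‖u - q‖ ^ 2) :=
    fun u hu => by
      rw [← hρu u hu]; rfl
  set β := Real.exp (-α * (3 * r) ^ 2) with hβ
  have hBβ : ∀ u ∈ Metric.closedBall q (3 * r), β ≤ B (φ.symm u) := fun u hu => by
    rw [hBu u hu, hβ]
    refine Real.exp_le_exp.2 ?_
    have : ‖u - q‖ ≤ 3 * r := by rwa [← dist_eq_norm]
    have := pow_le_pow_left₀ (norm_nonneg _) this 2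
    nlinarith
  obtain ⟨N₀, hN₀, hbar'⟩ := hbar β (Real.exp_pos _)
  have hcont' : ∀ F : Fn m M, ContinuousOn (fun u => F (φ.symm u)) (Metric.closedBall q (3 * r)) :=
    fun F => F.contMDiff.continuous.comp_continuousOn hcont
  obtain ⟨L, hL⟩ := (isCompact_closedBall q (3 * r)).exists_bound_of_continuousOn (hcont' f)
  -- A positive maximum cannot lie in the inner ball, where `f = 0`, nor in the open annulus, by the
  -- barrier. It lies on the sphere of radius `3r`, where the barrier has its minimum `β`.
  have hmax : ∀ N, N₀ ≤ N → ∀ u ∈ Metric.closedBall q (3 * r),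
      f (φ.symm u) * Real.exp (N * B (φ.symm u)) ≤ L * Real.exp (N * β) := by
    intro N hN
    obtain ⟨u₁, hu₁, hmax⟩ := (isCompact_closedBall q (3 * r)).exists_isMaxOn ⟨q, hqmem⟩
      (hcont' (f * Fn.exp (Fn.const N * B)))
    have hle : f (φ.symm u₁) * Real.exp (N * B (φ.symm u₁)) ≤ L * Real.exp (N * β) := by
      have hfL : f (φ.symm u₁) ≤ L := (le_abs_self _).trans (hL u₁ hu₁)
      have hL0 : 0 ≤ L := (norm_nonneg _).trans (hL u₁ hu₁)
      by_cases hz : f (φ.symm u₁) = 0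
      · rw [hz, zero_mul]; positivity
      by_cases hlt : dist u₁ q < 3 * r
      · exfalso
        have hu₁A : u₁ ∈ A := ⟨hu₁, fun hh => hz (hdz u₁ hh)⟩
        have hfacts := (hball u₁ (hsub hu₁)).2
        have hsrc : φ.symm u₁ ∈ φ.source := φ.map_target (hball u₁ (hsub hu₁)).1
        have hloc : IsLocalMax (f * Fn.exp (Fn.const N * B) : Fn m M) (φ.symm u₁) := by
          have hc1 : ContinuousAt φ (φ.symm u₁) := continuousAt_extChartAt' hsrc
          have h1 : ∀ᶠ y in 𝓝 (φ.symm u₁), φ y ∈ Metric.ball q (3 * r) := by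
            apply hc1
            rw [hchart u₁ hu₁]
            exact Metric.isOpen_ball.mem_nhds hlt
          filter_upwards [h1, (isOpen_extChartAt_source (I := 𝓡 m) p).mem_nhds hsrc] with y hy hys
          have := hmax (Metric.ball_subset_closedBall hy)
          simpa only [Set.mem_ofPred_eq, φ.left_inv hys] using this
        refine hbar' N hN (ρ q) (φ.symm u₁) hloc ?_ hfacts.1.1.1 hfacts.1.1.2.1 hfacts.1.1.2.2
          (hδ' u₁ hu₁A) (((le_abs_self _).trans (hR₁ u₁ hu₁A)).trans ((le_max_left _ _).trans (le_max_right _ _)))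
          (((le_abs_self _).trans (hR₂ u₁ hu₁A)).trans ((le_max_right _ _).trans (le_max_right _ _)))
          (hBβ u₁ hu₁)
        intro h0
        apply hz
        rw [hf_def, sqLen_apply, h0]; simp
      · have hB1 : B (φ.symm u₁) = β := by
          rw [hBu u₁ hu₁, ← dist_eq_norm, le_antisymm hu₁ (not_lt.1 hlt)]
        rw [hB1]
        exact mul_le_mul_of_nonneg_right hfL (Real.exp_pos _).le
    exact fun u hu => (hmax hu).trans hle
  -- Inside the sphere `B > β`, and `f exp (N(B - β)) ≤ L` for all large `N` leaves only `f = 0`.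
  have hzero : ∀ u ∈ Metric.ball q (3 * r), f (φ.symm u) = 0 := by
    intro u hu
    by_contra hne
    have hpos : 0 < f (φ.symm u) := lt_of_le_of_ne (hf0 _) (Ne.symm hne)
    have hu' := Metric.ball_subset_closedBall hu
    have hc : 0 < B (φ.symm u) - β := by
      rw [hBu u hu', hβ, sub_pos]
      refine Real.exp_lt_exp.2 ?_
      have : ‖u - q‖ < 3 * r := by rwa [← dist_eq_norm]
      have := pow_lt_pow_left₀ this (norm_nonneg _) two_ne_zero
      nlinarith
    set c := B (φ.symm u) - β
    have hlim : Filter.Tendsto (fun N : ℝ => f (φ.symm u) * Real.exp (N * c)) Filter.atTop Filter.atTop :=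
      (Real.tendsto_exp_atTop.comp (Filter.tendsto_id.atTop_mul_const hc)).const_mul_atTop hpos
    obtain ⟨N, hN1, hN2⟩ := ((hlim.eventually_gt_atTop L).and (Filter.eventually_ge_atTop N₀)).exists
    have h1 := hmax N hN2 u hu'
    have e : Real.exp (N * B (φ.symm u)) = Real.exp (N * c) * Real.exp (N * β) := by
      rw [← Real.exp_add]; congr 1; ring
    rw [e, ← mul_assoc] at h1
    exact absurd (le_of_mul_le_mul_right h1 (Real.exp_pos _)) (not_le.2 hN1)
  filter_upwards [hφc (Metric.ball_mem_nhds _ hr), extChartAt_source_mem_nhds (I := 𝓡 m) p] with y hy hys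
  have hyq : φ y ∈ Metric.ball q (3 * r) := by
    have h1 := dist_triangle (φ y) (φ p) q
    have h2 : dist (φ y) (φ p) < r := hy
    rw [dist_comm (φ p) q] at h1
    rw [Metric.mem_ball]; linarith
  have := hzero _ hyq
  rwa [φ.left_inv hys] at this

end UniqueContinuation

/-! ### Unique continuation for the tensor `s` -/

section Pointwise

variable {m : ℕ} {M : Type*} [TopologicalSpace M] [ChartedSpace (EuclideanSpace ℝ (Fin m)) M]
  [IsManifold (𝓡 m) ∞ M]

theorem Fn.lie_eq_sum {ι : Type*} [Fintype ι] {W : Fld m M} {E : ι → Fld m M} {c : ι → ℝ} {y : M}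
    (h : W y = ∑ i, c i • E i y) (f : Fn m M) : ⁅W, f⁆ y = ∑ i, c i * ⁅E i, f⁆ y := by
  rw [Fn.lie_apply', h, map_sum]
  refine Finset.sum_congr rfl fun i _ => ?_
  rw [map_smul]; rfl

variable [T2Space M]

theorem Fn.add_lie_apply (X Y : Fld m M) (f : Fn m M) (y : M) :
    ⁅X + Y, f⁆ y = ⁅X, f⁆ y + ⁅Y, f⁆ y := by
  rw [add_lie]; rfl

theorem Fn.smul_lie_apply (c : Fn m M) (X : Fld m M) (f : Fn m M) (y : M) :
    ⁅c • X, f⁆ y = c y * ⁅X, f⁆ y := by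
  rw [PseudoRiemannianMetric.fn_smul_lie]; rfl

end Pointwise

namespace KappaMuAlgebra

section UniqueContinuation

variable {m : ℕ} {M : Type*} [TopologicalSpace M] [ChartedSpace (EuclideanSpace ℝ (Fin m)) M]
  [IsManifold (𝓡 m) ∞ M] [T2Space M]
variable (C : KappaMuAlgebra (Fn m M) (Fld m M)) {G : PseudoRiemannianMetric m M}

/-- The horizontal part of a vector field. -/
def hor (X : Fld m M) : Fld m M := -C.φ (C.φ X)

theorem η_hor (X : Fld m M) : C.η (C.hor X) = 0 := by rw [hor, map_neg, C.η_φ, neg_zero]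

theorem hor_add (X : Fld m M) : C.hor X + C.η X • C.ξ = X := by rw [hor, C.φ_φ]; abel

theorem φ_hor (X : Fld m M) : C.φ (C.hor X) = C.φ X := by
  rw [hor, map_neg, C.φ_φ_of_hor (C.η_φ X), neg_neg]

theorem s_hor (X : Fld m M) : C.s (C.hor X) = C.s X := by
  rw [hor, map_neg, C.s_φ_φ, neg_neg]

theorem S_hor_right (X Y : Fld m M) : C.g (C.s X) (C.hor Y) = C.g (C.s X) Y :=
  C.g_hor_φ_φ (C.η_s X) Y

theorem lie_eq_hor (X : Fld m M) (f : Fn m M) (y : M) :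
    ⁅X, f⁆ y = ⁅C.hor X, f⁆ y + C.η X y * ⁅C.ξ, f⁆ y := by
  rw [← Fn.smul_lie_apply, ← Fn.add_lie_apply, C.hor_add]

theorem S_eq_sum (hg : ∀ X Y x, C.g X Y x = G.inner x (X x) (Y x)) {ι : Type*} [Fintype ι]
    {X Y : Fld m M} {E : ι → Fld m M} {c d : ι → ℝ} {y : M}
    (hX : X y = ∑ i, c i • E i y) (hY : Y y = ∑ i, d i • E i y) :
    C.g (C.s X) Y y = ∑ i : ι × ι, (c i.1 * d i.2) * C.g (C.s (E i.1)) (E i.2) y := by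
  have h1 : C.g (C.s X) Y y = ∑ i, c i * C.g (C.s (E i)) Y y := by
    rw [C.s_symm, hg, hX, map_sum, FunLike.coe_sum, Finset.sum_apply]
    refine Finset.sum_congr rfl fun i _ => ?_
    rw [map_smul, C.s_symm, hg]; rfl
  have h2 : ∀ i, C.g (C.s (E i)) Y y = ∑ j, d j * C.g (C.s (E i)) (E j) y := fun i => by
    rw [hg, hY, map_sum]
    refine Finset.sum_congr rfl fun j _ => ?_
    rw [map_smul, hg]; rfl
  rw [h1, Fintype.sum_prod_type]
  refine Finset.sum_congr rfl fun i _ => ?_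
  rw [h2, Finset.mul_sum]
  exact Finset.sum_congr rfl fun j _ => by ring

theorem nearCombo_of_mem (hg : ∀ X Y x, C.g X Y x = G.inner x (X x) (Y x)) {p : M}
    {E : Fin m → Fld m M}
    (hE : ∀ W : Fld m M, ∃ c : Fin m → Fn m M, ∀ᶠ y in 𝓝 p, W y = ∑ i, c i y • E i y)
    {f : Fn m M} (hf : f ∈ C.sIdeal) :
    NearCombo p (fun i : Fin m × Fin m => C.g (C.s (E i.1)) (E i.2)) f := by
  refine Submodule.span_induction ?_ ?_ ?_ ?_ hf
  · rintro _ ⟨⟨X, Y⟩, rfl⟩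
    obtain ⟨c, hc⟩ := hE X
    obtain ⟨d, hd⟩ := hE Y
    refine ⟨fun i => c i.1 * d i.2, ?_⟩
    filter_upwards [hc, hd] with y hcy hdy
    exact C.S_eq_sum hg hcy hdy
  · exact ⟨0, Filter.Eventually.of_forall fun y => by
      change (0 : ℝ) = ∑ i, (0 : ℝ) * _
      simp⟩
  · rintro f₁ f₂ - - ⟨c, hc⟩ ⟨d, hd⟩
    refine ⟨c + d, ?_⟩
    filter_upwards [hc, hd] with y hcy hdy
    rw [Fn.add_apply, hcy, hdy, ← Finset.sum_add_distrib]
    refine Finset.sum_congr rfl fun i _ => ?_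
    rw [Pi.add_apply, Fn.add_apply]; ring
  · rintro r f₁ - ⟨c, hc⟩
    refine ⟨fun i => r * c i, ?_⟩
    filter_upwards [hc] with y hcy
    rw [smul_eq_mul, Fn.mul_apply, hcy, Finset.mul_sum]
    refine Finset.sum_congr rfl fun i _ => ?_
    rw [Fn.mul_apply]; ring

theorem mem_of_two_mul_mem {f : Fn m M} (h : 2 * f ∈ C.sIdeal) : f ∈ C.sIdeal := by
  have e : f = Fn.const (1 / 2) * (2 * f) := by
    ext x
    rw [Fn.mul_apply, Fn.two_mul_apply, Fn.const_apply]; ring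
  rw [e]
  exact C.sIdeal.mul_mem_left _ h

/-- The unknown is the complex vector with entries `S(E i, E j) - √-1 S(φ E i, E j)`, where `S =
g(s·, ·)`. Its real and imaginary equations are `cauchyRiemann_mem` for `E i` and for `φ E i`; the
horizontal parts of the frame together with `ξ` span the tangent space. -/
theorem crSystem (hg : ∀ X Y x, C.g X Y x = G.inner x (X x) (Y x)) {p : M} {E : Fin m → Fld m M}
    (hsp : ∀ᶠ y in 𝓝 p, ∀ v : TangentSpace (𝓡 m) y, ∃ c : Fin m → ℝ, v = ∑ i, c i • E i y)
    (hE : ∀ W : Fld m M, ∃ c : Fin m → Fn m M, ∀ᶠ y in 𝓝 p, W y = ∑ i, c i y • E i y) :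
    CRSystem p (fun k => C.hor (E k)) (fun k => C.φ (E k)) C.ξ
      (fun i : Fin m × Fin m => C.g (C.s (E i.1)) (E i.2))
      (fun i : Fin m × Fin m => -C.g (C.s (C.φ (E i.1))) (E i.2)) where
  span := by
    filter_upwards [hsp] with y hy f hX _ hZ W
    obtain ⟨c, hc⟩ := hy (W y)
    rw [Fn.lie_eq_sum hc]
    refine Finset.sum_eq_zero fun i _ => ?_
    rw [C.lie_eq_hor, hX, hZ]; simp
  re k i := C.nearCombo_of_mem hg hE <| C.mem_of_two_mul_mem <| by
    have h := C.cauchyRiemann_mem (C.η_hor (E k)) (C.η_hor (E i.1)) (C.η_hor (E i.2))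
    rw [C.s_hor, C.φ_hor, C.φ_hor, C.S_hor_right, C.S_hor_right] at h
    rwa [lie_neg, sub_neg_eq_add]
  im k i := C.nearCombo_of_mem hg hE <| C.mem_of_two_mul_mem <| by
    have h := C.cauchyRiemann_mem (C.η_hor (E k)) (C.η_φ (E i.1)) (C.η_hor (E i.2))
    have e : C.s (C.φ (C.φ (E i.1))) = -C.s (E i.1) := C.s_φ_φ _
    rw [C.φ_hor, C.S_hor_right, C.S_hor_right, e, map_neg, LinearMap.neg_apply, lie_neg] at h
    have h' := neg_mem h
    rw [lie_neg]
    convert! h' using 1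
    ring
  lie_a i := C.nearCombo_of_mem hg hE (C.lie_ξ_S_mem _ _)
  lie_b i := C.nearCombo_of_mem hg hE (by rw [lie_neg]; exact neg_mem (C.lie_ξ_S_mem _ _))
  bracket k := by
    obtain ⟨c, hc⟩ := hE ⁅C.hor (E k), C.φ (E k)⁆
    refine ⟨c, ∑ i, c i * C.η (E i), ?_⟩
    filter_upwards [hc] with y hy f
    rw [Fn.lie_eq_sum hy, Fn.sum_apply, Finset.sum_mul, ← Finset.sum_add_distrib]
    refine Finset.sum_congr rfl fun i _ => ?_
    rw [C.lie_eq_hor (E i), Fn.mul_apply]; ring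

/-- If the tensor `s` vanishes on a nonempty open set of a connected manifold, it vanishes. -/
theorem s_eq_zero_of_eventually [ConnectedSpace M]
    (hg : ∀ X Y x, C.g X Y x = G.inner x (X x) (Y x)) {x₀ : M}
    (h₀ : ∀ᶠ y in 𝓝 x₀, ∀ X Y, C.g (C.s X) Y y = 0) (X : Fld m M) : C.s X = 0 := by
  set V : Set M := {x | ∀ᶠ y in 𝓝 x, ∀ X Y, C.g (C.s X) Y y = 0} with hV
  have hopen : IsOpen V := by
    rw [isOpen_iff_mem_nhds]
    exact fun x hx => Filter.Eventually.eventually_nhds hx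
  have hclosed : IsClosed V := by
    -- A connectedness argument: the interior of the zero set of `s` is open by definition, and
    -- closed by unique continuation.
    refine isClosed_of_closure_subset fun p hp => ?_
    obtain ⟨E, hli, hE⟩ := exists_frame (m := m) p
    have hsp := hli.mono fun y hy => hy.2
    have hsys := C.crSystem hg hsp hE
    have h1 := hsys.eventually_eq_zero (closure_mono (fun x hx => ?_) hp)
    · filter_upwards [h1, hsp] with y hy hspy X Y
      obtain ⟨c, hc⟩ := hspy (X y)
      obtain ⟨d, hd⟩ := hspy (Y y)
      rw [C.S_eq_sum hg hc hd]
      refine Finset.sum_eq_zero fun i _ => ?_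
      rw [sqLen_apply, sq_eq_zero_iff] at hy
      have h2 := abs_re_le_norm_cvec (fun i : Fin m × Fin m => C.g (C.s (E i.1)) (E i.2) y)
        (fun i : Fin m × Fin m => (-C.g (C.s (C.φ (E i.1))) (E i.2) : Fn m M) y) i
      have h3 : |C.g (C.s (E i.1)) (E i.2) y| ≤ 0 := h2.trans hy.le
      rw [abs_nonpos_iff.1 h3, mul_zero]
    · refine Filter.Eventually.mono hx fun y hy => ?_
      rw [sqLen, Fn.sum_apply]
      refine Finset.sum_eq_zero fun i _ => ?_
      rw [neg_mul_neg, Fn.add_apply, Fn.mul_apply, Fn.mul_apply, hy, hy]; simp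
  have huniv : V = Set.univ := IsClopen.eq_univ ⟨hclosed, hopen⟩ ⟨x₀, h₀⟩
  refine C.ext_g fun Y => ?_
  ext y
  have hy : y ∈ V := huniv ▸ Set.mem_univ y
  have := Filter.Eventually.self_of_nhds hy X Y
  rw [this, map_zero]; rfl

end UniqueContinuation

end KappaMuAlgebra

/-! ### Rigidity of `κ` and `μ` -/

namespace KappaMuAlgebra

section Rigidity

variable {m : ℕ} {M : Type*} [TopologicalSpace M] [ChartedSpace (EuclideanSpace ℝ (Fin m)) M]
  [IsManifold (𝓡 m) ∞ M] [T2Space M]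
variable (C : KappaMuAlgebra (Fn m M) (Fld m M)) {G : PseudoRiemannianMetric m M}

theorem lie_apply_eq_zero_of_inner (hg : ∀ X Y x, C.g X Y x = G.inner x (X x) (Y x)) {x : M}
    {X : Fld m M} (hX : ∀ Z, Fn.ev x (C.g X Z) = 0) (f : Fn m M) : Fn.ev x ⁅X, f⁆ = 0 := by
  have h0 : X x = 0 := G.ext_inner fun Z => by
    rw [← hg, map_zero]; exact hX Z
  rw [Fn.ev_apply, Fn.lie_apply', h0, map_zero]

theorem lie_ξ_κ_apply {x : M} {V : Fld m M} (hV : C.φ V x ≠ 0) : ⁅C.ξ, C.κ⁆ x = 0 := by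
  have h1 := congrArg C.φ (C.lie_ξ_κ V)
  rw [map_smul, C.φ_φ_of_hor (C.η_φ V), map_zero] at h1
  have h2 : ⁅C.ξ, C.κ⁆ x • (-C.φ V) x = 0 := congrArg (fun F : Fld m M => F x) h1
  exact (smul_eq_zero.1 h2).resolve_right fun h => hV (neg_eq_zero.1 h)

/-- A function whose horizontal derivatives vanish near a point has vanishing derivative along `ξ`
there, because the contact distribution is not integrable. -/
theorem lie_ξ_apply_eq_zero (hg : ∀ X Y x, C.g X Y x = G.inner x (X x) (Y x)) {x : M} {V : Fld m M}
    (hV : C.φ V x ≠ 0) {f : Fn m M} (hf : ∀ (X : Fld m M) (y : M), C.η X = 0 → ⁅X, f⁆ y = 0) :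
    ⁅C.ξ, f⁆ x = 0 := by
  obtain ⟨Z, hZ⟩ : ∃ Z, C.g (C.φ V) Z x ≠ 0 := by
    by_contra! h
    exact hV (G.ext_inner fun Z => by rw [← hg, h, map_zero]; rfl)
  set X := C.φ V
  set Y := C.φ Z
  have hX : C.η X = 0 := C.η_φ V
  have hY : C.η Y = 0 := C.η_φ Z
  have hlie : ∀ {X : Fld m M}, C.η X = 0 → ⁅X, f⁆ = 0 := fun hX => by ext y; exact hf _ y hX
  have h1 : ⁅⁅X, Y⁆, f⁆ = 0 := by
    rw [lie_lie, hlie hX, hlie hY, lie_zero, lie_zero, sub_zero]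
  have h2 := C.lie_eq_hor ⁅X, Y⁆ f x
  rw [h1, hf _ x (C.η_hor _)] at h2
  have h3 : C.η ⁅X, Y⁆ = 2 * C.g X Z := by
    have h := C.contact X Y
    rw [hX, hY, lie_zero, lie_zero] at h
    have e : C.g X (C.φ Y) = -C.g X Z := by
      rw [← C.g_hor_φ_φ hX Z, map_neg, neg_neg]
    rw [e] at h
    linear_combination -h
  rw [h3, Fn.two_mul_apply] at h2
  have h4 : 2 * C.g X Z x * ⁅C.ξ, f⁆ x = 0 := by simpa using h2.symm
  exact (mul_eq_zero.1 h4).resolve_left (mul_ne_zero two_ne_zero hZ)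

theorem lie_apply_eq_zero {f : Fn m M} {x : M} (hξ : ⁅C.ξ, f⁆ x = 0)
    (hf : ∀ X : Fld m M, C.η X = 0 → ⁅X, f⁆ x = 0) (X : Fld m M) : ⁅X, f⁆ x = 0 := by
  rw [C.lie_eq_hor, hf _ (C.η_hor X), hξ]; simp

theorem φ_s_φ_s {X : Fld m M} (hX : C.η X = 0) :
    C.φ (C.s (C.φ (C.s X))) = (1 - C.e * C.κ) • X := by
  rw [C.s_φ, map_neg, C.φ_φ_of_hor (C.η_s _), neg_neg, C.s_s_of_hor hX]

theorem lie_κ_apply (hg : ∀ X Y x, C.g X Y x = G.inner x (X x) (Y x)) {x : M}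
    (hx : (C.e * C.κ) x ≠ 1) {X : Fld m M} (hX : C.η X = 0) :
    ⁅X, C.κ⁆ x = ⁅C.φ (C.s X), C.μ⁆ x :=
  C.ev_lie_κ (Fn.ev x) hx (fun _ hX f => C.lie_apply_eq_zero_of_inner hg hX f) hX

/-- Two uses of `Xκ = (hX)μ = u (hX)κ` and `h² = 1 - eκ` give `Xκ = u²(1 - eκ) Xκ`. Where `Xκ ≠ 0`,
the function `eκ` is locally the constant `1 - u⁻²`, a contradiction. -/
theorem lie_κ_eq_zero_of_ne (hg : ∀ X Y x, C.g X Y x = G.inner x (X x) (Y x))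
    (hV : ∀ x : M, ∃ V : Fld m M, C.φ V x ≠ 0) {u v : ℝ} (hu : C.μ = Fn.const u * C.κ + Fn.const v)
    {x : M} (hx : (C.e * C.κ) x ≠ 1) (T : Fld m M) : ⁅T, C.κ⁆ x = 0 := by
  obtain ⟨V, hVx⟩ := hV x
  refine C.lie_apply_eq_zero (C.lie_ξ_κ_apply hVx) (fun X hX => ?_) T
  have hμ : ∀ (T : Fld m M) y, ⁅T, C.μ⁆ y = u * ⁅T, C.κ⁆ y := fun T y => by
    rw [hu, lie_add, Fn.lie_const, add_zero, Fn.lie_const_mul]; rfl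
  have hΩ : ∀ᶠ y in 𝓝 x, (C.e * C.κ) y ≠ 1 :=
    (C.e * C.κ).contMDiff.continuous.continuousAt.eventually_ne hx
  have key : ∀ y, (C.e * C.κ) y ≠ 1 → ⁅X, C.κ⁆ y = u ^ 2 * (1 - (C.e * C.κ) y) * ⁅X, C.κ⁆ y := by
    intro y hy
    have h1 := C.lie_κ_apply hg hy hX
    have h2 := C.lie_κ_apply hg hy (C.η_φ (C.s X))
    rw [C.φ_s_φ_s hX, Fn.smul_lie_apply] at h2
    rw [hμ] at h1 h2
    have e : (1 - C.e * C.κ) y = 1 - (C.e * C.κ) y := rfl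
    rw [e] at h2
    rw [h2] at h1
    linear_combination h1
  by_contra hne
  have hne' : ∀ᶠ y in 𝓝 x, ⁅X, C.κ⁆ y ≠ 0 :=
    (⁅X, C.κ⁆ : Fn m M).contMDiff.continuous.continuousAt.eventually_ne hne
  have h1 : ∀ᶠ y in 𝓝 x, (C.e * C.κ) y = (Fn.const (1 - (u ^ 2)⁻¹) : Fn m M) y := by
    filter_upwards [hΩ, hne'] with y hy hy'
    have h2 := key y hy
    have h3 : u ^ 2 * (1 - (C.e * C.κ) y) = 1 := by
      refine mul_right_cancel₀ hy' ?_
      rw [one_mul]; exact h2.symm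
    have h4 : 1 - (C.e * C.κ) y = (u ^ 2)⁻¹ := eq_inv_of_mul_eq_one_right h3
    rw [Fn.const_apply]; linarith
  have h2 := (Fn.lie_eventuallyEq h1 X).self_of_nhds
  rw [Fn.lie_const, Fn.lie_mul, C.lie_e, zero_mul, add_zero] at h2
  have h3 : C.e x * ⁅X, C.κ⁆ x = 0 := h2
  have h4 : C.e x * C.e x = 1 := congrArg (fun f : Fn m M => f x) C.e_sq
  have h5 : C.e x ≠ 0 := fun h => by rw [h] at h4; simp at h4
  exact hne ((mul_eq_zero.1 h3).resolve_left h5)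

variable [ConnectedSpace M]

theorem κ_const_of_linear (hg : ∀ X Y x, C.g X Y x = G.inner x (X x) (Y x))
    (hV : ∀ x : M, ∃ V : Fld m M, C.φ V x ≠ 0) {u v : ℝ} (hu : C.μ = Fn.const u * C.κ + Fn.const v) :
    ∀ (T : Fld m M) (x : M), ⁅T, C.κ⁆ x = 0 := by
  -- The derivative of the square carries a factor `1 - eκ`, so it also vanishes where `eκ = 1`, and
  -- the boundary between the two regimes needs no separate treatment.
  have h1 : ∀ (T : Fld m M) (x : M), ⁅T, (1 - C.e * C.κ) * (1 - C.e * C.κ)⁆ x = 0 := fun T x => by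
    have e : ⁅T, (1 - C.e * C.κ) * (1 - C.e * C.κ)⁆ = 2 * ((1 - C.e * C.κ) * -(C.e * ⁅T, C.κ⁆)) := by
      rw [Fn.lie_mul, lie_sub, lie_one', Fn.lie_mul, C.lie_e]; ring
    rw [e, Fn.two_mul_apply]
    by_cases hx : (C.e * C.κ) x = 1
    · have : (1 - C.e * C.κ) x = 0 := by
        change 1 - (C.e * C.κ) x = 0
        rw [hx, sub_self]
      rw [Fn.mul_apply, this]; simp
    · have := C.lie_κ_eq_zero_of_ne hg hV hu hx T
      change 2 * ((1 - C.e * C.κ) x * -(C.e x * ⁅T, C.κ⁆ x)) = 0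
      rw [this]; simp
  obtain ⟨c, hc⟩ := Fn.exists_eq_const h1
  have hc' : ∀ x, (1 - (C.e * C.κ) x) * (1 - (C.e * C.κ) x) = c := hc
  intro T x
  by_cases h0 : c = 0
  · have h2 : C.e * C.κ = 1 := by
      ext y
      have := hc' y
      rw [h0, mul_self_eq_zero] at this
      change (C.e * C.κ) y = 1
      linarith
    have h3 : C.κ = C.e := by linear_combination C.e * h2 - C.κ * C.e_sq
    rw [h3, C.lie_e]; rfl
  · refine C.lie_κ_eq_zero_of_ne hg hV hu (fun h => h0 ?_) T
    rw [← hc' x, h]; simp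

/-- A nonzero horizontal derivative of `μ` at a point forces `eκ = 1` there, hence everywhere as `κ`
is constant. It persists nearby, so `ev_lie_μ` gives `s = 0` on an open set, and unique continuation
does the rest. -/
theorem μ_const_or_s_eq_zero (hg : ∀ X Y x, C.g X Y x = G.inner x (X x) (Y x))
    (hV : ∀ x : M, ∃ V : Fld m M, C.φ V x ≠ 0) {c : ℝ} (hκ : C.κ = Fn.const c)
    (he : ∀ x y, C.e x = C.e y) :
    (∀ (T : Fld m M) (x : M), ⁅T, C.μ⁆ x = 0) ∨ (C.e * C.κ = 1 ∧ ∀ X, C.s X = 0) := by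
  by_cases hhor : ∀ (X : Fld m M) (y : M), C.η X = 0 → ⁅X, C.μ⁆ y = 0
  · left
    intro T x
    obtain ⟨V, hVx⟩ := hV x
    exact C.lie_apply_eq_zero (C.lie_ξ_apply_eq_zero hg hVx hhor) (fun X hX => hhor X x hX) T
  push Not at hhor
  obtain ⟨X, x, hX, hne⟩ := hhor
  right
  have h1 : (C.e * C.κ) x = 1 := by
    by_contra hx
    have h2 := C.lie_κ_apply hg hx (C.η_φ (C.s X))
    rw [C.φ_s_φ_s hX, Fn.smul_lie_apply, hκ, Fn.lie_const] at h2
    have h3 : (1 - (C.e * C.κ) x) * ⁅X, C.μ⁆ x = 0 := by rw [hκ]; exact h2.symm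
    exact (mul_ne_zero (sub_ne_zero.2 (Ne.symm hx)) hne) h3
  have h2 : C.e * C.κ = 1 := by
    ext y
    rw [hκ] at h1 ⊢
    change C.e y * c = 1
    rw [he y x]; exact h1
  refine ⟨h2, ?_⟩
  have h3 : C.κ = C.e := by linear_combination C.e * h2 - C.κ * C.e_sq
  have hne' : ∀ᶠ y in 𝓝 x, ⁅X, C.μ⁆ y ≠ 0 :=
    (⁅X, C.μ⁆ : Fn m M).contMDiff.continuous.continuousAt.eventually_ne hne
  refine C.s_eq_zero_of_eventually hg (x₀ := x) (hne'.mono fun y hy X' Y' => ?_)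
  by_contra h
  rw [← C.s_hor, ← C.S_hor_right] at h
  exact hy (C.ev_lie_μ (Fn.ev y) h3 (C.η_hor X') (C.η_hor Y') h hX)

end Rigidity

end KappaMuAlgebra

/-! ### Nonvanishing of `φ` and the conclusion -/

section Main

variable {n : ℕ} {M : Type*} [TopologicalSpace M]
  [ChartedSpace (EuclideanSpace ℝ (Fin (2 * n + 1))) M] [IsManifold (𝓡 (2 * n + 1)) ∞ M]

namespace ContactPseudoMetric

variable (S : ContactPseudoMetric n M)

theorem finrank_tangentSpace (x : M) :
    Module.finrank ℝ (TangentSpace (𝓡 (2 * n + 1)) x) = 2 * n + 1 :=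
  (finrank_euclideanSpace_fin : Module.finrank ℝ (EuclideanSpace ℝ (Fin (2 * n + 1))) = 2 * n + 1)

/-- On a manifold of dimension one the structure is Sasakian. -/
theorem isSasakian_of_φ_eq_zero (h : ∀ x v, S.φ x v = 0) : S.IsSasakian := by
  intro X Y hX hY x
  have e := S.contact X Y hX hY x
  have h0 : ∀ X, S.φf X = 0 := fun X => by funext x; exact h x _
  rw [e, h, map_zero, mul_zero, zero_smul, add_zero, nijenhuis, h, h, h, h0, h0]
  simp [bracket]

/-- In dimension one `φ = 0` and the structure is Sasakian. In higher dimension `φ = 0` at a point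
would make every tangent vector there a multiple of `ξ`. -/
theorem exists_φ_ne_zero [T2Space M] (hS : ¬ S.IsSasakian) (x : M) :
    ∃ V : Fld (2 * n + 1) M, S.φL V x ≠ 0 := by
  have hn : n ≠ 0 := by
    rintro rfl
    refine hS (S.isSasakian_of_φ_eq_zero fun y v => ?_)
    have hξ : S.ξ y ≠ 0 := fun h => by
      have := S.η_ξ y
      rw [h, map_zero] at this
      exact zero_ne_one this
    obtain ⟨c, rfl⟩ := (finrank_eq_one_iff_of_nonzero' (S.ξ y) hξ).1 (finrank_tangentSpace y) v
    rw [map_smul, S.φ_ξ, smul_zero]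
  by_contra! h
  have h1 : Module.finrank ℝ (TangentSpace (𝓡 (2 * n + 1)) x) ≤ 1 := by
    refine finrank_le_one (S.ξ x) fun w => ⟨S.η x w, ?_⟩
    obtain ⟨V, rfl⟩ := exists_fld_apply_eq w
    have h2 := S.φ_φ x (V x)
    have h3 : S.φ x (V x) = 0 := h V
    rw [h3, map_zero] at h2
    linear_combination (norm := module) -h2
  rw [finrank_tangentSpace] at h1
  omega

end ContactPseudoMetric

end Main

end ContactPseudo

end

theorem mainTheorem7 (n : ℕ) (M : Type*) [TopologicalSpace M] [T2Space M]
    [SecondCountableTopology M] [ConnectedSpace M]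
    [ChartedSpace (EuclideanSpace ℝ (Fin (2 * n + 1))) M] [IsManifold (𝓡 (2 * n + 1)) ∞ M]
    (S : ContactPseudo.ContactPseudoMetric n M) (hS : ¬ S.IsSasakian)
    (κ μ : M → ℝ) (hκμ : S.IsGeneralizedKappaMu κ μ)
    (a b c : ℝ) (hab : a ≠ 0 ∨ b ≠ 0) (hlin : ∀ x, a * κ x + b * μ x = c) :
    (∃ κ₀ : ℝ, ∀ x, κ x = κ₀) ∧ (∃ μ₀ : ℝ, ∀ x, μ x = μ₀) := by
  let C := S.toKappaMuAlgebra hκμ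
  have hg : ∀ X Y x, C.g X Y x = S.g.inner x (X x) (Y x) := fun _ _ _ => rfl
  have hV := S.exists_φ_ne_zero hS
  by_cases hb : b = 0
  · have ha : a ≠ 0 := hab.resolve_right (not_not.2 hb)
    have hκ : ∀ x, κ x = c / a := fun x => by
      rw [eq_div_iff ha, ← hlin x, hb]; ring
    have hκ' : C.κ = ContactPseudo.Fn.const (c / a) := by ext x; exact hκ x
    refine ⟨⟨_, hκ⟩, ?_⟩
    rcases C.μ_const_or_s_eq_zero hg hV hκ' (fun _ _ => rfl) with h | ⟨h1, h2⟩
    · exact ContactPseudo.Fn.exists_eq_const h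
    -- The alternative `s = 0`, `εκ = 1` makes the structure normal, contrary to hypothesis.
    · refine absurd (fun X Y hX hY x => ?_) hS
      have h := C.nijenhuis_eq_zero h2 h1 hX.toFld hY.toFld
      rw [two_mul (C.g _ _), add_smul] at h
      rw [S.contact X Y hX hY, two_mul (S.g.inner _ _ _), add_smul]
      exact congrArg (fun F : ContactPseudo.Fld (2 * n + 1) M => F x) h
  · have hμ : ∀ x, μ x = -a / b * κ x + c / b := fun x => by
      field_simp; linarith [hlin x]
    have hμ' : C.μ = ContactPseudo.Fn.const (-a / b) * C.κ + ContactPseudo.Fn.const (c / b) := by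
      ext x; exact hμ x
    obtain ⟨κ₀, hκ₀⟩ := ContactPseudo.Fn.exists_eq_const (C.κ_const_of_linear hg hV hμ')
    have hκ₀' : ∀ x, κ x = κ₀ := hκ₀
    exact ⟨⟨κ₀, hκ₀'⟩, ⟨-a / b * κ₀ + c / b, fun x => by rw [hμ, hκ₀']⟩⟩
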